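/- Let $N\in\mathbb N$, $1<p<N$, $p^*=Np/(N-p)$ and $0\le\mu<\bar\mu=\left((N-p)/p\right)^p$. Let $\Omega\subset\mathbb R^N$ be an exterior domain, i.e. a nonempty connected open set whose complement $\Omega^c=\mathbb R^N\setminus\Omega$ is bounded, and assume that the compact set $\Omega^c$ has positive $p$-capacity: $$\inf\Big\{\int_{\mathbb R^N}|\nabla\varphi|^p:\ \varphi\in C_0^\infty(\mathbb R^N),\ \varphi\ge1\text{ on }\Omega^c\Big\}>0 .$$ Let $\mathcal D^{1,p}(\Omega)$ be the space of weakly differentiable $w\in L^{p^*}(\Omega)$ with $\nabla w\in L^p(\Omega)$, and let $\mathcal D^{1,p}_0(\Omega)$ be the set of $w\in\mathcal D^{1,p}(\Omega)$ for which there are $\varphi_k\in C_0^\infty(\Omega)$ with $\varphi_k\to w$ in $L^{p^*}(\Omega)$ and $\nabla\varphi_k\to\nabla w$ in $L^p(\Omega)$. For functions $a,b$ on $\Omega$, "$a\le b$ on $\partial\Omega$" means that $\chi\,(a-b)^+\in\mathcal D^{1,p}_0(\Omega)$ for some $\chi\in C_0^\infty(\mathbb R^N)$ with $\chi=1$ in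 a neighbourhood of $\partial\Omega$; "$\inf_{\partial\Omega}v>0$" means that there is a constant $c>0$ with $c\le v$ on $\partial\Omega$ in this sense. For $h\in L^{N/p}(\Omega)$, a function $w\in\mathcal D^{1,p}(\Omega)$ is a weak subsolution of $$-\Delta_p w-\frac{\mu}{|x|^p}|w|^{p-2}w=h|w|^{p-2}w\quad\text{in }\Omega$$ if for every nonnegative $\varphi\in C_0^\infty(\Omega)$ $$\int_\Omega\Big(|\nabla w|^{p-2}\nabla w\cdot\nabla\varphi-\frac{\mu}{|x|^p}|w|^{p-2}w\,\varphi\Big)\le\int_\Omega h|w|^{p-2}w\,\varphi ,$$ and a weak supersolution if $-w$ is a weak subsolution. Let $f,g\in L^{N/p}(\Omega)$ with $f\le g$ a.e. in $\Omega$. Let $u\in\mathcal D^{1,p}(\Omega)$ be a weak subsolution of the equation with $h=f$, and let $v\in\mathcal D^{1,p}(\Omega)$ be a weak supersolution of the equation with $h=g$ such that $v>0$ a.e. in $\Omega$ and $\inf_{\partial\Omega}v>0$. Assume, with $u^+=\max(u,0)$, $|\nabla\log v|=|\nabla v|/v$ and $B_R$ the open ball of radius $R$ centred at the origin, that $$\limsup_{R\to\infty}\frac1R\int_{B_{2R}\setminus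 B_R}(u^+)^p\,|\nabla\log v|^{p-1}\,dx=0 .$$ If $u\le v$ on $\partial\Omega$, then $u\le v$ a.e. in $\Omega$. -/

import Mathlib

open MeasureTheory Filter Topology
open scoped ContDiff

noncomputable section

/-- `φ ∈ C₀^∞(Ω)`. -/
def IsTestFunction {N : ℕ} (Ω : Set (EuclideanSpace ℝ (Fin N)))
    (φ : EuclideanSpace ℝ (Fin N) → ℝ) : Prop :=
  ContDiff ℝ ∞ φ ∧ HasCompactSupport φ ∧ tsupport φ ⊆ Ω

/-- `G` is a weak gradient of `u` in `Ω`. -/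
def HasWeakGradient {N : ℕ} (Ω : Set (EuclideanSpace ℝ (Fin N)))
    (u : EuclideanSpace ℝ (Fin N) → ℝ)
    (G : EuclideanSpace ℝ (Fin N) → EuclideanSpace ℝ (Fin N)) : Prop :=
  LocallyIntegrableOn u Ω ∧ LocallyIntegrableOn G Ω ∧
    ∀ φ : EuclideanSpace ℝ (Fin N) → ℝ, IsTestFunction Ω φ →
      ∫ x in Ω, u x • gradient φ x = -∫ x in Ω, φ x • G x

open Classical in
/-- The weak gradient of `u` in `Ω` (unique almost everywhere in an open set `Ω`);
it is `0` by convention if `u` is not weakly differentiable in `Ω`. -/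
def weakGrad {N : ℕ} (Ω : Set (EuclideanSpace ℝ (Fin N)))
    (u : EuclideanSpace ℝ (Fin N) → ℝ) :
    EuclideanSpace ℝ (Fin N) → EuclideanSpace ℝ (Fin N) :=
  if h : ∃ G, HasWeakGradient Ω u G then h.choose else 0

/-- The critical Sobolev exponent `p* = N p / (N - p)`. -/
def sobolevExponent (N : ℕ) (p : ℝ) : ℝ := N * p / (N - p)

/-- `u ∈ D^{1,p}(Ω)`: `u ∈ L^{p*}(Ω)` is weakly differentiable and `∇u ∈ L^p(Ω)`. -/
def MemD1p {N : ℕ} (p : ℝ) (Ω : Set (EuclideanSpace ℝ (Fin N)))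
    (u : EuclideanSpace ℝ (Fin N) → ℝ) : Prop :=
  MemLp u (ENNReal.ofReal (sobolevExponent N p)) (volume.restrict Ω) ∧
    (∃ G, HasWeakGradient Ω u G) ∧
    MemLp (weakGrad Ω u) (ENNReal.ofReal p) (volume.restrict Ω)

/-- `w ∈ D₀^{1,p}(Ω)`: `w` is a limit of functions in `C₀^∞(Ω)`, in `L^{p*}(Ω)` and with
gradients converging in `L^p(Ω)`. -/
def MemD1pZero {N : ℕ} (p : ℝ) (Ω : Set (EuclideanSpace ℝ (Fin N)))
    (w : EuclideanSpace ℝ (Fin N) → ℝ) : Prop :=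
  MemD1p p Ω w ∧ ∃ φ : ℕ → EuclideanSpace ℝ (Fin N) → ℝ,
    (∀ k, IsTestFunction Ω (φ k)) ∧
    Tendsto (fun k => eLpNorm (fun x => w x - φ k x)
      (ENNReal.ofReal (sobolevExponent N p)) (volume.restrict Ω)) atTop (𝓝 0) ∧
    Tendsto (fun k => eLpNorm (fun x => weakGrad Ω w x - gradient (φ k) x)
      (ENNReal.ofReal p) (volume.restrict Ω)) atTop (𝓝 0)

/-- `a ≤ b` on `∂Ω` in the Sobolev sense, for `Ω` with compact boundary: the function `(a - b)⁺`,
cut off away from `∂Ω`, belongs to `D₀^{1,p}(Ω)`. The cut-off makes the notion meaningful also for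
functions, such as positive constants, that are not in `D^{1,p}(Ω)` because of their
behaviour at infinity. -/
def LEOnBoundary {N : ℕ} (p : ℝ) (Ω : Set (EuclideanSpace ℝ (Fin N)))
    (a b : EuclideanSpace ℝ (Fin N) → ℝ) : Prop :=
  ∃ χ : EuclideanSpace ℝ (Fin N) → ℝ, ContDiff ℝ ∞ χ ∧ HasCompactSupport χ ∧
    (∀ᶠ x in 𝓝ˢ (frontier Ω), χ x = 1) ∧
    MemD1pZero p Ω (fun x => χ x * max (a x - b x) 0)

/-- The variational `p`-capacity of a compact set `K ⊆ ℝ^N`: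
`inf {∫ |∇φ|^p : φ ∈ C₀^∞(ℝ^N), φ ≥ 1 on K}`. -/
def pCapacity {N : ℕ} (p : ℝ) (K : Set (EuclideanSpace ℝ (Fin N))) : ENNReal :=
  ⨅ (φ : EuclideanSpace ℝ (Fin N) → ℝ)
    (_ : ContDiff ℝ ∞ φ ∧ HasCompactSupport φ ∧ ∀ x ∈ K, 1 ≤ φ x),
    ∫⁻ x, ‖gradient φ x‖ₑ ^ p

/-- `u ∈ D^{1,p}(Ω)` is a weak subsolution in `Ω` of
`-Δ_p u - μ |x|^{-p} |u|^{p-2} u = f |u|^{p-2} u`. -/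
def IsWeakSubsolution {N : ℕ} (p μ : ℝ) (Ω : Set (EuclideanSpace ℝ (Fin N)))
    (f u : EuclideanSpace ℝ (Fin N) → ℝ) : Prop :=
  MemD1p p Ω u ∧
    ∀ φ : EuclideanSpace ℝ (Fin N) → ℝ, IsTestFunction Ω φ → (∀ x, 0 ≤ φ x) →
      ∫ x in Ω, (‖weakGrad Ω u x‖ ^ (p - 2) * inner ℝ (weakGrad Ω u x) (gradient φ x)
          - μ / ‖x‖ ^ p * (|u x| ^ (p - 2) * u x) * φ x)
        ≤ ∫ x in Ω, f x * (|u x| ^ (p - 2) * u x) * φ x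

/-- `u` is a weak supersolution if `-u` is a weak subsolution. -/
def IsWeakSupersolution {N : ℕ} (p μ : ℝ) (Ω : Set (EuclideanSpace ℝ (Fin N)))
    (f u : EuclideanSpace ℝ (Fin N) → ℝ) : Prop :=
  IsWeakSubsolution p μ Ω f (fun x => -u x)

end

/-! On the set where u > v the two functions are compared through their logarithms. Formally, put D
= (u - v)⁺, test the inequality for u with D^p / u^(p-1) and the one for v with D^p / v^(p-1). In
the zero-order terms both tests produce D^p, so the Hardy terms cancel and f ≤ g gives the
potentials the favourable sign. The principal parts add up to p u D^(p-1) 𝔅(∇u/u, ∇v/v) + p v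
D^(p-1) 𝔅(∇v/v, ∇u/u), where 𝔅 is the Bregman distance of |·|^p / p (`bregman`). It is nonnegative
and vanishes only when its two arguments coincide. Hence ∇ log u = ∇ log v almost everywhere on {u >
v} (`ae_log_gradient_eq`).

To make these tests admissible, D is replaced by (k u / (k + |u|) - v - ε)⁺ (`gapPart`) and a
cut-off η at scale R is inserted. The truncation makes the tests bounded; the shift ε keeps the
denominators away from zero and makes the tests vanish near ∂Ω wherever (u - v)⁺ < ε. On the
remaining set the approximants of (u - v)⁺ from C₀^∞(Ω) provide cut-offs Θ near the boundary whose
gradients tend to zero in L^p (`exists_boundary_cutoff`). The price is `energyError`: a truncation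
error that disappears as k → ∞, a zero-order error with factor 1 - (v/(v+ε))^(p-1) that disappears
as ε → 0, and two terms with |∇η|. Of these, u⁺|∇u|^(p-1)|∇η| tends to zero by Hölder's inequality
with exponents p*, p/(p-1), N, and (u⁺)^p |∇ log v|^(p-1) |∇η| by the growth hypothesis.

Rigidity follows: ((u - v)⁺/u)² has zero weak gradient (`hasWeakGradient_ratio_zero`), so it is
constant on the connected set Ω. Its weak differentiability comes from a limit ε → 0 that is
dominated because |∇ log v| is locally integrable, by the logarithmic estimate for positive
supersolutions. If the constant is 0, then u ≤ v. Otherwise u = κ v with κ > 1 throughout Ω; then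
(κ-1)⁻¹ (u - v)⁺ + (c - v)⁺ = v + (c - v)⁺ ≥ c has zero boundary values by the two boundary
hypotheses, and its approximants yield competitors of vanishing energy for the capacity of Ωᶜ,
contradicting positive capacity (`pCapacity_compl_eq_zero_of_ae_eq_mul`). -/

/-! ### Mollification: L^p bounds, convergence, commutation with weak gradients. -/

section Mollification

/-- A sequence of bump functions at the origin with radii `1 / (n + 1)`. -/
noncomputable def mollifierBump (E : Type*) [NormedAddCommGroup E] [InnerProductSpace ℝ E]
    [FiniteDimensional ℝ E] (n : ℕ) : ContDiffBump (0 : E) where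
  rIn := 1 / (2 * ((n : ℝ) + 1))
  rOut := 1 / ((n : ℝ) + 1)
  rIn_pos := by positivity
  rIn_lt_rOut := by
    apply one_div_lt_one_div_of_lt <;> nlinarith [(Nat.cast_nonneg n : (0 : ℝ) ≤ n)]

lemma tendsto_mollifierBump_rOut {E : Type*} [NormedAddCommGroup E]
    [InnerProductSpace ℝ E] [FiniteDimensional ℝ E] :
    Tendsto (fun n => (mollifierBump E n).rOut) atTop (𝓝 0) :=
  tendsto_one_div_add_atTop_nhds_zero_nat

variable {E : Type*} [NormedAddCommGroup E] [InnerProductSpace ℝ E] [FiniteDimensional ℝ E]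
  [MeasurableSpace E] [BorelSpace E]

/-- The standard mollification of `f` at scale `1 / (n + 1)`. -/
noncomputable def mollify {F : Type*} [NormedAddCommGroup F] [NormedSpace ℝ F] (n : ℕ)
    (f : E → F) : E → F :=
  convolution ((mollifierBump E n).normed volume) f (ContinuousLinearMap.lsmul ℝ ℝ) volume

variable {F : Type*} [NormedAddCommGroup F] [NormedSpace ℝ F]

lemma mollify_apply (n : ℕ) (f : E → F) (x : E) :
    mollify n f x = ∫ t, (mollifierBump E n).normed volume t • f (x - t) := rfl

lemma mollify_apply' (n : ℕ) (f : E → F) (x : E) :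
    mollify n f x = ∫ t, (mollifierBump E n).normed volume (x - t) • f t := by
  unfold mollify
  rw [convolution_eq_swap]
  rfl

lemma contDiff_mollify [CompleteSpace F] (n : ℕ) {f : E → F} (hf : LocallyIntegrable f) :
    ContDiff ℝ ∞ (mollify n f) :=
  (mollifierBump E n).hasCompactSupport_normed.contDiff_convolution_left _
    (mollifierBump E n).contDiff_normed hf

lemma support_mollify_subset (n : ℕ) (f : E → F) :
    Function.support (mollify n f) ⊆ Metric.cthickening (1 / ((n : ℝ) + 1)) (tsupport f) := by
  intro x hx
  have h := support_convolution_subset (L := ContinuousLinearMap.lsmul ℝ ℝ) (μ := volume) hx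
  rw [ContDiffBump.support_normed_eq] at h
  obtain ⟨a, ha, b, hb, rfl⟩ := h
  refine Metric.mem_cthickening_of_dist_le _ b _ _ (subset_tsupport f hb) ?_
  have : ‖a‖ < 1 / ((n : ℝ) + 1) := by simpa [mollifierBump] using ha
  simpa [dist_eq_norm] using this.le

lemma tsupport_mollify_subset (n : ℕ) (f : E → F) :
    tsupport (mollify n f) ⊆ Metric.cthickening (1 / ((n : ℝ) + 1)) (tsupport f) :=
  closure_minimal (support_mollify_subset n f) Metric.isClosed_cthickening

lemma hasCompactSupport_mollify (n : ℕ) {f : E → F} (hf : HasCompactSupport f) :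
    HasCompactSupport (mollify n f) :=
  HasCompactSupport.convolution _ (mollifierBump E n).hasCompactSupport_normed hf

lemma mollify_nonneg (n : ℕ) {f : E → ℝ} (hf : ∀ᵐ x, 0 ≤ f x) (x : E) : 0 ≤ mollify n f x := by
  rw [mollify_apply']
  refine integral_nonneg_of_ae ?_
  filter_upwards [hf] with t ht
  exact mul_nonneg (ContDiffBump.nonneg_normed _ _) ht

lemma norm_mollify_le (n : ℕ) {f : E → F} {C : ℝ} (hf : ∀ᵐ x, ‖f x‖ ≤ C) (x : E) :
    ‖mollify n f x‖ ≤ C := by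
  rw [mollify_apply']
  have hint : Integrable (fun t => (mollifierBump E n).normed volume (x - t)) :=
    ((mollifierBump E n).integrable_normed).comp_sub_left x
  calc _ ≤ ∫ t, (mollifierBump E n).normed volume (x - t) * C := by
        refine norm_integral_le_of_norm_le (hint.mul_const C) ?_
        filter_upwards [hf] with t ht
        rw [norm_smul, Real.norm_of_nonneg (ContDiffBump.nonneg_normed _ _)]
        exact mul_le_mul_of_nonneg_left ht (ContDiffBump.nonneg_normed _ _)
    _ = C := by
        rw [integral_mul_const, integral_sub_left_eq_self
          (fun t => (mollifierBump E n).normed volume t), ContDiffBump.integral_normed, one_mul]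

lemma mollify_sub (n : ℕ) {f g : E → F} (hf : LocallyIntegrable f) (hg : LocallyIntegrable g)
    (x : E) : mollify n (f - g) x = mollify n f x - mollify n g x := by
  have key : ∀ {h : E → F}, LocallyIntegrable h →
      Integrable fun t => (mollifierBump E n).normed volume (x - t) • h t := by
    intro h hh
    refine hh.integrable_smul_left_of_hasCompactSupport
      ((ContDiffBump.continuous_normed _).comp (by fun_prop)) ?_
    exact (mollifierBump E n).hasCompactSupport_normed.comp_homeomorph (Homeomorph.subLeft x)
  simp only [mollify_apply', Pi.sub_apply, smul_sub]
  exact integral_sub (key hf) (key hg)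

/-- Mollification averages translates of f against the probability measure with density ρ.
Monotonicity of L^q norms on a probability space bounds the q-th power of the average by the average
of q-th powers; Tonelli and translation invariance finish. -/
lemma eLpNorm_mollify_le (n : ℕ) {f : E → F} {q : ENNReal} (hq : 1 ≤ q) (hq' : q ≠ ⊤)
    (hf : AEStronglyMeasurable f) : eLpNorm (mollify n f) q ≤ eLpNorm f q := by
  set ρ := (mollifierBump E n).normed (volume : Measure E) with hρ
  have hρc : Continuous ρ := ContDiffBump.continuous_normed _
  have hρ0 : ∀ t, 0 ≤ ρ t := ContDiffBump.nonneg_normed _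
  set ν : Measure E := volume.withDensity (fun t => ENNReal.ofReal (ρ t)) with hν
  have hm : Measurable fun t => ENNReal.ofReal (ρ t) := hρc.measurable.ennreal_ofReal
  have hprob : IsProbabilityMeasure ν := by
    constructor
    rw [hν, withDensity_apply _ MeasurableSet.univ, Measure.restrict_univ,
      ← ofReal_integral_eq_lintegral_ofReal (ContDiffBump.integrable_normed _)
        (Eventually.of_forall hρ0), ContDiffBump.integral_normed, ENNReal.ofReal_one]
  have hac : ν ≪ volume := withDensity_absolutelyContinuous _ _
  have hq0 : q ≠ 0 := (zero_lt_one.trans_le hq).ne'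
  have hpos : 0 < q.toReal := ENNReal.toReal_pos hq0 hq'
  have hmx : ∀ x, AEStronglyMeasurable (fun t => f (x - t)) volume := fun x =>
    hf.comp_quasiMeasurePreserving (quasiMeasurePreserving_sub_left volume x)
  have hpt : ∀ x, ‖mollify n f x‖ₑ ^ q.toReal ≤ ∫⁻ t, ‖f (x - t)‖ₑ ^ q.toReal ∂ν := by
    intro x
    have h1 : ‖mollify n f x‖ₑ ≤ eLpNorm (fun t => f (x - t)) 1 ν := by
      rw [mollify_apply, eLpNorm_one_eq_lintegral_enorm, hν,
        lintegral_withDensity_eq_lintegral_mul₀ hm.aemeasurable (hmx x).enorm]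
      refine (enorm_integral_le_lintegral_enorm _).trans (lintegral_mono fun t => ?_)
      simp only [Pi.mul_apply, enorm_smul]
      rw [Real.enorm_of_nonneg (hρ0 t)]
    have h2 := eLpNorm_le_eLpNorm_of_exponent_le hq ((hmx x).mono_ac hac)
    calc _ ≤ (eLpNorm (fun t => f (x - t)) q ν) ^ q.toReal :=
          ENNReal.rpow_le_rpow (h1.trans h2) hpos.le
      _ = _ := by
          rw [eLpNorm_eq_lintegral_rpow_enorm_toReal hq0 hq', ← ENNReal.rpow_mul,
            one_div_mul_cancel hpos.ne', ENNReal.rpow_one]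
  rw [eLpNorm_eq_lintegral_rpow_enorm_toReal hq0 hq', eLpNorm_eq_lintegral_rpow_enorm_toReal hq0 hq']
  refine ENNReal.rpow_le_rpow ?_ (by positivity)
  calc _ ≤ ∫⁻ x, ∫⁻ t, ‖f (x - t)‖ₑ ^ q.toReal ∂ν := lintegral_mono hpt
    _ = ∫⁻ t, (∫⁻ x, ‖f (x - t)‖ₑ ^ q.toReal) ∂ν := by
        rw [lintegral_lintegral_swap]
        have hqmp : Measure.QuasiMeasurePreserving (fun z : E × E => z.1 - z.2)
            ((volume : Measure E).prod ν) volume := by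
          refine (quasiMeasurePreserving_sub volume volume).mono_left ?_
          exact Measure.AbsolutelyContinuous.rfl.prod hac
        exact ((hf.comp_quasiMeasurePreserving hqmp).enorm.pow_const _)
    _ = ∫⁻ t, (∫⁻ x, ‖f x‖ₑ ^ q.toReal) ∂ν := by
        congr 1 with t
        exact lintegral_sub_right_eq_self (fun x => ‖f x‖ₑ ^ q.toReal) t
    _ = _ := by simp

/-- Uniform continuity gives uniform convergence, and all differences live in one compact set of
finite measure, namely the 1-thickening of the support. -/
lemma tendsto_eLpNorm_mollify_sub_of_continuous [CompleteSpace F] {g : E → F} (hg : Continuous g)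
    (hgc : HasCompactSupport g) {q : ENNReal} :
    Tendsto (fun n => eLpNorm (fun x => mollify n g x - g x) q) atTop (𝓝 0) := by
  set K := Metric.cthickening 1 (tsupport g) with hK
  have hKc : IsCompact K := hgc.isCompact.cthickening
  have hKf : volume K ^ (1 / q.toReal) ≠ ⊤ :=
    ENNReal.rpow_ne_top_of_nonneg (by positivity) hKc.measure_lt_top.ne
  have huc : UniformContinuous g := hgc.uniformContinuous_of_continuous hg
  have hsupp : ∀ n x, x ∉ K → mollify n g x - g x = 0 := by
    intro n x hx
    have h1 : x ∉ Function.support (mollify n g) := fun h => hx <|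
      Metric.cthickening_mono (by
        rw [div_le_one (by positivity)]
        linarith [(Nat.cast_nonneg n : (0 : ℝ) ≤ n)]) _ (support_mollify_subset n g h)
    have h2 : x ∉ Function.support g := fun h => hx <|
      Metric.self_subset_cthickening _ (subset_tsupport g h)
    rw [Function.notMem_support.1 h1, Function.notMem_support.1 h2, sub_zero]
  have hb : ∀ δ : ℝ, 0 < δ → ∀ᶠ n in atTop,
      eLpNorm (fun x => mollify n g x - g x) q ≤ volume K ^ (1 / q.toReal) * ENNReal.ofReal δ := by
    intro δ hδ
    obtain ⟨r, hr, hr'⟩ := Metric.uniformContinuous_iff.1 huc δ hδ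
    filter_upwards [(tendsto_mollifierBump_rOut (E := E)).eventually (gt_mem_nhds hr)] with n hn
    have hle : ∀ x, ‖mollify n g x - g x‖ ≤ δ := by
      intro x
      rw [← dist_eq_norm]
      refine ContDiffBump.dist_normed_convolution_le hg.aestronglyMeasurable fun y hy => ?_
      exact (hr' ((Metric.mem_ball.1 hy).trans hn)).le
    have heq : (fun x => mollify n g x - g x) = K.indicator (fun x => mollify n g x - g x) := by
      ext x
      by_cases hx : x ∈ K
      · rw [Set.indicator_of_mem hx]
      · rw [Set.indicator_of_notMem hx, hsupp n x hx]
    rw [heq, eLpNorm_indicator_eq_eLpNorm_restrict hKc.measurableSet]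
    refine (eLpNorm_le_of_ae_bound (C := δ) (Eventually.of_forall hle)).trans ?_
    rw [Measure.restrict_apply_univ, one_div]
  refine ENNReal.tendsto_nhds_zero.2 fun ε hε => ?_
  have hlim : Tendsto (fun δ : ℝ => volume K ^ (1 / q.toReal) * ENNReal.ofReal δ) (𝓝[>] 0) (𝓝 0) := by
    have : Tendsto (fun δ : ℝ => ENNReal.ofReal δ) (𝓝[>] 0) (𝓝 0) := by
      have := (ENNReal.continuous_ofReal.tendsto 0).mono_left (nhdsWithin_le_nhds (s := Set.Ioi 0))
      simpa using this
    simpa using ENNReal.Tendsto.const_mul this (Or.inr hKf)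
  obtain ⟨δ, h1, h2⟩ := ((hlim.eventually (ge_mem_nhds hε)).and self_mem_nhdsWithin).exists
  filter_upwards [hb δ h2] with n hn
  exact hn.trans h1

/-- Density of continuous compactly supported functions, with the contraction bound
`eLpNorm_mollify_le` controlling the mollified remainder: three errors of size ε / 3. -/
lemma tendsto_eLpNorm_mollify_sub [CompleteSpace F] {f : E → F} {q : ENNReal} (hq : 1 ≤ q)
    (hq' : q ≠ ⊤) (hf : MemLp f q) :
    Tendsto (fun n => eLpNorm (fun x => mollify n f x - f x) q) atTop (𝓝 0) := by
  refine ENNReal.tendsto_nhds_zero.2 fun ε hε => ?_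
  have hε3 : ε / 3 ≠ 0 := (ENNReal.div_pos hε.ne' (by norm_num)).ne'
  obtain ⟨g, hgs, hfg, hg, hgm⟩ := hf.exists_hasCompactSupport_eLpNorm_sub_le hq' hε3
  have hgl : LocallyIntegrable g := hgm.locallyIntegrable hq
  have hfl : LocallyIntegrable f := hf.locallyIntegrable hq
  filter_upwards [(tendsto_eLpNorm_mollify_sub_of_continuous hg hgs).eventually
    (ge_mem_nhds (pos_iff_ne_zero.2 hε3))] with n hn
  have h1 : (fun x => mollify n f x - f x)
      = mollify n (f - g) + ((fun x => mollify n g x - g x) + (g - f)) := by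
    ext x
    simp only [Pi.add_apply, Pi.sub_apply, mollify_sub n hfl hgl]
    abel
  have m1 : AEStronglyMeasurable (mollify n (f - g)) volume :=
    (contDiff_mollify n (hfl.sub hgl)).continuous.aestronglyMeasurable
  have m2 : AEStronglyMeasurable (fun x => mollify n g x - g x) volume :=
    ((contDiff_mollify n hgl).continuous.sub hg).aestronglyMeasurable
  have m3 : AEStronglyMeasurable (g - f) volume := hgm.1.sub hf.1
  have b1 : eLpNorm (mollify n (f - g)) q ≤ ε / 3 :=
    (eLpNorm_mollify_le n hq hq' (hf.1.sub hgm.1)).trans hfg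
  have b3 : eLpNorm (g - f) q ≤ ε / 3 := by
    rw [eLpNorm_sub_comm]
    exact hfg
  have t1 := eLpNorm_add_le m1 (m2.add m3) hq
  have t2 := eLpNorm_add_le m2 m3 hq
  rw [h1]
  refine t1.trans ((add_le_add b1 (t2.trans (add_le_add hn b3))).trans ?_)
  rw [← add_assoc, ENNReal.add_thirds]

/-- Weak differentiation commutes with mollification. -/
lemma hasGradientAt_mollify (n : ℕ) {f : E → ℝ} {G : E → E}
    (hf : LocallyIntegrable f) (hG : LocallyIntegrable G)
    (hw : ∀ φ : E → ℝ, ContDiff ℝ ∞ φ → HasCompactSupport φ →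
      ∫ x, f x • gradient φ x = -∫ x, φ x • G x) (x : E) :
    HasGradientAt (mollify n f) (mollify n G x) x := by
  set ρ := (mollifierBump E n).normed (volume : Measure E) with hρ
  have hρd : ContDiff ℝ ∞ ρ := ContDiffBump.contDiff_normed _
  have hρs : HasCompactSupport ρ := ContDiffBump.hasCompactSupport_normed _
  have hD := hρs.hasFDerivAt_convolution_left (ContinuousLinearMap.lsmul ℝ ℝ)
    (hρd.of_le (by simp)) hf x
  set ψ : E → ℝ := fun t => ρ (x - t) with hψ
  have hψd : ContDiff ℝ ∞ ψ := hρd.comp (contDiff_const.sub contDiff_id)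
  have hψs : HasCompactSupport ψ := hρs.comp_homeomorph (Homeomorph.subLeft x)
  -- The derivative falls on the kernel. Seen as a function of t, ρ(x - t) is a test function whose
  -- gradient has the opposite sign, and this sign cancels the one in the definition of the weak
  -- gradient.
  have hgrad : ∀ t y, fderiv ℝ ρ (x - t) y = - inner ℝ (gradient ψ t) y := by
    intro t y
    have h1 : HasFDerivAt ψ (-(fderiv ℝ ρ (x - t))) t := by
      have := ((hρd.differentiable (by simp)) (x - t)).hasFDerivAt.comp t
        ((hasFDerivAt_id t).const_sub x)
      refine this.congr_fderiv ?_
      ext y; simp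
    rw [show inner ℝ (gradient ψ t) y = fderiv ℝ ψ t y by simp [gradient], h1.fderiv]
    simp
  have hψg : Continuous (gradient ψ) :=
    (InnerProductSpace.toDual ℝ E).symm.continuous.comp (hψd.continuous_fderiv (by simp))
  have hψgs : HasCompactSupport (gradient ψ) :=
    (hψs.fderiv ℝ).comp_left (g := (InnerProductSpace.toDual ℝ E).symm) (map_zero _)
  have hint : Integrable fun t => f t • gradient ψ t :=
    hf.integrable_smul_right_of_hasCompactSupport hψg hψgs
  have hint2 : Integrable fun t => ψ t • G t :=
    hG.integrable_smul_left_of_hasCompactSupport hψd.continuous hψs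
  have hw' := hw ψ hψd hψs
  rw [hasGradientAt_iff_hasFDerivAt]
  refine HasFDerivAt.congr_fderiv hD ?_
  ext y
  rw [InnerProductSpace.toDual_apply_apply, mollify_apply', convolution_eq_swap]
  have hex : Integrable fun t => (ContinuousLinearMap.precompL E
      (ContinuousLinearMap.lsmul ℝ ℝ : ℝ →L[ℝ] ℝ →L[ℝ] ℝ)) (fderiv ℝ ρ (x - t)) (f t) := by
    have := ((hρs.fderiv ℝ).convolutionExists_left (ContinuousLinearMap.precompL E
      (ContinuousLinearMap.lsmul ℝ ℝ : ℝ →L[ℝ] ℝ →L[ℝ] ℝ)) (hρd.continuous_fderiv (by simp)) hf x)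
    exact this.integrable_swap
  rw [ContinuousLinearMap.integral_apply hex]
  have e1 : ∀ t, (((ContinuousLinearMap.precompL E
      (ContinuousLinearMap.lsmul ℝ ℝ : ℝ →L[ℝ] ℝ →L[ℝ] ℝ)) (fderiv ℝ ρ (x - t)) (f t)) y)
      = - inner ℝ y (f t • gradient ψ t) := by
    intro t
    rw [ContinuousLinearMap.precompL_apply, ContinuousLinearMap.lsmul_apply, hgrad, inner_smul_right,
      real_inner_comm, smul_eq_mul]
    ring
  simp only [e1]
  rw [integral_neg, integral_inner hint, hw', inner_neg_right, neg_neg, real_inner_comm]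

end Mollification

/-! ### Weak gradients: products with test functions, uniqueness. -/

section WeakGradient

variable {N : ℕ}

local notation "𝔼" => EuclideanSpace ℝ (Fin N)

lemma exists_smooth_cutoff {K U : Set 𝔼} (hK : IsCompact K) (hU : IsOpen U) (hKU : K ⊆ U) :
    ∃ ξ : 𝔼 → ℝ, IsTestFunction U ξ ∧ (∀ᶠ x in 𝓝ˢ K, ξ x = 1) ∧ ∀ x, ξ x ∈ Set.Icc 0 1 := by
  obtain ⟨L, hL, hKL, hLU⟩ := exists_compact_between hK hU hKU
  obtain ⟨f, h1, h0, hf⟩ := exists_contMDiffMap_one_nhds_of_subset_interior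
    (modelWithCornersSelf ℝ 𝔼) (n := ⊤) hK.isClosed hKL
  have hsub : tsupport f ⊆ L := by
    refine closure_minimal (fun x hx => ?_) hL.isClosed
    by_contra hxL
    exact hx (h0 x hxL)
  exact ⟨f, ⟨f.contMDiff.contDiff, hL.of_isClosed_subset (isClosed_tsupport _) hsub,
    hsub.trans hLU⟩, h1, hf⟩

lemma ContDiff.continuous_gradient {φ : 𝔼 → ℝ} (h : ContDiff ℝ ∞ φ) : Continuous (gradient φ) :=
  (InnerProductSpace.toDual ℝ 𝔼).symm.continuous.comp (h.continuous_fderiv (by simp))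

lemma HasCompactSupport.gradient {φ : 𝔼 → ℝ} (h : HasCompactSupport φ) :
    HasCompactSupport (gradient φ) :=
  (h.fderiv ℝ).comp_left (g := (InnerProductSpace.toDual ℝ 𝔼).symm) (map_zero _)

lemma tsupport_gradient_subset (φ : 𝔼 → ℝ) : tsupport (gradient φ) ⊆ tsupport φ := by
  refine (closure_mono ?_).trans (tsupport_fderiv_subset ℝ (f := φ))
  intro x hx
  refine Function.mem_support.2 fun h => hx ?_
  simp [_root_.gradient, h]

lemma gradient_eq_zero_of_notMem_tsupport {φ : 𝔼 → ℝ} {x : 𝔼} (h : x ∉ tsupport φ) :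
    gradient φ x = 0 :=
  image_eq_zero_of_notMem_tsupport fun h' => h (tsupport_gradient_subset φ h')

lemma HasGradientAt.mul' {f g : 𝔼 → ℝ} {f' g' x : 𝔼} (hf : HasGradientAt f f' x)
    (hg : HasGradientAt g g' x) : HasGradientAt (fun y => f y * g y) (f x • g' + g x • f') x := by
  rw [hasGradientAt_iff_hasFDerivAt] at *
  refine (hf.mul hg).congr_fderiv ?_
  simp

lemma HasGradientAt.comp_deriv {g : ℝ → ℝ} {f : 𝔼 → ℝ} {f' x : 𝔼} {g' : ℝ}
    (hg : HasDerivAt g g' (f x)) (hf : HasGradientAt f f' x) :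
    HasGradientAt (fun y => g (f y)) (g' • f') x := by
  rw [hasGradientAt_iff_hasFDerivAt] at *
  refine (hg.comp_hasFDerivAt x hf).congr_fderiv ?_
  simp

lemma gradient_mul {f g : 𝔼 → ℝ} {x : 𝔼} (hf : DifferentiableAt ℝ f x)
    (hg : DifferentiableAt ℝ g x) :
    gradient (fun y => f y * g y) x = f x • gradient g x + g x • gradient f x :=
  (hf.hasGradientAt.mul' hg.hasGradientAt).gradient

lemma IsTestFunction.mul {Ω Ω' : Set 𝔼} {φ ψ : 𝔼 → ℝ} (hφ : IsTestFunction Ω φ)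
    (hψ : IsTestFunction Ω' ψ) : IsTestFunction Ω (fun x => φ x * ψ x) :=
  ⟨hφ.1.mul hψ.1, hφ.2.1.mul_right, (tsupport_mul_subset_left).trans hφ.2.2⟩

lemma IsTestFunction.eq_zero {Ω : Set 𝔼} {φ : 𝔼 → ℝ} (hφ : IsTestFunction Ω φ) {x : 𝔼}
    (hx : x ∉ Ω) : φ x = 0 :=
  image_eq_zero_of_notMem_tsupport fun h => hx (hφ.2.2 h)

lemma IsTestFunction.gradient_eq_zero {Ω : Set 𝔼} {φ : 𝔼 → ℝ} (hφ : IsTestFunction Ω φ) {x : 𝔼}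
    (hx : x ∉ Ω) : gradient φ x = 0 :=
  gradient_eq_zero_of_notMem_tsupport fun h => hx (hφ.2.2 h)

/-- A locally integrable function on `Ω` times a continuous function with compact support
in `Ω` is integrable. -/
lemma MeasureTheory.LocallyIntegrableOn.integrable_smul_of_tsupport {F : Type*} [NormedAddCommGroup F]
    [NormedSpace ℝ F] {Ω : Set 𝔼} {G : 𝔼 → F} (hG : LocallyIntegrableOn G Ω)
    {ψ : 𝔼 → ℝ} (hψ : Continuous ψ) (hc : HasCompactSupport ψ) (hs : tsupport ψ ⊆ Ω) :
    Integrable (fun x => ψ x • G x) := by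
  have hK : IsCompact (tsupport ψ) := hc
  refine (integrableOn_iff_integrable_of_support_subset (s := tsupport ψ) ?_).1
    ((hG.integrableOn_compact_subset hs hK).continuousOn_smul hψ.continuousOn hK)
  intro x hx
  exact subset_tsupport _ (left_ne_zero_of_smul hx)

lemma MeasureTheory.LocallyIntegrableOn.integrable_smul_of_tsupport_right {Ω : Set 𝔼} {u : 𝔼 → ℝ}
    (hu : LocallyIntegrableOn u Ω) {ψ : 𝔼 → 𝔼} (hψ : Continuous ψ) (hc : HasCompactSupport ψ)
    (hs : tsupport ψ ⊆ Ω) : Integrable (fun x => u x • ψ x) := by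
  have hK : IsCompact (tsupport ψ) := hc
  refine (integrableOn_iff_integrable_of_support_subset (s := tsupport ψ) ?_).1
    ((hu.integrableOn_compact_subset hs hK).smul_continuousOn hψ.continuousOn hK)
  intro x hx
  exact subset_tsupport _ (right_ne_zero_of_smul hx)

lemma setIntegral_eq_integral_of_eq_zero {F : Type*} [NormedAddCommGroup F] [NormedSpace ℝ F]
    {Ω : Set 𝔼} {f : 𝔼 → F} (h : ∀ x, x ∉ Ω → f x = 0) : ∫ x in Ω, f x = ∫ x, f x :=
  setIntegral_eq_integral_of_forall_compl_eq_zero h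

lemma HasWeakGradient.integral_eq {Ω : Set 𝔼} {u : 𝔼 → ℝ} {G : 𝔼 → 𝔼}
    (h : HasWeakGradient Ω u G) {φ : 𝔼 → ℝ} (hφ : IsTestFunction Ω φ) :
    ∫ x, u x • gradient φ x = -∫ x, φ x • G x := by
  rw [← setIntegral_eq_integral_of_eq_zero (Ω := Ω), h.2.2 φ hφ,
    setIntegral_eq_integral_of_eq_zero]
  · intro x hx; rw [hφ.eq_zero hx, zero_smul]
  · intro x hx; rw [hφ.gradient_eq_zero hx, smul_zero]

lemma HasWeakGradient.of_integral_eq {Ω : Set 𝔼} {u : 𝔼 → ℝ} {G : 𝔼 → 𝔼}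
    (hu : LocallyIntegrableOn u Ω) (hG : LocallyIntegrableOn G Ω)
    (h : ∀ φ, IsTestFunction Ω φ → ∫ x, u x • gradient φ x = -∫ x, φ x • G x) :
    HasWeakGradient Ω u G := by
  refine ⟨hu, hG, fun φ hφ => ?_⟩
  rw [setIntegral_eq_integral_of_eq_zero, setIntegral_eq_integral_of_eq_zero, h φ hφ]
  · intro x hx; rw [hφ.eq_zero hx, zero_smul]
  · intro x hx; rw [hφ.gradient_eq_zero hx, smul_zero]

/-- The fundamental lemma of the calculus of variations; it makes the choice involved in `weakGrad`
harmless almost everywhere. -/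
lemma HasWeakGradient.ae_unique {Ω : Set 𝔼} (hΩ : IsOpen Ω) {u : 𝔼 → ℝ} {G G' : 𝔼 → 𝔼}
    (h : HasWeakGradient Ω u G) (h' : HasWeakGradient Ω u G') :
    G =ᵐ[volume.restrict Ω] G' := by
  have key := hΩ.ae_eq_zero_of_integral_contDiff_smul_eq_zero (μ := volume) (f := G - G')
    (h.2.1.sub h'.2.1) fun φ h1 h2 h3 => by
      have e := h.integral_eq ⟨h1, h2, h3⟩
      rw [h'.integral_eq ⟨h1, h2, h3⟩, neg_inj] at e
      simp only [Pi.sub_apply, smul_sub]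
      rw [integral_sub, e, sub_self]
      · exact h.2.1.integrable_smul_of_tsupport h1.continuous h2 h3
      · exact h'.2.1.integrable_smul_of_tsupport h1.continuous h2 h3
  rw [Filter.EventuallyEq, ae_restrict_iff' hΩ.measurableSet]
  filter_upwards [key] with x hx hxΩ
  exact sub_eq_zero.1 (hx hxΩ)

lemma hasWeakGradient_weakGrad {Ω : Set 𝔼} {u : 𝔼 → ℝ} (h : ∃ G, HasWeakGradient Ω u G) :
    HasWeakGradient Ω u (weakGrad Ω u) := by
  rw [weakGrad, dif_pos h]
  exact h.choose_spec

lemma HasWeakGradient.neg {Ω : Set 𝔼} {u : 𝔼 → ℝ} {G : 𝔼 → 𝔼} (h : HasWeakGradient Ω u G) :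
    HasWeakGradient Ω (fun x => -u x) (fun x => -G x) := by
  refine ⟨h.1.neg, h.2.1.neg, fun φ hφ => ?_⟩
  simp only [neg_smul, smul_neg, integral_neg, h.2.2 φ hφ]

/-- A supersolution v is defined through `weakGrad` of -v, a choice made independently of the one
for v, so the two agree up to sign only almost everywhere. -/
lemma weakGrad_neg_ae {Ω : Set 𝔼} (hΩ : IsOpen Ω) {u : 𝔼 → ℝ}
    (h : ∃ G, HasWeakGradient Ω (fun x => -u x) G) :
    HasWeakGradient Ω u (weakGrad Ω u) ∧
      weakGrad Ω (fun x => -u x) =ᵐ[volume.restrict Ω] fun x => -weakGrad Ω u x := by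
  have h1 := hasWeakGradient_weakGrad h
  have h2 := h1.neg
  simp only [neg_neg] at h2
  have h3 := hasWeakGradient_weakGrad ⟨_, h2⟩
  exact ⟨h3, h1.ae_unique hΩ h3.neg⟩

/-- The product of a weakly differentiable function on `Ω` with a test function on `Ω` is weakly
differentiable on the whole space. -/
lemma HasWeakGradient.testFunction_mul {Ω : Set 𝔼} {u : 𝔼 → ℝ} {G : 𝔼 → 𝔼}
    (h : HasWeakGradient Ω u G) {m : 𝔼 → ℝ} (hm : IsTestFunction Ω m) :
    Integrable (fun x => m x * u x) ∧ Integrable (fun x => m x • G x + u x • gradient m x) ∧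
    HasWeakGradient Set.univ (fun x => m x * u x) (fun x => m x • G x + u x • gradient m x) := by
  have i1 : Integrable (fun x => m x * u x) :=
    h.1.integrable_smul_of_tsupport hm.1.continuous hm.2.1 hm.2.2
  have i2 : Integrable (fun x => m x • G x) :=
    h.2.1.integrable_smul_of_tsupport hm.1.continuous hm.2.1 hm.2.2
  have i3 : Integrable (fun x => u x • gradient m x) :=
    h.1.integrable_smul_of_tsupport_right hm.1.continuous_gradient hm.2.1.gradient
      ((tsupport_gradient_subset m).trans hm.2.2)
  refine ⟨i1, i2.add i3, HasWeakGradient.of_integral_eq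
    (i1.locallyIntegrable.locallyIntegrableOn _) ((i2.add i3).locallyIntegrable.locallyIntegrableOn _)
    fun ψ hψ => ?_⟩
  have hmψ := hm.mul hψ
  have e := h.integral_eq hmψ
  have j1 : Integrable (fun x => ψ x • u x • gradient m x) :=
    i3.locallyIntegrable.integrable_smul_left_of_hasCompactSupport hψ.1.continuous hψ.2.1
  have j2 : Integrable (fun x => ψ x • m x • G x) :=
    i2.locallyIntegrable.integrable_smul_left_of_hasCompactSupport hψ.1.continuous hψ.2.1
  have j3 : Integrable (fun x => (m x * u x) • gradient ψ x) :=
    i1.locallyIntegrable.integrable_smul_right_of_hasCompactSupport hψ.1.continuous_gradient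
      hψ.2.1.gradient
  have e1 : ∀ x, u x • gradient (fun y => m y * ψ y) x
      = (m x * u x) • gradient ψ x + ψ x • u x • gradient m x := by
    intro x
    rw [gradient_mul (hm.1.differentiable (by simp) x) (hψ.1.differentiable (by simp) x), smul_add,
      smul_smul, smul_smul, smul_smul]
    congr 2 <;> ring
  simp only [e1] at e
  rw [integral_add j3 j1] at e
  rw [eq_sub_of_add_eq e]
  simp only [smul_add]
  rw [integral_add j2 j1]
  simp only [smul_smul, mul_comm]
  abel

/-- `Φ` is `C¹` and bounded on the half plane `{b ≥ 0}` with bounded partial derivatives `Φa`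
and `Φb`. -/
structure HasBoundedPartials (Φ Φa Φb : ℝ → ℝ → ℝ) : Prop where
  hasFDerivAt : ∀ a b, 0 ≤ b → HasFDerivAt (fun z : ℝ × ℝ => Φ z.1 z.2)
    (Φa a b • ContinuousLinearMap.fst ℝ ℝ ℝ + Φb a b • ContinuousLinearMap.snd ℝ ℝ ℝ) (a, b)
  continuousOn_fst : ContinuousOn (fun z : ℝ × ℝ => Φa z.1 z.2) {z | 0 ≤ z.2}
  continuousOn_snd : ContinuousOn (fun z : ℝ × ℝ => Φb z.1 z.2) {z | 0 ≤ z.2}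
  bounded : ∃ C, ∀ a b, 0 ≤ b → |Φ a b| ≤ C ∧ |Φa a b| ≤ C ∧ |Φb a b| ≤ C

end WeakGradient

/-! ### Chain rule for weak gradients; functions with zero weak gradient. -/

section WeakGradient

variable {N : ℕ}

local notation "𝔼" => EuclideanSpace ℝ (Fin N)

lemma ae_tendsto_mollify {F : Type*} [NormedAddCommGroup F] [NormedSpace ℝ F] [CompleteSpace F]
    {f : 𝔼 → F} (hf : LocallyIntegrable f) :
    ∀ᵐ x, Tendsto (fun n => mollify n f x) atTop (𝓝 (f x)) := by
  refine ContDiffBump.ae_convolution_tendsto_right_of_locallyIntegrable (K := 2)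
    tendsto_mollifierBump_rOut (Eventually.of_forall fun n => ?_) hf
  simp only [mollifierBump]
  rw [show (2 : ℝ) * (1 / (2 * ((n : ℝ) + 1))) = 1 / ((n : ℝ) + 1) by field_simp]

/-- Uniformly bounded, a.e. convergent factors may multiply an L¹ convergent sequence: write a_n f_n
= a_n (f_n - f₀) + a_n f₀, the first part being small in L¹ and the second dominated. -/
lemma tendsto_integral_smul_of_L1 {f : ℕ → 𝔼 → 𝔼} {f0 : 𝔼 → 𝔼} {a : ℕ → 𝔼 → ℝ} {a0 : 𝔼 → ℝ}
    {C : ℝ} (hf : ∀ n, Integrable (f n)) (hf0 : Integrable f0)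
    (hlim : Tendsto (fun n => eLpNorm (fun x => f n x - f0 x) 1) atTop (𝓝 0))
    (ha : ∀ n, AEStronglyMeasurable (a n) volume) (hC : ∀ n x, |a n x| ≤ C)
    (hal : ∀ᵐ x, Tendsto (fun n => a n x) atTop (𝓝 (a0 x))) :
    Tendsto (fun n => ∫ x, a n x • f n x) atTop (𝓝 (∫ x, a0 x • f0 x)) := by
  have hbi : ∀ n {g : 𝔼 → 𝔼}, Integrable g → Integrable fun x => a n x • g x := fun n g hg =>
    hg.bdd_smul C (ha n) (Eventually.of_forall (hC n))
  have h1 : Tendsto (fun n => ∫ x, a n x • f0 x) atTop (𝓝 (∫ x, a0 x • f0 x)) := by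
    refine tendsto_integral_of_dominated_convergence (fun x => C * ‖f0 x‖)
      (fun n => (hbi n hf0).1) (hf0.norm.const_mul C) (fun n => Eventually.of_forall fun x => ?_)
      (hal.mono fun x hx => hx.smul_const _)
    rw [norm_smul]
    exact mul_le_mul_of_nonneg_right (hC n x) (norm_nonneg _)
  have h2 : Tendsto (fun n => ∫ x, a n x • (f n x - f0 x)) atTop (𝓝 0) := by
    have h3 : Tendsto (fun n => C * (eLpNorm (fun x => f n x - f0 x) 1).toReal) atTop (𝓝 0) := by
      have := (ENNReal.continuousAt_toReal ENNReal.zero_ne_top).tendsto.comp hlim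
      simpa using this.const_mul C
    refine squeeze_zero_norm (fun n => ?_) h3
    have hi : Integrable fun x => f n x - f0 x := (hf n).sub hf0
    rw [eLpNorm_one_eq_lintegral_enorm, ← integral_norm_eq_lintegral_enorm hi.1,
      ← integral_const_mul]
    refine norm_integral_le_of_norm_le (hi.norm.const_mul C) (Eventually.of_forall fun x => ?_)
    rw [norm_smul]
    exact mul_le_mul_of_nonneg_right (hC n x) (norm_nonneg _)
  have h4 := h2.add h1
  rw [zero_add] at h4
  refine h4.congr fun n => ?_
  have hi : Integrable fun x => a n x • (f n x - f0 x) := hbi n ((hf n).sub hf0)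
  rw [← integral_add hi (hbi n hf0)]
  exact integral_congr_ae (Eventually.of_forall fun x => by simp only [← smul_add, sub_add_cancel])

lemma integral_smul_gradient_eq_neg {f ψ : 𝔼 → ℝ} {f' : 𝔼 → 𝔼} (hf : ∀ x, HasGradientAt f (f' x) x)
    (hf' : Continuous f') (hψ : IsTestFunction Set.univ ψ) :
    ∫ x, f x • gradient ψ x = -∫ x, ψ x • f' x := by
  have hfc : Continuous f := continuous_iff_continuousAt.2 fun x => (hf x).continuousAt
  have i1 : Integrable fun x => f x • gradient ψ x :=
    hfc.locallyIntegrable.integrable_smul_right_of_hasCompactSupport hψ.1.continuous_gradient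
      hψ.2.1.gradient
  have i2 : Integrable fun x => ψ x • f' x :=
    hf'.locallyIntegrable.integrable_smul_left_of_hasCompactSupport hψ.1.continuous hψ.2.1
  have i3 : Integrable fun x => f x * ψ x :=
    hfc.locallyIntegrable.integrable_smul_right_of_hasCompactSupport hψ.1.continuous hψ.2.1
  refine ext_inner_left ℝ fun y => ?_
  rw [← integral_inner i1, inner_neg_right, ← integral_inner i2]
  have e1 : ∀ x, inner ℝ y (f x • gradient ψ x) = f x * fderiv ℝ ψ x y := fun x => by
    rw [inner_smul_right, inner_gradient_right]; simp
  have e2 : ∀ x, inner ℝ y (ψ x • f' x) = fderiv ℝ f x y * ψ x := fun x => by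
    rw [inner_smul_right, (hf x).fderiv_apply, real_inner_comm, mul_comm]
  have j1 := i1.const_inner (𝕜 := ℝ) y
  have j2 := i2.const_inner (𝕜 := ℝ) y
  simp only [e1] at j1 ⊢
  simp only [e2] at j2 ⊢
  exact integral_mul_fderiv_eq_neg_fderiv_mul_of_integrable j2 j1 i3
    (fun x _ => (hf x).differentiableAt) (fun x _ => hψ.1.differentiable (by simp) x)

/-- The classical chain rule holds for the mollified pair, and every term passes to the limit.
Mollification preserves v ≥ 0, so the approximations never leave the half plane on which Φ is
controlled. -/
lemma HasWeakGradient.comp_univ {u v : 𝔼 → ℝ} {U V : 𝔼 → 𝔼}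
    {Φ Φa Φb : ℝ → ℝ → ℝ} (hΦ : HasBoundedPartials Φ Φa Φb)
    (hu : HasWeakGradient Set.univ u U) (hv : HasWeakGradient Set.univ v V)
    (hui : Integrable u) (hvi : Integrable v) (hUi : Integrable U) (hVi : Integrable V)
    (hv0 : ∀ᵐ x, 0 ≤ v x) {ψ : 𝔼 → ℝ} (hψ : IsTestFunction Set.univ ψ) :
    AEStronglyMeasurable (fun x => Φ (u x) (v x)) volume ∧
    AEStronglyMeasurable (fun x => Φa (u x) (v x)) volume ∧
    AEStronglyMeasurable (fun x => Φb (u x) (v x)) volume ∧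
    ∫ x, Φ (u x) (v x) • gradient ψ x
      = -∫ x, ψ x • (Φa (u x) (v x) • U x + Φb (u x) (v x) • V x) := by
  obtain ⟨C, hC⟩ := hΦ.bounded
  have hC0 : 0 ≤ C := (abs_nonneg _).trans (hC 0 0 le_rfl).1
  have hΦc : ContinuousOn (fun z : ℝ × ℝ => Φ z.1 z.2) {z | 0 ≤ z.2} := fun z hz =>
    (hΦ.hasFDerivAt z.1 z.2 hz).continuousAt.continuousWithinAt
  have hun := ae_tendsto_mollify hui.locallyIntegrable
  have hvn := ae_tendsto_mollify hvi.locallyIntegrable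
  have hcu : ∀ n, ContDiff ℝ ∞ (mollify n u) := fun n => contDiff_mollify n hui.locallyIntegrable
  have hcv : ∀ n, ContDiff ℝ ∞ (mollify n v) := fun n => contDiff_mollify n hvi.locallyIntegrable
  have hvn0 : ∀ n x, 0 ≤ mollify n v x := fun n => mollify_nonneg n hv0
  -- composites with continuous functions on the half plane
  have hcont : ∀ {Θ : ℝ → ℝ → ℝ}, ContinuousOn (fun z : ℝ × ℝ => Θ z.1 z.2) {z | 0 ≤ z.2} →
      (∀ n, Continuous fun x => Θ (mollify n u x) (mollify n v x)) ∧
      ∀ᵐ x, Tendsto (fun n => Θ (mollify n u x) (mollify n v x)) atTop (𝓝 (Θ (u x) (v x))) := by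
    intro Θ hΘ
    refine ⟨fun n => ?_, ?_⟩
    · exact hΘ.comp_continuous ((hcu n).continuous.prodMk (hcv n).continuous) (hvn0 n)
    · filter_upwards [hun, hvn, hv0] with x h1 h2 h3
      have := (hΘ (u x, v x) h3).tendsto
      refine this.comp (tendsto_nhdsWithin_iff.2 ⟨h1.prodMk_nhds h2, ?_⟩)
      exact Eventually.of_forall fun n => hvn0 n x
  obtain ⟨c0, l0⟩ := hcont hΦc
  obtain ⟨ca, la⟩ := hcont hΦ.continuousOn_fst
  obtain ⟨cb, lb⟩ := hcont hΦ.continuousOn_snd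
  have hmeas : ∀ {Θ : ℝ → ℝ → ℝ}, (∀ n, Continuous fun x => Θ (mollify n u x) (mollify n v x)) →
      (∀ᵐ x, Tendsto (fun n => Θ (mollify n u x) (mollify n v x)) atTop (𝓝 (Θ (u x) (v x)))) →
      AEStronglyMeasurable (fun x => Θ (u x) (v x)) volume := fun h1 h2 =>
    aestronglyMeasurable_of_tendsto_ae atTop (fun n => (h1 n).aestronglyMeasurable) h2
  refine ⟨hmeas c0 l0, hmeas ca la, hmeas cb lb, ?_⟩
  have hψg : Integrable (gradient ψ) :=
    hψ.1.continuous_gradient.integrable_of_hasCompactSupport hψ.2.1.gradient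
  obtain ⟨M, hM⟩ := hψ.1.continuous.bounded_above_of_compact_support hψ.2.1
  -- left side
  have hL : Tendsto (fun n => ∫ x, Φ (mollify n u x) (mollify n v x) • gradient ψ x) atTop
      (𝓝 (∫ x, Φ (u x) (v x) • gradient ψ x)) := by
    refine tendsto_integral_of_dominated_convergence (fun x => C * ‖gradient ψ x‖)
      (fun n => (c0 n).aestronglyMeasurable.smul hψg.1)
      (hψg.norm.const_mul C) (fun n => Eventually.of_forall fun x => ?_)
      (l0.mono fun x hx => hx.smul_const _)
    rw [norm_smul]
    exact mul_le_mul_of_nonneg_right (hC _ _ (hvn0 n x)).1 (norm_nonneg _)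
  -- right side
  have hterm : ∀ {W : 𝔼 → 𝔼} {Θ : ℝ → ℝ → ℝ}, Integrable W →
      (∀ n, Continuous fun x => Θ (mollify n u x) (mollify n v x)) →
      (∀ᵐ x, Tendsto (fun n => Θ (mollify n u x) (mollify n v x)) atTop (𝓝 (Θ (u x) (v x)))) →
      (∀ a b, 0 ≤ b → |Θ a b| ≤ C) →
      (∀ n, Integrable fun x => (ψ x * Θ (mollify n u x) (mollify n v x)) • mollify n W x) ∧
      Tendsto (fun n => ∫ x, (ψ x * Θ (mollify n u x) (mollify n v x)) • mollify n W x) atTop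
        (𝓝 (∫ x, (ψ x * Θ (u x) (v x)) • W x)) := by
    intro W Θ hW h1 h2 h3
    have hWm : MemLp W 1 := memLp_one_iff_integrable.2 hW
    have hWn : ∀ n, Integrable (mollify n W) := fun n => by
      rw [← memLp_one_iff_integrable]
      exact ⟨(contDiff_mollify n hW.locallyIntegrable).continuous.aestronglyMeasurable,
        (eLpNorm_mollify_le n le_rfl (by simp) hWm.1).trans_lt hWm.2⟩
    have hb : ∀ n x, |ψ x * Θ (mollify n u x) (mollify n v x)| ≤ M * C := fun n x => by
      rw [abs_mul]
      exact mul_le_mul (hM x) (h3 _ _ (hvn0 n x)) (abs_nonneg _) ((norm_nonneg _).trans (hM x))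
    have hm : ∀ n, AEStronglyMeasurable
        (fun x => ψ x * Θ (mollify n u x) (mollify n v x)) volume := fun n =>
      (hψ.1.continuous.mul (h1 n)).aestronglyMeasurable
    refine ⟨fun n => (hWn n).bdd_smul (M * C) (hm n) (Eventually.of_forall (hb n)), ?_⟩
    exact tendsto_integral_smul_of_L1 hWn hW
      (tendsto_eLpNorm_mollify_sub le_rfl (by simp) hWm) hm hb
      (h2.mono fun x hx => hx.const_mul _)
  obtain ⟨ia, ta⟩ := hterm hUi ca la fun a b hb => (hC a b hb).2.1
  obtain ⟨ib, tb⟩ := hterm hVi cb lb fun a b hb => (hC a b hb).2.2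
  have hR := (ta.add tb).neg
  have hgu := fun n x => hasGradientAt_mollify n hui.locallyIntegrable hUi.locallyIntegrable
    (fun φ h1 h2 => hu.integral_eq ⟨h1, h2, Set.subset_univ _⟩) x
  have hgv := fun n x => hasGradientAt_mollify n hvi.locallyIntegrable hVi.locallyIntegrable
    (fun φ h1 h2 => hv.integral_eq ⟨h1, h2, Set.subset_univ _⟩) x
  have hlim : ∫ x, Φ (u x) (v x) • gradient ψ x
      = -((∫ x, (ψ x * Φa (u x) (v x)) • U x) + ∫ x, (ψ x * Φb (u x) (v x)) • V x) := by
    refine tendsto_nhds_unique hL (hR.congr fun n => ?_)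
    have hchain : ∀ x, HasGradientAt (fun y => Φ (mollify n u y) (mollify n v y))
        (Φa (mollify n u x) (mollify n v x) • mollify n U x
          + Φb (mollify n u x) (mollify n v x) • mollify n V x) x := by
      intro x
      have h1 := (hgu n x).hasFDerivAt
      have h2 := (hgv n x).hasFDerivAt
      rw [hasGradientAt_iff_hasFDerivAt]
      refine ((hΦ.hasFDerivAt _ _ (hvn0 n x)).comp x (h1.prodMk h2)).congr_fderiv ?_
      ext y
      simp
    have hgc : Continuous fun x => Φa (mollify n u x) (mollify n v x) • mollify n U x
        + Φb (mollify n u x) (mollify n v x) • mollify n V x :=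
      ((ca n).smul (contDiff_mollify n hUi.locallyIntegrable).continuous).add
        ((cb n).smul (contDiff_mollify n hVi.locallyIntegrable).continuous)
    rw [integral_smul_gradient_eq_neg hchain hgc hψ, ← integral_add (ia n) (ib n)]
    simp only [smul_add, smul_smul]
  rw [hlim, ← integral_add]
  · simp only [smul_add, smul_smul]
  · refine hUi.bdd_smul (M * C) (hψ.1.continuous.aestronglyMeasurable.mul (hmeas ca la)) ?_
    filter_upwards [hv0] with x hx
    rw [Real.norm_eq_abs, Pi.mul_apply, abs_mul]
    exact mul_le_mul (hM x) (hC _ _ hx).2.1 (abs_nonneg _) ((norm_nonneg _).trans (hM x))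
  · refine hVi.bdd_smul (M * C) (hψ.1.continuous.aestronglyMeasurable.mul (hmeas cb lb)) ?_
    filter_upwards [hv0] with x hx
    rw [Real.norm_eq_abs, Pi.mul_apply, abs_mul]
    exact mul_le_mul (hM x) (hC _ _ hx).2.2 (abs_nonneg _) ((norm_nonneg _).trans (hM x))

/-- Chain rule for weak gradients. -/
lemma HasWeakGradient.comp {Ω : Set 𝔼} (hΩ : IsOpen Ω) {u v : 𝔼 → ℝ} {U V : 𝔼 → 𝔼}
    {Φ Φa Φb : ℝ → ℝ → ℝ} (hΦ : HasBoundedPartials Φ Φa Φb)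
    (hu : HasWeakGradient Ω u U) (hv : HasWeakGradient Ω v V)
    (hv0 : ∀ᵐ x ∂(volume.restrict Ω), 0 ≤ v x) :
    HasWeakGradient Ω (fun x => Φ (u x) (v x))
      (fun x => Φa (u x) (v x) • U x + Φb (u x) (v x) • V x) := by
  obtain ⟨C, hC⟩ := hΦ.bounded
  rw [ae_restrict_iff' hΩ.measurableSet] at hv0
  -- Localization: both u and v are multiplied by a cut-off ξ that is 1 near the support of the test
  -- function. Since ξ ≥ 0, the second argument remains nonnegative; away from that support the
  -- value of the composite does not matter.
  have key : ∀ ξ, IsTestFunction Ω ξ → (∀ x, ξ x ∈ Set.Icc 0 1) →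
      ∀ ψ, IsTestFunction Set.univ ψ →
      AEStronglyMeasurable (fun x => Φ (ξ x * u x) (ξ x * v x)) volume ∧
      AEStronglyMeasurable (fun x => Φa (ξ x * u x) (ξ x * v x)) volume ∧
      AEStronglyMeasurable (fun x => Φb (ξ x * u x) (ξ x * v x)) volume ∧
      ∫ x, Φ (ξ x * u x) (ξ x * v x) • gradient ψ x
      = -∫ x, ψ x • (Φa (ξ x * u x) (ξ x * v x) • (ξ x • U x + u x • gradient ξ x)
          + Φb (ξ x * u x) (ξ x * v x) • (ξ x • V x + v x • gradient ξ x)) := by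
    intro ξ hξ hξ1 ψ hψ
    obtain ⟨a1, a2, a3⟩ := hu.testFunction_mul hξ
    obtain ⟨b1, b2, b3⟩ := hv.testFunction_mul hξ
    refine HasWeakGradient.comp_univ hΦ a3 b3 a1 b1 a2 b2 ?_ hψ
    filter_upwards [hv0] with x hx
    by_cases hxΩ : x ∈ Ω
    · exact mul_nonneg (hξ1 x).1 (hx hxΩ)
    · rw [hξ.eq_zero hxΩ, zero_mul]
  have hmeasK : ∀ K ⊆ Ω, IsCompact K →
      AEStronglyMeasurable (fun x => Φ (u x) (v x)) (volume.restrict K) ∧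
      AEStronglyMeasurable (fun x => Φa (u x) (v x)) (volume.restrict K) ∧
      AEStronglyMeasurable (fun x => Φb (u x) (v x)) (volume.restrict K) := by
    intro K hK hKc
    obtain ⟨ξ, hξ, hξ1, hξI⟩ := exists_smooth_cutoff hKc hΩ hK
    obtain ⟨m1, m2, m3, -⟩ := key ξ hξ hξI ξ ⟨hξ.1, hξ.2.1, Set.subset_univ _⟩
    have hc : ∀ {Θ : ℝ → ℝ → ℝ},
        AEStronglyMeasurable (fun x => Θ (ξ x * u x) (ξ x * v x)) volume →
        AEStronglyMeasurable (fun x => Θ (u x) (v x)) (volume.restrict K) := fun h => by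
      refine h.restrict.congr ?_
      filter_upwards [ae_restrict_mem hKc.measurableSet] with x hx
      rw [hξ1.self_of_nhdsSet x hx, one_mul, one_mul]
    exact ⟨hc m1, hc m2, hc m3⟩
  have hv0K : ∀ K ⊆ Ω, IsCompact K → ∀ᵐ x ∂(volume.restrict K), 0 ≤ v x := by
    intro K hK hKc
    rw [ae_restrict_iff' hKc.measurableSet]
    filter_upwards [hv0] with x hx h using hx (hK h)
  refine HasWeakGradient.of_integral_eq ?_ ?_ fun ψ hψ => ?_
  · rw [locallyIntegrableOn_iff hΩ.isLocallyClosed]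
    intro K hK hKc
    have : IsFiniteMeasure (volume.restrict K) := ⟨by simpa using hKc.measure_lt_top⟩
    refine Integrable.of_bound (hmeasK K hK hKc).1 C ?_
    filter_upwards [hv0K K hK hKc] with x hx using (hC _ _ hx).1
  · rw [locallyIntegrableOn_iff hΩ.isLocallyClosed]
    intro K hK hKc
    refine Integrable.add ?_ ?_
    · refine (hu.2.1.integrableOn_compact_subset hK hKc).bdd_smul C (hmeasK K hK hKc).2.1 ?_
      filter_upwards [hv0K K hK hKc] with x hx using (hC _ _ hx).2.1
    · refine (hv.2.1.integrableOn_compact_subset hK hKc).bdd_smul C (hmeasK K hK hKc).2.2 ?_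
      filter_upwards [hv0K K hK hKc] with x hx using (hC _ _ hx).2.2
  · obtain ⟨ξ, hξ, hξ1, hξI⟩ := exists_smooth_cutoff hψ.2.1 hΩ hψ.2.2
    obtain ⟨-, -, -, e⟩ := key ξ hξ hξI ψ ⟨hψ.1, hψ.2.1, Set.subset_univ _⟩
    have hg : ∀ x ∈ tsupport ψ, ξ x = 1 ∧ gradient ξ x = 0 := by
      intro x hx
      have h1 : ξ =ᶠ[𝓝 x] fun _ => 1 := hξ1.filter_mono (nhds_le_nhdsSet hx)
      exact ⟨h1.self_of_nhds, by rw [h1.gradient_eq, gradient_fun_const]⟩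
    convert e using 1
    · refine integral_congr_ae (Eventually.of_forall fun x => ?_)
      by_cases hx : x ∈ tsupport ψ
      · simp only [(hg x hx).1, one_mul]
      · simp only [gradient_eq_zero_of_notMem_tsupport hx, smul_zero]
    · congr 1
      refine integral_congr_ae (Eventually.of_forall fun x => ?_)
      by_cases hx : x ∈ tsupport ψ
      · simp only [(hg x hx).1, (hg x hx).2, one_mul, one_smul, smul_zero, add_zero]
      · simp only [image_eq_zero_of_notMem_tsupport hx, zero_smul]

/-- A function with zero weak gradient is constant on a ball well inside the domain. -/
lemma HasWeakGradient.exists_ae_eq_const_ball {Ω : Set 𝔼} (hΩ : IsOpen Ω) {u : 𝔼 → ℝ}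
    (hu : HasWeakGradient Ω u fun _ => 0) {x0 : 𝔼} (hx0 : x0 ∈ Ω) :
    ∃ r > 0, ∃ c, Metric.ball x0 r ⊆ Ω ∧ ∀ᵐ x ∂(volume.restrict (Metric.ball x0 r)), u x = c := by
  obtain ⟨r, hr, hrΩ⟩ := Metric.nhds_basis_closedBall.mem_iff.1 (hΩ.mem_nhds hx0)
  obtain ⟨ξ, hξ, hξ1, hξI⟩ := exists_smooth_cutoff (isCompact_closedBall x0 r) hΩ hrΩ
  obtain ⟨i1, i2, hw⟩ := hu.testFunction_mul hξ
  have hsub : Metric.ball x0 (r / 2) ⊆ Metric.closedBall x0 r :=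
    Metric.ball_subset_closedBall.trans (Metric.closedBall_subset_closedBall (by linarith))
  have hae := ae_tendsto_mollify i1.locallyIntegrable
  obtain ⟨n0, hn0⟩ := exists_nat_one_div_lt (half_pos hr)
  -- The kernel radius is below r / 2, so at a point of the half ball the mollified gradient only
  -- sees points of the closed ball, where ξ = 1 nearby and the weak gradient of ξ u is zero.
  have hconst : ∀ n ≥ n0, ∀ x ∈ Metric.ball x0 (r / 2), ∀ y ∈ Metric.ball x0 (r / 2),
      mollify n (fun x => ξ x * u x) x = mollify n (fun x => ξ x * u x) y := by
    intro n hn x hx y hy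
    have hg : ∀ z, HasGradientAt (mollify n fun x => ξ x * u x) _ z := fun z =>
      hasGradientAt_mollify n i1.locallyIntegrable i2.locallyIntegrable
        (fun φ h1 h2 => hw.integral_eq ⟨h1, h2, Set.subset_univ _⟩) z
    refine Metric.isOpen_ball.is_const_of_fderiv_eq_zero (𝕜 := ℝ)
      (convex_ball x0 (r / 2)).isPreconnected
      (fun z _ => (hg z).differentiableAt.differentiableWithinAt) (fun z hz => ?_) hx hy
    rw [(hg z).hasFDerivAt.fderiv]
    have hz0 : mollify n (fun x => ξ x • (0 : 𝔼) + u x • gradient ξ x) z = 0 := by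
      rw [mollify_apply]
      refine integral_eq_zero_of_ae (Eventually.of_forall fun t => ?_)
      by_cases ht : t ∈ Function.support ((mollifierBump 𝔼 n).normed volume)
      · rw [ContDiffBump.support_normed_eq] at ht
        have ht' : ‖t‖ < 1 / ((n : ℝ) + 1) := by simpa [mollifierBump] using ht
        have hnn : 1 / ((n : ℝ) + 1) ≤ 1 / ((n0 : ℝ) + 1) := by gcongr
        have hmem : z - t ∈ Metric.closedBall x0 r := by
          rw [Metric.mem_closedBall, dist_eq_norm]
          have h1 : ‖z - x0‖ < r / 2 := by rwa [Metric.mem_ball, dist_eq_norm] at hz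
          calc ‖z - t - x0‖ = ‖(z - x0) - t‖ := by congr 1; abel
            _ ≤ ‖z - x0‖ + ‖t‖ := norm_sub_le _ _
            _ ≤ r := by linarith
        have h1 : ξ =ᶠ[𝓝 (z - t)] fun _ => 1 := hξ1.filter_mono (nhds_le_nhdsSet hmem)
        simp [h1.gradient_eq]
      · simp [Function.notMem_support.1 ht]
    rw [hz0]
    simp
  have hae' : ∀ᵐ x ∂(volume.restrict (Metric.ball x0 (r / 2))),
      x ∈ Metric.ball x0 (r / 2) ∧
        Tendsto (fun n => mollify n (fun x => ξ x * u x) x) atTop (𝓝 (u x)) := by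
    rw [ae_restrict_iff' measurableSet_ball]
    filter_upwards [hae] with x hx hxb
    refine ⟨hxb, ?_⟩
    simpa [hξ1.self_of_nhdsSet x (hsub hxb)] using hx
  have hne : (ae (volume.restrict (Metric.ball x0 (r / 2)))).NeBot := by
    rw [ae_neBot, Ne, Measure.restrict_eq_zero]
    exact (Metric.measure_ball_pos volume x0 (half_pos hr)).ne'
  obtain ⟨x1, hx1, hx1'⟩ := hae'.exists
  refine ⟨r / 2, half_pos hr, u x1, hsub.trans hrΩ, ?_⟩
  filter_upwards [hae'] with x hx
  refine tendsto_nhds_unique hx.2 (hx1'.congr' ?_)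
  filter_upwards [eventually_ge_atTop n0] with n hn
  exact hconst n hn _ hx1 _ hx.1

/-- A function with zero weak gradient on a connected open set is constant. -/
lemma HasWeakGradient.exists_ae_eq_const {Ω : Set 𝔼} (hΩ : IsOpen Ω) (hc : IsConnected Ω)
    {u : 𝔼 → ℝ} (hu : HasWeakGradient Ω u fun _ => 0) :
    ∃ c, ∀ᵐ x ∂(volume.restrict Ω), u x = c := by
  choose! r hr c hrΩ hrc using fun x (hx : x ∈ Ω) => hu.exists_ae_eq_const_ball hΩ hx
  -- If y lies in the ball of x, then the balls of x and y meet in a nonempty open set, of positive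
  -- measure, which forces the two a.e. constants to agree. The constant is thus locally constant as
  -- a function of the centre.
  have hloc : ∀ x ∈ Ω, ∀ y ∈ Metric.ball x (r x), c y = c x := by
    intro x hx y hy
    have hyΩ := hrΩ x hx hy
    have hopen : IsOpen (Metric.ball x (r x) ∩ Metric.ball y (r y)) :=
      Metric.isOpen_ball.inter Metric.isOpen_ball
    have hpos : volume (Metric.ball x (r x) ∩ Metric.ball y (r y)) ≠ 0 :=
      (hopen.measure_pos volume ⟨y, hy, Metric.mem_ball_self (hr y hyΩ)⟩).ne'
    have hne : (ae (volume.restrict (Metric.ball x (r x) ∩ Metric.ball y (r y)))).NeBot := by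
      rwa [ae_neBot, Ne, Measure.restrict_eq_zero]
    obtain ⟨z, h1, h2⟩ := ((ae_restrict_of_ae_restrict_of_subset Set.inter_subset_left
      (hrc x hx)).and (ae_restrict_of_ae_restrict_of_subset Set.inter_subset_right
      (hrc y hyΩ))).exists
    rw [← h1, ← h2]
  have hcont : ContinuousOn c Ω := by
    intro x hx
    refine ContinuousAt.continuousWithinAt ?_
    have : c =ᶠ[𝓝 x] fun _ => c x :=
      Filter.eventually_of_mem (Metric.ball_mem_nhds x (hr x hx)) (hloc x hx)
    exact continuousAt_const.congr this.symm
  obtain ⟨x0, hx0⟩ := hc.nonempty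
  have hall : ∀ x ∈ Ω, c x = c x0 := by
    intro x hx
    refine hc.isPreconnected.induction₂ (fun a b => c a = c b) (fun a ha => ?_)
      (fun a b c' _ _ _ h1 h2 => h1.trans h2) (fun a b _ _ h => h.symm) hx hx0
    filter_upwards [mem_nhdsWithin_of_mem_nhds (Metric.ball_mem_nhds a (hr a ha))] with b hb
    exact (hloc a ha b hb).symm
  refine ⟨c x0, ?_⟩
  rw [ae_restrict_iff' hΩ.measurableSet]
  have hnull : volume {x | x ∈ Ω ∧ u x ≠ c x0} = 0 := by
    refine measure_null_of_locally_null _ fun x hx => ?_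
    refine ⟨{x | x ∈ Ω ∧ u x ≠ c x0} ∩ Metric.ball x (r x),
      inter_mem self_mem_nhdsWithin
        (mem_nhdsWithin_of_mem_nhds (Metric.ball_mem_nhds x (hr x hx.1))), ?_⟩
    have := (ae_restrict_iff' measurableSet_ball).1 (hrc x hx.1)
    refine measure_mono_null (fun y hy => ?_) (ae_iff.1 this)
    simp only [Set.mem_ofPred_eq, Classical.not_imp]
    exact ⟨hy.2, by rw [hall x hx.1]; exact hy.1.2⟩
  rw [ae_iff]
  refine measure_mono_null (fun x hx => ?_) hnull
  simpa using hx

end WeakGradient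

/-! ### Boundary cut-offs and the capacity of the complement. -/

section BoundaryCutoff

lemma tendsto_eLpNorm_zero_of_dominated {α F : Type*} [MeasurableSpace α] {μ : Measure α}
    [NormedAddCommGroup F] {p : ENNReal} (hp0 : p ≠ 0) (hpt : p ≠ ⊤) {f : ℕ → α → F} {g : α → ℝ}
    (hf : ∀ n, AEStronglyMeasurable (f n) μ) (hg : MemLp g p μ)
    (hb : ∀ n, ∀ᵐ x ∂μ, ‖f n x‖ ≤ g x)
    (hl : ∀ᵐ x ∂μ, Tendsto (fun n => f n x) atTop (𝓝 0)) :
    Tendsto (fun n => eLpNorm (f n) p μ) atTop (𝓝 0) := by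
  have hpos : 0 < p.toReal := ENNReal.toReal_pos hp0 hpt
  have key : Tendsto (fun n => ∫⁻ x, ‖f n x‖ₑ ^ p.toReal ∂μ) atTop (𝓝 (∫⁻ _, 0 ∂μ)) := by
    refine tendsto_lintegral_of_dominated_convergence' (fun x => ‖g x‖ₑ ^ p.toReal)
      (fun n => (hf n).enorm.pow_const _) (fun n => ?_) ?_ ?_
    · filter_upwards [hb n] with x hx
      refine ENNReal.rpow_le_rpow ?_ hpos.le
      exact enorm_le_iff_norm_le.2 (hx.trans (Real.le_norm_self _))
    · exact (lintegral_rpow_enorm_lt_top_of_eLpNorm_lt_top hp0 hpt hg.2).ne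
    · filter_upwards [hl] with x hx
      have h1 : Tendsto (fun n => ‖f n x‖ₑ) atTop (𝓝 0) := by simpa using hx.enorm
      have h2 := h1.ennrpow_const p.toReal
      rwa [ENNReal.zero_rpow_of_pos hpos] at h2
  simp only [lintegral_zero] at key
  have h3 := key.ennrpow_const (1 / p.toReal)
  rw [ENNReal.zero_rpow_of_pos (by positivity)] at h3
  simpa only [eLpNorm_eq_lintegral_rpow_enorm_toReal hp0 hpt] using h3

/-- A smooth step function from `0` on `(-∞, 0]` to `1` on `[c / 2, ∞)`. -/
lemma exists_smooth_step {c : ℝ} (hc : 0 < c) : ∃ S : ℝ → ℝ, ContDiff ℝ ∞ S ∧ S 0 = 0 ∧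
    (∀ t, S t ∈ Set.Icc 0 1) ∧ (∀ t > c / 2, S t = 1) ∧ ∃ C, ∀ t, |deriv S t| ≤ C := by
  have hcd : ContDiff ℝ ∞ fun t : ℝ => Real.smoothTransition (2 * t / c) :=
    Real.smoothTransition.contDiff.comp ((contDiff_const.mul contDiff_id).div_const c)
  refine ⟨fun t => Real.smoothTransition (2 * t / c), hcd, by simp,
    fun t => ⟨Real.smoothTransition.nonneg _, Real.smoothTransition.le_one _⟩, fun t ht => ?_, ?_⟩
  · refine Real.smoothTransition.one_of_one_le ?_
    rw [le_div_iff₀ hc]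
    linarith
  · have hcont : Continuous (deriv fun t : ℝ => Real.smoothTransition (2 * t / c)) :=
      hcd.continuous_deriv (by simp)
    obtain ⟨C, hC⟩ := (isCompact_Icc (a := (0 : ℝ)) (b := c / 2)).exists_bound_of_continuousOn
      hcont.continuousOn
    have hC0 : 0 ≤ C := (norm_nonneg _).trans (hC 0 ⟨le_rfl, by positivity⟩)
    refine ⟨C, fun t => ?_⟩
    rcases lt_or_ge t 0 with h | h
    · have : (fun t : ℝ => Real.smoothTransition (2 * t / c)) =ᶠ[𝓝 t] fun _ => 0 := by
        filter_upwards [gt_mem_nhds h] with s hs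
        refine Real.smoothTransition.zero_of_nonpos ?_
        exact div_nonpos_of_nonpos_of_nonneg (by linarith) hc.le
      rw [this.deriv_eq]
      simpa using hC0
    rcases le_or_gt t (c / 2) with h' | h'
    · exact hC t ⟨h, h'⟩
    · have : (fun t : ℝ => Real.smoothTransition (2 * t / c)) =ᶠ[𝓝 t] fun _ => 1 := by
        filter_upwards [lt_mem_nhds h'] with s hs
        refine Real.smoothTransition.one_of_one_le ?_
        rw [le_div_iff₀ hc]
        linarith
      rw [this.deriv_eq]
      simpa using hC0

variable {N : ℕ}

local notation "𝔼" => EuclideanSpace ℝ (Fin N)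

/-- Cut-off functions equal to `1` near the complement of `Ω`, built from test functions `σ k`
converging to `W`; they tend to `0` in the energy sense on the part of `Ω` where `W ≥ c`, or that
lies outside a given neighbourhood of the boundary. -/
lemma exists_boundary_cutoff {Ω : Set 𝔼} (hΩ : IsOpen Ω) (hb : Bornology.IsBounded Ωᶜ)
    {p q : ENNReal} (hp1 : 1 ≤ p) (hpt : p ≠ ⊤) (hq0 : q ≠ 0)
    {σ : ℕ → 𝔼 → ℝ} (hσ : ∀ k, IsTestFunction Ω (σ k)) {W : 𝔼 → ℝ} {dW : 𝔼 → 𝔼}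
    (hWm : AEStronglyMeasurable W (volume.restrict Ω)) (hdW : MemLp dW p (volume.restrict Ω))
    (hlim : Tendsto (fun k => eLpNorm (fun x => W x - σ k x) q (volume.restrict Ω)) atTop (𝓝 0))
    (hdlim : Tendsto (fun k => eLpNorm (fun x => dW x - gradient (σ k) x) p (volume.restrict Ω))
      atTop (𝓝 0))
    {U : Set 𝔼} (hU : IsOpen U) (hUΩ : frontier Ω ⊆ U) {c : ℝ} (hc : 0 < c) :
    ∃ Θ : ℕ → 𝔼 → ℝ, (∀ n, ContDiff ℝ ∞ (Θ n) ∧ HasCompactSupport (Θ n) ∧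
        (∀ x, Θ n x ∈ Set.Icc 0 1) ∧ ∀ᶠ x in 𝓝ˢ Ωᶜ, Θ n x = 1) ∧
      (∀ᵐ x ∂(volume.restrict Ω), (x ∈ U → c ≤ W x) →
        Tendsto (fun n => Θ n x) atTop (𝓝 0)) ∧
      Tendsto (fun n => eLpNorm ({x | x ∈ U → c ≤ W x}.indicator (gradient (Θ n))) p
        (volume.restrict Ω)) atTop (𝓝 0) := by
  have hp0 : p ≠ 0 := (zero_lt_one.trans_le hp1).ne'
  set A : Set 𝔼 := {x | x ∈ U → c ≤ W x} with hA
  -- an almost everywhere convergent subsequence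
  obtain ⟨ns, hns, hae⟩ := (tendstoInMeasure_of_tendsto_eLpNorm (μ := volume.restrict Ω) (p := q)
    (f := σ) (g := W) (l := atTop) hq0 (fun n => (hσ n).1.continuous.aestronglyMeasurable) hWm (by
      refine hlim.congr fun k => ?_
      rw [← eLpNorm_neg]
      congr 1
      ext x
      simp)).exists_seq_tendsto_ae
  have hdlim' := hdlim.comp hns.tendsto_atTop
  obtain ⟨S, hS, hS0, hSI, hS1, C, hC⟩ := exists_smooth_step hc
  have hC0 : 0 ≤ C := (abs_nonneg _).trans (hC 0)
  -- cut-off near the complement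
  have hK : IsCompact Ωᶜ := Metric.isCompact_of_isClosed_isBounded hΩ.isClosed_compl hb
  -- The cut-off ζ is supported in this set, so inside Ω it lives in U; points of Ω outside U then
  -- never see it.
  have hV : IsOpen (interior Ωᶜ ∪ U) := isOpen_interior.union hU
  have hKV : Ωᶜ ⊆ interior Ωᶜ ∪ U := by
    intro x hx
    by_cases h : x ∈ interior Ωᶜ
    · exact Or.inl h
    · refine Or.inr (hUΩ ?_)
      rw [← frontier_compl, frontier, hΩ.isClosed_compl.closure_eq]
      exact ⟨hx, h⟩
  obtain ⟨ζ, hζ, hζ1, hζI⟩ := exists_smooth_cutoff hK hV hKV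
  -- Near Ωᶜ the test function σ vanishes, so S(σ) = 0 and Θ = ζ = 1. At points of Ω ∩ U where W ≥
  -- c, eventually σ > c / 2 (a.e.), so S(σ) = 1 with zero derivative, and Θ vanishes.
  set Θ : ℕ → 𝔼 → ℝ := fun n x => ζ x * (1 - S (σ (ns n) x)) with hΘ
  have hSσ : ∀ n, ContDiff ℝ ∞ fun x => 1 - S (σ (ns n) x) := fun n =>
    contDiff_const.sub (hS.comp (hσ (ns n)).1)
  have hgS : ∀ n x, HasGradientAt (fun x => 1 - S (σ (ns n) x))
      (-(deriv S (σ (ns n) x) • gradient (σ (ns n)) x)) x := by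
    intro n x
    have h1 := ((hS.differentiable (by simp)) (σ (ns n) x)).hasDerivAt.const_sub 1
    have h2 := ((hσ (ns n)).1.differentiable (by simp) x).hasGradientAt
    simpa using HasGradientAt.comp_deriv (g := fun t => 1 - S t) h1 h2
  have hgrad : ∀ n x, gradient (Θ n) x
      = (1 - S (σ (ns n) x)) • gradient ζ x
        - (ζ x * deriv S (σ (ns n) x)) • gradient (σ (ns n)) x := by
    intro n x
    rw [((hζ.1.differentiable (by simp) x).hasGradientAt.mul' (hgS n x)).gradient, smul_neg,
      smul_smul]
    abel
  -- eventual vanishing on `A`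
  have hvan : ∀ᵐ x ∂(volume.restrict Ω), x ∈ A →
      ∀ᶠ n in atTop, ζ x * (1 - S (σ (ns n) x)) = 0 ∧ (1 - S (σ (ns n) x)) • gradient ζ x = 0 ∧
        ζ x * deriv S (σ (ns n) x) = 0 := by
    filter_upwards [hae, ae_restrict_mem hΩ.measurableSet] with x hx hxΩ hxA
    by_cases hxU : x ∈ U
    · have hlt : c / 2 < W x := by linarith [hxA hxU]
      filter_upwards [hx.eventually (lt_mem_nhds hlt)] with n hn
      have h1 : S =ᶠ[𝓝 (σ (ns n) x)] fun _ => 1 := by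
        filter_upwards [lt_mem_nhds hn] with t ht using hS1 t ht
      rw [h1.self_of_nhds, h1.deriv_eq]
      simp
    · have hxt : x ∉ tsupport ζ := fun h => by
        rcases hζ.2.2 h with h' | h'
        · exact interior_subset h' hxΩ
        · exact hxU h'
      rw [image_eq_zero_of_notMem_tsupport hxt, gradient_eq_zero_of_notMem_tsupport hxt]
      simp
  refine ⟨Θ, fun n => ⟨hζ.1.mul (hSσ n), hζ.2.1.mul_right, fun x => ?_, ?_⟩, ?_, ?_⟩
  · have h1 := hζI x
    have h2 := hSI (σ (ns n) x)
    exact ⟨mul_nonneg h1.1 (by linarith [h2.2]), mul_le_one₀ h1.2 (by linarith [h2.2])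
      (by linarith [h2.1])⟩
  · have hopen : (tsupport (σ (ns n)))ᶜ ∈ 𝓝ˢ Ωᶜ :=
      (isClosed_tsupport _).isOpen_compl.mem_nhdsSet.2 (Set.compl_subset_compl.2 (hσ (ns n)).2.2)
    filter_upwards [hζ1, hopen] with x h1 h2
    simp [hΘ, h1, image_eq_zero_of_notMem_tsupport h2, hS0]
  · filter_upwards [hvan] with x hx hxA
    exact tendsto_const_nhds.congr' ((hx hxA).mono fun n hn => hn.1.symm)
  · have hAm : NullMeasurableSet A (volume.restrict Ω) := by
      have h1 : NullMeasurableSet {x | c ≤ W x} (volume.restrict Ω) :=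
        nullMeasurableSet_le aemeasurable_const hWm.aemeasurable
      have h2 : A = Uᶜ ∪ {x | c ≤ W x} := by
        ext x
        simp only [hA, Set.mem_ofPred_eq, Set.mem_union, Set.mem_compl_iff]
        tauto
      rw [h2]
      exact hU.measurableSet.compl.nullMeasurableSet.union h1
    have hζg : MemLp (gradient ζ) p (volume.restrict Ω) :=
      (hζ.1.continuous_gradient.memLp_of_hasCompactSupport hζ.2.1.gradient).restrict Ω
    have hmS : ∀ n, Continuous fun x => 1 - S (σ (ns n) x) := fun n => (hSσ n).continuous
    have hmD : ∀ n, Continuous fun x => ζ x * deriv S (σ (ns n) x) := fun n =>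
      hζ.1.continuous.mul ((hS.continuous_deriv (by simp)).comp (hσ (ns n)).1.continuous)
    have hζC : ∀ n x, |ζ x * deriv S (σ (ns n) x)| ≤ C := fun n x => by
      rw [abs_mul, abs_of_nonneg (hζI x).1]
      exact (mul_le_mul (hζI x).2 (hC _) (abs_nonneg _) zero_le_one).trans_eq (one_mul C)
    -- the vanishing part
    set f1 : ℕ → 𝔼 → 𝔼 := fun n => A.indicator fun x =>
      (1 - S (σ (ns n) x)) • gradient ζ x - (ζ x * deriv S (σ (ns n) x)) • dW x with hf1
    set f2 : ℕ → 𝔼 → 𝔼 := fun n => A.indicator fun x =>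
      (ζ x * deriv S (σ (ns n) x)) • (dW x - gradient (σ (ns n)) x) with hf2
    have hm1 : ∀ n, AEStronglyMeasurable (f1 n) (volume.restrict Ω) := fun n =>
      (((hmS n).aestronglyMeasurable.smul hζg.1).sub
        ((hmD n).aestronglyMeasurable.smul hdW.1)).indicator₀ hAm
    have hm2 : ∀ n, AEStronglyMeasurable (f2 n) (volume.restrict Ω) := fun n =>
      ((hmD n).aestronglyMeasurable.smul (hdW.1.sub
        (hσ (ns n)).1.continuous_gradient.aestronglyMeasurable)).indicator₀ hAm
    -- In the gradient of Θ, ∇σ is replaced by its fixed limit dW: what results (f1) is dominated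
    -- and eventually zero pointwise, while the replacement error (f2) is at most C |dW - ∇σ|.
    have heq : ∀ n, A.indicator (gradient (Θ n)) = f1 n + f2 n := by
      intro n
      ext1 x
      by_cases hx : x ∈ A
      · simp only [hf1, hf2, Pi.add_apply, Set.indicator_of_mem hx, hgrad, smul_sub]
        abel
      · simp [hf1, hf2, Set.indicator_of_notMem hx]
    have t1 : Tendsto (fun n => eLpNorm (f1 n) p (volume.restrict Ω)) atTop (𝓝 0) := by
      refine tendsto_eLpNorm_zero_of_dominated (g := fun x => ‖gradient ζ x‖ + C * ‖dW x‖) hp0 hpt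
        hm1 (hζg.norm.add (hdW.norm.const_mul C)) (fun n => Eventually.of_forall fun x => ?_) ?_
      · refine (norm_indicator_le_norm_self _ _).trans ((norm_sub_le _ _).trans ?_)
        rw [norm_smul, norm_smul]
        refine add_le_add ?_ (mul_le_mul_of_nonneg_right (hζC n x) (norm_nonneg _))
        refine mul_le_of_le_one_left (norm_nonneg _) ?_
        have := hSI (σ (ns n) x)
        rw [Real.norm_eq_abs, abs_le]
        constructor <;> linarith [this.1, this.2]
      · filter_upwards [hvan] with x hx
        by_cases hxA : x ∈ A
        · refine tendsto_const_nhds.congr' ((hx hxA).mono fun n hn => ?_)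
          simp only [hf1, Set.indicator_of_mem hxA, hn.2.1, hn.2.2, zero_smul, sub_zero]
        · simp only [hf1, Set.indicator_of_notMem hxA]
          exact tendsto_const_nhds
    have t2 : Tendsto (fun n => eLpNorm (f2 n) p (volume.restrict Ω)) atTop (𝓝 0) := by
      have h := ENNReal.Tendsto.const_mul (a := ENNReal.ofReal C) hdlim'
        (Or.inr ENNReal.ofReal_ne_top)
      rw [mul_zero] at h
      refine tendsto_of_tendsto_of_tendsto_of_le_of_le tendsto_const_nhds h (fun _ => zero_le)
        fun n => ?_
      refine eLpNorm_le_mul_eLpNorm_of_ae_le_mul (Eventually.of_forall fun x => ?_) p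
      refine (norm_indicator_le_norm_self _ _).trans ?_
      rw [norm_smul]
      exact mul_le_mul_of_nonneg_right (hζC n x) (norm_nonneg _)
    have t := t1.add t2
    rw [add_zero] at t
    refine tendsto_of_tendsto_of_tendsto_of_le_of_le tendsto_const_nhds t (fun _ => zero_le)
      fun n => ?_
    simp only [heq]
    exact eLpNorm_add_le (hm1 n) (hm2 n) hp1

/-- If `W ∈ D₀^{1,p}(Ω)` (in the sense of approximation by test functions) is bounded below by a
positive constant near the boundary, then the complement of `Ω` has zero capacity. -/
lemma pCapacity_compl_eq_zero {Ω : Set 𝔼} (hΩ : IsOpen Ω) (hb : Bornology.IsBounded Ωᶜ)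
    {p : ℝ} (hp1 : 1 ≤ p) {q : ENNReal} (hq0 : q ≠ 0)
    {σ : ℕ → 𝔼 → ℝ} (hσ : ∀ k, IsTestFunction Ω (σ k)) {W : 𝔼 → ℝ} {dW : 𝔼 → 𝔼}
    (hWm : AEStronglyMeasurable W (volume.restrict Ω))
    (hdW : MemLp dW (ENNReal.ofReal p) (volume.restrict Ω))
    (hlim : Tendsto (fun k => eLpNorm (fun x => W x - σ k x) q (volume.restrict Ω)) atTop (𝓝 0))
    (hdlim : Tendsto (fun k => eLpNorm (fun x => dW x - gradient (σ k) x) (ENNReal.ofReal p)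
      (volume.restrict Ω)) atTop (𝓝 0))
    {U : Set 𝔼} (hU : IsOpen U) (hUΩ : frontier Ω ⊆ U) {c : ℝ} (hc : 0 < c)
    (hWc : ∀ᵐ x ∂(volume.restrict Ω), x ∈ U → c ≤ W x) : pCapacity p Ωᶜ = 0 := by
  have hpos : 0 < p := zero_lt_one.trans_le hp1
  have hp1' : 1 ≤ ENNReal.ofReal p := by simpa using hp1
  have hp0 : ENNReal.ofReal p ≠ 0 := (zero_lt_one.trans_le hp1').ne'
  obtain ⟨Θ, hΘ, -, hΘl⟩ := exists_boundary_cutoff hΩ hb hp1' ENNReal.ofReal_ne_top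
    hq0 hσ hWm hdW hlim hdlim hU hUΩ hc
  -- Θ n competes in the capacity. Its energy outside Ω is zero because it is locally constant
  -- there, and inside Ω the indicator is 1 almost everywhere by `hWc`.
  have hle : ∀ n, pCapacity p Ωᶜ ≤ (eLpNorm ({x | x ∈ U → c ≤ W x}.indicator (gradient (Θ n)))
      (ENNReal.ofReal p) (volume.restrict Ω)) ^ p := by
    intro n
    have h1 : eLpNorm ({x | x ∈ U → c ≤ W x}.indicator (gradient (Θ n)))
        (ENNReal.ofReal p) (volume.restrict Ω)
        = eLpNorm (gradient (Θ n)) (ENNReal.ofReal p) (volume.restrict Ω) := by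
      refine eLpNorm_congr_ae (hWc.mono fun x hx => ?_)
      exact Set.indicator_of_mem (s := {x | x ∈ U → c ≤ W x}) hx _
    rw [h1, eLpNorm_eq_lintegral_rpow_enorm_toReal hp0 ENNReal.ofReal_ne_top, ← ENNReal.rpow_mul,
      ENNReal.toReal_ofReal hpos.le, one_div_mul_cancel hpos.ne', ENNReal.rpow_one]
    have hadm : ContDiff ℝ ∞ (Θ n) ∧ HasCompactSupport (Θ n) ∧ ∀ x ∈ Ωᶜ, 1 ≤ Θ n x :=
      ⟨(hΘ n).1, (hΘ n).2.1, fun x hx => ((hΘ n).2.2.2.self_of_nhdsSet x hx).ge⟩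
    refine (iInf₂_le (Θ n) hadm).trans_eq ?_
    · rw [← lintegral_indicator hΩ.measurableSet]
      refine lintegral_congr fun x => ?_
      by_cases hx : x ∈ Ω
      · rw [Set.indicator_of_mem hx]
      · rw [Set.indicator_of_notMem hx]
        have h2 : Θ n =ᶠ[𝓝 x] fun _ => 1 :=
          (hΘ n).2.2.2.filter_mono (nhds_le_nhdsSet hx)
        rw [h2.gradient_eq, gradient_fun_const, enorm_zero, ENNReal.zero_rpow_of_pos hpos]
  have hl := hΘl.ennrpow_const p
  rw [ENNReal.zero_rpow_of_pos hpos] at hl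
  exact le_antisymm (ge_of_tendsto' hl hle) zero_le

end BoundaryCutoff

/-! ### The weak formulation and its extension to bounded Sobolev test functions. -/

section WeakForm

lemma MeasureTheory.MemLp.integrable_inner' {α F : Type*} [MeasurableSpace α] {μ : Measure α}
    [NormedAddCommGroup F] [InnerProductSpace ℝ F] {f g : α → F} {a b : ENNReal}
    (hf : MemLp f a μ) (hg : MemLp g b μ) (hab : a.HolderConjugate b) :
    Integrable (fun x => inner ℝ (f x) (g x)) μ := by
  rw [← memLp_one_iff_integrable]
  refine MemLp.of_bilin (fun x y => inner ℝ x y) 1 hf hg (hf.1.inner hg.1)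
    (Eventually.of_forall fun x => ?_)
  rw [one_mul]
  exact_mod_cast norm_inner_le_norm (𝕜 := ℝ) (f x) (g x)

lemma tendsto_integral_inner {α F : Type*} [MeasurableSpace α] {μ : Measure α}
    [NormedAddCommGroup F] [InnerProductSpace ℝ F] {f : α → F} {g : ℕ → α → F} {g0 : α → F}
    {a b : ENNReal} (hf : MemLp f a μ) (hg : ∀ n, MemLp (g n) b μ) (hg0 : MemLp g0 b μ)
    (hab : a.HolderConjugate b)
    (hl : Tendsto (fun n => eLpNorm (fun x => g n x - g0 x) b μ) atTop (𝓝 0)) :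
    Tendsto (fun n => ∫ x, inner ℝ (f x) (g n x) ∂μ) atTop (𝓝 (∫ x, inner ℝ (f x) (g0 x) ∂μ)) := by
  rw [tendsto_iff_norm_sub_tendsto_zero]
  have hfin : eLpNorm f a μ ≠ ⊤ := hf.2.ne
  have h1 : Tendsto (fun n => (eLpNorm f a μ * eLpNorm (fun x => g n x - g0 x) b μ).toReal) atTop
      (𝓝 0) := by
    have := ENNReal.Tendsto.const_mul (a := eLpNorm f a μ) hl (Or.inr hfin)
    rw [mul_zero] at this
    exact (ENNReal.continuousAt_toReal ENNReal.zero_ne_top).tendsto.comp this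
  refine squeeze_zero (fun n => norm_nonneg _) (fun n => ?_) h1
  have hsub : MemLp (fun x => g n x - g0 x) b μ := (hg n).sub hg0
  rw [← integral_sub (hf.integrable_inner' (hg n) hab) (hf.integrable_inner' hg0 hab)]
  simp only [← inner_sub_right]
  refine (norm_integral_le_lintegral_norm _).trans ?_
  refine ENNReal.toReal_mono (ENNReal.mul_ne_top hfin hsub.2.ne) ?_
  have h2 := eLpNorm_le_eLpNorm_mul_eLpNorm'_of_norm (r := 1) (p := a) (q := b) hf.1 hsub.1
    (fun x y => inner ℝ x y) 1 (Eventually.of_forall fun x => by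
      simpa using norm_inner_le_norm (𝕜 := ℝ) (f x) (g n x - g0 x))
  simp only [ENNReal.coe_one, one_mul] at h2
  refine le_trans (le_of_eq ?_) h2
  rw [eLpNorm_one_eq_lintegral_enorm]
  simp only [ofReal_norm]

variable {N : ℕ}

local notation "𝔼" => EuclideanSpace ℝ (Fin N)

/-- The flux `|z|^{p-2} z` of the `p`-Laplacian. -/
noncomputable def pFlux {F : Type*} [NormedAddCommGroup F] [NormedSpace ℝ F] (p : ℝ) (z : F) : F :=
  ‖z‖ ^ (p - 2) • z

lemma norm_pFlux {F : Type*} [NormedAddCommGroup F] [NormedSpace ℝ F] {p : ℝ} (hp : 1 < p) (z : F) :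
    ‖pFlux p z‖ = ‖z‖ ^ (p - 1) := by
  rw [pFlux, norm_smul, Real.norm_of_nonneg (by positivity)]
  rcases eq_or_ne z 0 with rfl | hz
  · rw [norm_zero, mul_zero, Real.zero_rpow (by linarith)]
  · rw [show p - 1 = (p - 2) + 1 by ring, Real.rpow_add_one (norm_ne_zero_iff.2 hz)]

lemma pFlux_real (p a : ℝ) : |a| ^ (p - 2) * a = pFlux p a := by
  simp [pFlux]

lemma inner_pFlux {F : Type*} [NormedAddCommGroup F] [InnerProductSpace ℝ F] (p : ℝ) (y z : F) :
    inner ℝ (pFlux p z) y = ‖z‖ ^ (p - 2) * inner ℝ z y :=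
  real_inner_smul_left _ _ _

lemma memLp_pFlux {α F : Type*} [MeasurableSpace α] {ν : Measure α} [NormedAddCommGroup F]
    [NormedSpace ℝ F] {p s : ℝ} (hp : 1 < p) {f : α → F}
    (hf : MemLp f (ENNReal.ofReal s) ν) :
    MemLp (fun x => pFlux p (f x)) (ENNReal.ofReal (s / (p - 1))) ν := by
  have h := hf.norm_rpow_div (ENNReal.ofReal (p - 1))
  rw [ENNReal.toReal_ofReal (by linarith), ← ENNReal.ofReal_div_of_pos (by linarith)] at h
  refine MemLp.congr_norm h ?_ (Eventually.of_forall fun x => ?_)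
  · exact (hf.1.norm.aemeasurable.pow_const _).aestronglyMeasurable.smul hf.1
  · rw [norm_pFlux hp, Real.norm_of_nonneg (by positivity)]

/-- The integrand of the weak formulation of
`-Δ_p u - μ |x|^{-p} |u|^{p-2} u = h |u|^{p-2} u`, tested with a function `φ` of gradient `G`. -/
noncomputable def weakForm (p μ : ℝ) (h u : 𝔼 → ℝ) (du : 𝔼 → 𝔼) (φ : 𝔼 → ℝ) (G : 𝔼 → 𝔼)
    (x : 𝔼) : ℝ :=
  inner ℝ (pFlux p (du x)) (G x) - (μ / ‖x‖ ^ p + h x) * pFlux p (u x) * φ x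

lemma one_lt_sobolevExponent {p : ℝ} (hp : 1 < p) (hpN : p < N) : p < sobolevExponent N p := by
  rw [sobolevExponent, lt_div_iff₀ (by linarith)]
  nlinarith

/-- Local integrability of the zero-order coefficients. -/
lemma integrableOn_coeff {p : ℝ} (hp : 1 < p) (hpN : p < N) {Ω : Set 𝔼} {h u : 𝔼 → ℝ}
    (hu : MemLp u (ENNReal.ofReal (sobolevExponent N p)) (volume.restrict Ω))
    (hh : MemLp h (ENNReal.ofReal (N / p)) (volume.restrict Ω)) (μ R : ℝ) :
    IntegrableOn (fun x => (μ / ‖x‖ ^ p) * pFlux p (u x)) (Ω ∩ Metric.ball 0 R) ∧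
    IntegrableOn (fun x => h x * pFlux p (u x)) (Ω ∩ Metric.ball 0 R) := by
  have hN : (0 : ℝ) < N := by linarith
  have hNp : (0 : ℝ) < N - p := by linarith
  have hp0 : 0 < p := by linarith
  have hp1 : 0 < p - 1 := by linarith
  have hse : 0 < sobolevExponent N p := by linarith [one_lt_sobolevExponent hp hpN]
  set ν := (volume : Measure 𝔼).restrict (Ω ∩ Metric.ball 0 R) with hν
  have : IsFiniteMeasure ν := ⟨by
    rw [hν, Measure.restrict_apply_univ]
    exact (measure_mono Set.inter_subset_right).trans_lt measure_ball_lt_top⟩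
  have hu' : MemLp u (ENNReal.ofReal (sobolevExponent N p)) ν :=
    hu.mono_measure (Measure.restrict_mono Set.inter_subset_left le_rfl)
  have hh' : MemLp h (ENNReal.ofReal (N / p)) ν :=
    hh.mono_measure (Measure.restrict_mono Set.inter_subset_left le_rfl)
  have hk := memLp_pFlux hp hu'
  constructor
  -- This t is the Hölder conjugate of p* / (p - 1), the exponent of |u|^(p-1). The weight |x|^(-p)
  -- is locally in L^t since p t < N, which amounts to p < N.
  · set t : ℝ := N * p / (p ^ 2 + N - p) with ht
    have hden : 0 < p ^ 2 + N - p := by nlinarith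
    have ht0 : 0 < t := by positivity
    have hconj : t.HolderConjugate (sobolevExponent N p / (p - 1)) := by
      rw [Real.holderConjugate_iff]
      constructor
      · rw [ht, lt_div_iff₀ hden]
        nlinarith [mul_pos hNp hp1]
      · rw [ht, sobolevExponent]
        field_simp
        ring
    have hw : MemLp (fun x : 𝔼 => μ / ‖x‖ ^ p) (ENNReal.ofReal t) ν := by
      have hm : AEStronglyMeasurable (fun x : 𝔼 => μ / ‖x‖ ^ p) volume :=
        (measurable_const.div (measurable_norm.pow_const p)).aestronglyMeasurable
      have hball : MemLp (fun x : 𝔼 => μ / ‖x‖ ^ p) (ENNReal.ofReal t)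
          (volume.restrict (Metric.ball 0 R)) := by
        rw [← integrable_norm_rpow_iff hm.restrict (by simpa using ht0) ENNReal.ofReal_ne_top,
          ENNReal.toReal_ofReal ht0.le]
        refine integrableOn_ball_of_norm_le_rpow (C := |μ| ^ t) (α := p * t) ?_ ?_ ?_ ?_
        · rw [finrank_euclideanSpace_fin]
          exact_mod_cast hN
        · rw [finrank_euclideanSpace_fin, ht, ← mul_div_assoc, div_lt_iff₀ hden]
          nlinarith
        · refine Eventually.of_forall fun x => le_of_eq ?_
          rw [Real.norm_of_nonneg (by positivity), Real.norm_eq_abs, abs_div,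
            abs_of_nonneg (show 0 ≤ ‖x‖ ^ p by positivity), Real.div_rpow (abs_nonneg _)
            (by positivity), ← Real.rpow_mul (norm_nonneg _), Real.rpow_neg (norm_nonneg _),
            div_eq_mul_inv]
        · exact (hm.norm.aemeasurable.pow_const _).aestronglyMeasurable
      exact hball.mono_measure (Measure.restrict_mono Set.inter_subset_right le_rfl)
    have := hconj.ennrealOfReal
    exact hw.integrable_mul hk
  -- The conjugate N / (N - p) of N / p is at most p* / (p - 1), so on the ball, of finite measure,
  -- |u|^(p-1) belongs to it.
  · have hconj : (N / p : ℝ).HolderConjugate (N / (N - p)) := by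
      rw [Real.holderConjugate_iff]
      constructor
      · rw [lt_div_iff₀ hp0]
        linarith
      · field_simp
        ring
    have := hconj.ennrealOfReal
    refine hh'.integrable_mul (q := ENNReal.ofReal (N / (N - p)))
      (hk.mono_exponent (ENNReal.ofReal_le_ofReal ?_))
    rw [sobolevExponent, div_div, div_le_div_iff₀ hNp (by positivity)]
    nlinarith [mul_pos hN hNp]

lemma integrable_mul_of_integrableOn_ball {Ω : Set 𝔼} {K : 𝔼 → ℝ} {R C : ℝ}
    (hK : IntegrableOn K (Ω ∩ Metric.ball 0 R)) :
    Integrable ((Metric.ball 0 R).indicator fun x => C * ‖K x‖) (volume.restrict Ω) := by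
  rw [integrable_indicator_iff measurableSet_ball, IntegrableOn,
    Measure.restrict_restrict measurableSet_ball, Set.inter_comm]
  exact hK.norm.const_mul C

/-- Passage to the limit in the weak formulation. -/
lemma tendsto_integral_weakForm {p μ : ℝ} (hp : 1 < p) (hpN : p < N) {Ω : Set 𝔼} {h u : 𝔼 → ℝ}
    {du : 𝔼 → 𝔼} (hu : MemLp u (ENNReal.ofReal (sobolevExponent N p)) (volume.restrict Ω))
    (hdu : MemLp du (ENNReal.ofReal p) (volume.restrict Ω))
    (hh : MemLp h (ENNReal.ofReal (N / p)) (volume.restrict Ω))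
    {φ : ℕ → 𝔼 → ℝ} {φ0 : 𝔼 → ℝ} {G : ℕ → 𝔼 → 𝔼} {G0 : 𝔼 → 𝔼} {C R : ℝ}
    (hφm : ∀ n, AEStronglyMeasurable (φ n) (volume.restrict Ω))
    (hφC : ∀ n, ∀ᵐ x ∂(volume.restrict Ω), |φ n x| ≤ C)
    (hφR : ∀ n, ∀ x, x ∉ Metric.ball 0 R → φ n x = 0)
    (hφl : ∀ᵐ x ∂(volume.restrict Ω), Tendsto (fun n => φ n x) atTop (𝓝 (φ0 x)))
    (hG : ∀ n, MemLp (G n) (ENNReal.ofReal p) (volume.restrict Ω))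
    (hG0 : MemLp G0 (ENNReal.ofReal p) (volume.restrict Ω))
    (hGl : Tendsto (fun n => eLpNorm (fun x => G n x - G0 x) (ENNReal.ofReal p)
      (volume.restrict Ω)) atTop (𝓝 0)) :
    (∀ n, Integrable (weakForm p μ h u du (φ n) (G n)) (volume.restrict Ω)) ∧
    Integrable (weakForm p μ h u du φ0 G0) (volume.restrict Ω) ∧
    Tendsto (fun n => ∫ x in Ω, weakForm p μ h u du (φ n) (G n) x) atTop
      (𝓝 (∫ x in Ω, weakForm p μ h u du φ0 G0 x)) := by
  have hp0 : 0 < p := by linarith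
  have hfl : MemLp (fun x => pFlux p (du x)) (ENNReal.ofReal (p / (p - 1))) (volume.restrict Ω) :=
    memLp_pFlux hp hdu
  have hconj : (p / (p - 1)).HolderConjugate p := (Real.HolderConjugate.conjExponent hp).symm
  have hconj' := hconj.ennrealOfReal
  obtain ⟨k1, k2⟩ := integrableOn_coeff hp hpN hu hh μ R
  have hK : IntegrableOn (fun x => (μ / ‖x‖ ^ p + h x) * pFlux p (u x)) (Ω ∩ Metric.ball 0 R) := by
    simp only [add_mul]
    exact k1.add k2
  have hm : AEStronglyMeasurable (fun x => (μ / ‖x‖ ^ p + h x) * pFlux p (u x))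
      (volume.restrict Ω) := by
    refine AEStronglyMeasurable.mul (AEStronglyMeasurable.add ?_ hh.1) ?_
    · exact (measurable_const.div (measurable_norm.pow_const p)).aestronglyMeasurable
    · exact (hu.1.norm.aemeasurable.pow_const _).aestronglyMeasurable.smul hu.1
  have hdom := integrable_mul_of_integrableOn_ball (C := C) hK
  have hbd : ∀ n, ∀ᵐ x ∂(volume.restrict Ω), ‖(μ / ‖x‖ ^ p + h x) * pFlux p (u x) * φ n x‖
      ≤ (Metric.ball 0 R).indicator (fun x => C * ‖(μ / ‖x‖ ^ p + h x) * pFlux p (u x)‖) x := by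
    intro n
    filter_upwards [hφC n] with x hx
    by_cases hxR : x ∈ Metric.ball 0 R
    · rw [Set.indicator_of_mem hxR, norm_mul _ (φ n x), mul_comm C]
      exact mul_le_mul_of_nonneg_left hx (norm_nonneg _)
    · rw [Set.indicator_of_notMem hxR, hφR n x hxR, mul_zero, norm_zero]
  have hint : ∀ n, Integrable (fun x => (μ / ‖x‖ ^ p + h x) * pFlux p (u x) * φ n x)
      (volume.restrict Ω) := fun n => hdom.mono' (hm.mul (hφm n)) (hbd n)
  have hφ0m : AEStronglyMeasurable φ0 (volume.restrict Ω) :=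
    aestronglyMeasurable_of_tendsto_ae atTop hφm hφl
  have hint0 : Integrable (fun x => (μ / ‖x‖ ^ p + h x) * pFlux p (u x) * φ0 x)
      (volume.restrict Ω) := by
    refine hdom.mono' (hm.mul hφ0m) ?_
    filter_upwards [hφl, ae_all_iff.2 hbd] with x hx hb
    exact le_of_tendsto' (hx.const_mul _).norm hb
  have hin : ∀ n, Integrable (fun x => inner ℝ (pFlux p (du x)) (G n x)) (volume.restrict Ω) :=
    fun n => hfl.integrable_inner' (hG n) hconj'
  have hin0 : Integrable (fun x => inner ℝ (pFlux p (du x)) (G0 x)) (volume.restrict Ω) :=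
    hfl.integrable_inner' hG0 hconj'
  refine ⟨fun n => (hin n).sub (hint n), hin0.sub hint0, ?_⟩
  have t1 := tendsto_integral_inner hfl hG hG0 hconj' hGl
  have t2 : Tendsto (fun n => ∫ x in Ω, (μ / ‖x‖ ^ p + h x) * pFlux p (u x) * φ n x) atTop
      (𝓝 (∫ x in Ω, (μ / ‖x‖ ^ p + h x) * pFlux p (u x) * φ0 x)) :=
    tendsto_integral_of_dominated_convergence _ (fun n => (hint n).1) hdom hbd
      (hφl.mono fun x hx => hx.const_mul _)
  have t3 := t1.sub t2
  rw [← integral_sub hin0 hint0] at t3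
  refine t3.congr fun n => ?_
  rw [← integral_sub (hin n) (hint n)]
  rfl

lemma IsTestFunction.memLp_gradient {Ω' Ω : Set 𝔼} {φ : 𝔼 → ℝ} (hφ : IsTestFunction Ω' φ)
    (q : ENNReal) : MemLp (gradient φ) q (volume.restrict Ω) :=
  (hφ.1.continuous_gradient.memLp_of_hasCompactSupport hφ.2.1.gradient).restrict Ω

lemma HasCompactSupport.exists_ball {F : Type*} [Zero F] {φ : 𝔼 → F} (hφ : HasCompactSupport φ) :
    ∃ R : ℝ, tsupport φ ⊆ Metric.ball 0 R := by
  obtain ⟨R, hR⟩ := hφ.isCompact.isBounded.subset_ball 0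
  exact ⟨R, hR⟩

/-- Merging the two sides of the definition into one integral requires each side to be integrable,
since a Bochner integral without integrability is 0 by default. Integrability comes from
`tendsto_integral_weakForm` with constant sequences, for h and for the zero potential; the
right-hand side is the difference of the two resulting forms. -/
lemma IsWeakSubsolution.integral_weakForm_testFunction_le {p μ : ℝ} (hp : 1 < p) (hpN : p < N)
    {Ω : Set 𝔼} {h u : 𝔼 → ℝ} (hu : IsWeakSubsolution p μ Ω h u)
    (hh : MemLp h (ENNReal.ofReal (N / p)) (volume.restrict Ω)) {φ : 𝔼 → ℝ}
    (hφ : IsTestFunction Ω φ) (hφ0 : ∀ x, 0 ≤ φ x) :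
    ∫ x in Ω, weakForm p μ h u (weakGrad Ω u) φ (gradient φ) x ≤ 0 := by
  obtain ⟨⟨hup, -, hdu⟩, hw⟩ := hu
  obtain ⟨R, hR⟩ := hφ.2.1.exists_ball
  obtain ⟨C, hC⟩ := hφ.1.continuous.bounded_above_of_compact_support hφ.2.1
  have hconst : ∀ {h' : 𝔼 → ℝ}, MemLp h' (ENNReal.ofReal (N / p)) (volume.restrict Ω) → ∀ ν : ℝ,
      Integrable (weakForm p ν h' u (weakGrad Ω u) φ (gradient φ)) (volume.restrict Ω) := by
    intro h' hh' ν
    refine (tendsto_integral_weakForm (μ := ν) hp hpN hup hdu hh' (φ := fun _ => φ) (φ0 := φ)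
      (G := fun _ => gradient φ) (G0 := gradient φ) (C := C) (R := R)
      (fun _ => hφ.1.continuous.aestronglyMeasurable) (fun _ => Eventually.of_forall hC)
      (fun _ x hx => image_eq_zero_of_notMem_tsupport fun h => hx (hR h))
      (Eventually.of_forall fun _ => tendsto_const_nhds) (fun _ => hφ.memLp_gradient _)
      (hφ.memLp_gradient _) ?_).2.1
    simp
  have i1 := hconst (h' := fun _ => 0) (MemLp.zero' ) μ
  have i2 := (hconst (h' := fun _ => 0) (MemLp.zero' ) μ).sub (hconst hh μ)
  have hw' := hw φ hφ hφ0
  have e1 : ∀ x, ‖weakGrad Ω u x‖ ^ (p - 2) * inner ℝ (weakGrad Ω u x) (gradient φ x)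
      - μ / ‖x‖ ^ p * (|u x| ^ (p - 2) * u x) * φ x
      = weakForm p μ (fun _ => 0) u (weakGrad Ω u) φ (gradient φ) x := by
    intro x
    rw [weakForm, pFlux_real, inner_pFlux]
    ring
  have e2 : ∀ x, h x * (|u x| ^ (p - 2) * u x) * φ x
      = (weakForm p μ (fun _ => 0) u (weakGrad Ω u) φ (gradient φ)
        - weakForm p μ h u (weakGrad Ω u) φ (gradient φ)) x := by
    intro x
    rw [Pi.sub_apply, weakForm, weakForm, pFlux_real]
    ring
  simp only [e1, e2] at hw'
  have e3 := integral_sub i1 (hconst hh μ)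
  simp only [Pi.sub_apply] at hw' e3
  linarith

lemma memLp_gradient_mul {Ω Ω' : Set 𝔼} {q : ENNReal} {Φ : 𝔼 → ℝ} {dΦ : 𝔼 → 𝔼} {C : ℝ}
    (hΦ : AEStronglyMeasurable Φ (volume.restrict Ω)) (hΦC : ∀ᵐ x ∂(volume.restrict Ω), |Φ x| ≤ C)
    (hdΦ : MemLp dΦ q (volume.restrict Ω)) {m : 𝔼 → ℝ} (hm : IsTestFunction Ω' m) :
    MemLp (fun x => m x • dΦ x + Φ x • gradient m x) q (volume.restrict Ω) := by
  obtain ⟨M, hM⟩ := hm.1.continuous.bounded_above_of_compact_support hm.2.1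
  refine MemLp.add ?_ ?_
  · refine MemLp.of_le_mul (c := M) hdΦ
      (hm.1.continuous.aestronglyMeasurable.smul hdΦ.1) (Eventually.of_forall fun x => ?_)
    rw [norm_smul]
    exact mul_le_mul_of_nonneg_right (hM x) (norm_nonneg _)
  · refine MemLp.of_le_mul (c := C) (hm.memLp_gradient _)
      (hΦ.smul hm.1.continuous_gradient.aestronglyMeasurable) ?_
    filter_upwards [hΦC] with x hx
    rw [norm_smul]
    exact mul_le_mul_of_nonneg_right hx (norm_nonneg _)

/-- Subsolutions may be tested with bounded weakly differentiable functions cut off by a test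
function. -/
lemma IsWeakSubsolution.integral_weakForm_le {p μ : ℝ} (hp : 1 < p) (hpN : p < N)
    {Ω : Set 𝔼} (hΩ : IsOpen Ω) {h u : 𝔼 → ℝ} (hu : IsWeakSubsolution p μ Ω h u)
    (hh : MemLp h (ENNReal.ofReal (N / p)) (volume.restrict Ω)) {Φ : 𝔼 → ℝ} {dΦ : 𝔼 → 𝔼} {C : ℝ}
    (hC : 0 ≤ C) (hΦ : HasWeakGradient Ω Φ dΦ) (hΦC : ∀ᵐ x ∂(volume.restrict Ω), |Φ x| ≤ C)
    (hΦ0 : ∀ᵐ x ∂(volume.restrict Ω), 0 ≤ Φ x)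
    (hdΦ : MemLp dΦ (ENNReal.ofReal p) (volume.restrict Ω))
    {m : 𝔼 → ℝ} (hm : IsTestFunction Ω m) (hm0 : ∀ x, 0 ≤ m x) :
    Integrable (weakForm p μ h u (weakGrad Ω u) (fun x => m x * Φ x)
      (fun x => m x • dΦ x + Φ x • gradient m x)) (volume.restrict Ω) ∧
    ∫ x in Ω, weakForm p μ h u (weakGrad Ω u) (fun x => m x * Φ x)
      (fun x => m x • dΦ x + Φ x • gradient m x) x ≤ 0 := by
  have hp0 : 0 < p := by linarith
  obtain ⟨i1, i2, hw⟩ := hΦ.testFunction_mul hm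
  obtain ⟨M, hM⟩ := hm.1.continuous.bounded_above_of_compact_support hm.2.1
  set f : 𝔼 → ℝ := fun x => m x * Φ x with hf
  set G : 𝔼 → 𝔼 := fun x => m x • dΦ x + Φ x • gradient m x with hG
  rw [ae_restrict_iff' hΩ.measurableSet] at hΦC hΦ0
  have hfC : ∀ᵐ x, ‖f x‖ ≤ M * C := by
    filter_upwards [hΦC] with x hx
    by_cases hxΩ : x ∈ Ω
    · rw [hf, norm_mul]
      exact mul_le_mul (hM x) (hx hxΩ) (norm_nonneg _) ((norm_nonneg _).trans (hM x))
    · have h1 : m x = 0 := hm.eq_zero hxΩ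
      rw [hf]
      simp only [h1, zero_mul, norm_zero]
      exact mul_nonneg ((norm_nonneg _).trans (hM x)) hC
  have hf0 : ∀ᵐ x, 0 ≤ f x := by
    filter_upwards [hΦ0] with x hx
    by_cases hxΩ : x ∈ Ω
    · exact mul_nonneg (hm0 x) (hx hxΩ)
    · rw [hf]
      simp only [hm.eq_zero hxΩ, zero_mul, le_refl]
  -- The cut-off m makes G vanish outside Ω, so G is in L^p on the whole space and its
  -- mollifications converge there.
  have hGL : MemLp G (ENNReal.ofReal p) := by
    have h1 : MemLp G (ENNReal.ofReal p) (volume.restrict Ω) :=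
      memLp_gradient_mul hΦ.1.aestronglyMeasurable ((ae_restrict_iff' hΩ.measurableSet).2 hΦC)
        hdΦ hm
    rw [← memLp_indicator_iff_restrict hΩ.measurableSet] at h1
    have hind : Ω.indicator G = G := by
      refine Set.indicator_eq_self.2 fun x hx => ?_
      by_contra hxΩ
      refine hx ?_
      simp only [hG, hm.eq_zero hxΩ, hm.gradient_eq_zero hxΩ, zero_smul, smul_zero, add_zero]
    rwa [hind] at h1
  have hfm : tsupport f ⊆ tsupport m := closure_mono fun x hx => left_ne_zero_of_mul hx
  have hfc : HasCompactSupport f := hm.2.1.of_isClosed_subset (isClosed_tsupport _) hfm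
  -- A compact δ-thickening of the support still fits in Ω. Shifting the index by n0 makes every
  -- mollification a test function of Ω, with supports in a common ball.
  obtain ⟨δ, hδ, hδΩ⟩ := IsCompact.exists_cthickening_subset_open hfc.isCompact hΩ
    (hfm.trans hm.2.2)
  obtain ⟨n0, hn0⟩ := exists_nat_one_div_lt hδ
  have hcth : IsCompact (Metric.cthickening δ (tsupport f)) := hfc.isCompact.cthickening
  obtain ⟨R, hR⟩ := hcth.isBounded.subset_ball 0
  have hsub : ∀ n, tsupport (mollify (n + n0) f) ⊆ Metric.cthickening δ (tsupport f) := by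
    intro n
    refine (tsupport_mollify_subset _ f).trans (Metric.cthickening_mono ?_ _)
    refine le_trans ?_ hn0.le
    push_cast
    gcongr
    linarith [(Nat.cast_nonneg n : (0 : ℝ) ≤ n)]
  have htest : ∀ n, IsTestFunction Ω (mollify (n + n0) f) := fun n =>
    ⟨contDiff_mollify _ i1.locallyIntegrable, hasCompactSupport_mollify _ hfc,
      (hsub n).trans hδΩ⟩
  have hgrad : ∀ n, gradient (mollify (n + n0) f) = mollify (n + n0) G := fun n =>
    gradient_eq fun x => hasGradientAt_mollify _ i1.locallyIntegrable i2.locallyIntegrable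
      (fun φ h1 h2 => hw.integral_eq ⟨h1, h2, Set.subset_univ _⟩) x
  have hp1 : 1 ≤ ENNReal.ofReal p := by simpa using hp.le
  have hlimG := (tendsto_eLpNorm_mollify_sub hp1 ENNReal.ofReal_ne_top hGL).comp
    (tendsto_add_atTop_nat n0)
  have hae := ae_tendsto_mollify i1.locallyIntegrable
  obtain ⟨-, j2, j3⟩ := tendsto_integral_weakForm (μ := μ) hp hpN hu.1.1 hu.1.2.2 hh
    (φ := fun n => mollify (n + n0) f) (φ0 := f) (G := fun n => gradient (mollify (n + n0) f))
    (G0 := G) (C := M * C) (R := R) (fun n => (htest n).1.continuous.aestronglyMeasurable)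
    (fun n => Eventually.of_forall fun x => norm_mollify_le _ hfC x)
    (fun n x hx => image_eq_zero_of_notMem_tsupport fun h => hx (hR (hsub n h)))
    ((ae_restrict_of_ae hae).mono fun x hx => hx.comp (tendsto_add_atTop_nat n0))
    (fun n => (htest n).memLp_gradient _) (hGL.restrict Ω) (by
      refine tendsto_of_tendsto_of_tendsto_of_le_of_le tendsto_const_nhds hlimG
        (fun _ => zero_le) fun n => ?_
      simp only [hgrad]
      exact eLpNorm_mono_measure _ Measure.restrict_le_self)
  refine ⟨j2, le_of_tendsto' j3 fun n => ?_⟩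
  exact hu.integral_weakForm_testFunction_le hp hpN hh (htest n) fun x => mollify_nonneg _ hf0 x

end WeakForm

/-! ### Test functions that reach the boundary of the domain. -/

section Testing

variable {N : ℕ}

local notation "𝔼" => EuclideanSpace ℝ (Fin N)

/-- Subsolutions may be tested with bounded weakly differentiable functions of bounded support that
vanish on the boundary in the sense described by a sequence of boundary cut-offs. -/
lemma IsWeakSubsolution.integral_weakForm_le_of_cutoff {p μ : ℝ} (hp : 1 < p) (hpN : p < N)
    {Ω : Set 𝔼} (hΩ : IsOpen Ω) {h u : 𝔼 → ℝ} (hu : IsWeakSubsolution p μ Ω h u)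
    (hh : MemLp h (ENNReal.ofReal (N / p)) (volume.restrict Ω)) {Φ : 𝔼 → ℝ} {dΦ : 𝔼 → 𝔼} {C : ℝ}
    (hC : 0 ≤ C) (hΦ : HasWeakGradient Ω Φ dΦ) (hΦC : ∀ᵐ x ∂(volume.restrict Ω), |Φ x| ≤ C)
    (hΦ0 : ∀ᵐ x ∂(volume.restrict Ω), 0 ≤ Φ x)
    (hdΦ : MemLp dΦ (ENNReal.ofReal p) (volume.restrict Ω))
    {Θ : ℕ → 𝔼 → ℝ} {A : Set 𝔼}
    (hΘ : ∀ n, ContDiff ℝ ∞ (Θ n) ∧ HasCompactSupport (Θ n) ∧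
        (∀ x, Θ n x ∈ Set.Icc 0 1) ∧ ∀ᶠ x in 𝓝ˢ Ωᶜ, Θ n x = 1)
    (hΘ0 : ∀ᵐ x ∂(volume.restrict Ω), x ∈ A → Tendsto (fun n => Θ n x) atTop (𝓝 0))
    (hΘl : Tendsto (fun n => eLpNorm (A.indicator (gradient (Θ n))) (ENNReal.ofReal p)
        (volume.restrict Ω)) atTop (𝓝 0))
    (hΦA : ∀ᵐ x ∂(volume.restrict Ω), x ∉ A → Φ x = 0 ∧ dΦ x = 0)
    {η : 𝔼 → ℝ} (hη : IsTestFunction Set.univ η) (hη0 : ∀ x, 0 ≤ η x) :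
    Integrable (weakForm p μ h u (weakGrad Ω u) (fun x => η x * Φ x)
      (fun x => η x • dΦ x + Φ x • gradient η x)) (volume.restrict Ω) ∧
    ∫ x in Ω, weakForm p μ h u (weakGrad Ω u) (fun x => η x * Φ x)
      (fun x => η x • dΦ x + Φ x • gradient η x) x ≤ 0 := by
  have hp0 : ENNReal.ofReal p ≠ 0 := by simpa using (by linarith : 0 < p)
  have hp1 : 1 ≤ ENNReal.ofReal p := by simpa using hp.le
  obtain ⟨M, hM⟩ := hη.1.continuous.bounded_above_of_compact_support hη.2.1
  have hM0 : 0 ≤ M := (norm_nonneg _).trans (hM 0)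
  obtain ⟨R, hR⟩ := hη.2.1.exists_ball
  -- η need not vanish on ∂Ω, but η (1 - Θ n) is zero near Ωᶜ and is therefore an admissible
  -- cut-off; it tends to η on A.
  set m : ℕ → 𝔼 → ℝ := fun n x => η x * (1 - Θ n x) with hm
  have hΘd : ∀ n, ContDiff ℝ ∞ fun x => 1 - Θ n x := fun n => contDiff_const.sub (hΘ n).1
  have hmt : ∀ n, IsTestFunction Ω (m n) := by
    intro n
    refine ⟨hη.1.mul (hΘd n), hη.2.1.mul_right, fun x hx => ?_⟩
    by_contra hxΩ
    refine (notMem_tsupport_iff_eventuallyEq.2 ?_) hx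
    have h1 : ∀ᶠ y in 𝓝 x, Θ n y = 1 := (hΘ n).2.2.2.filter_mono (nhds_le_nhdsSet hxΩ)
    filter_upwards [h1] with y hy
    simp [hm, hy]
  have hm0 : ∀ n x, 0 ≤ m n x := fun n x =>
    mul_nonneg (hη0 x) (by linarith [((hΘ n).2.2.1 x).2])
  have hmM : ∀ n x, |m n x| ≤ M := fun n x => by
    rw [abs_of_nonneg (hm0 n x)]
    refine (mul_le_of_le_one_right (hη0 x) (by linarith [((hΘ n).2.2.1 x).1])).trans ?_
    exact (Real.le_norm_self _).trans (hM x)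
  have hgm : ∀ n x, gradient (m n) x = (1 - Θ n x) • gradient η x - η x • gradient (Θ n) x := by
    intro n x
    have h1 := (hη.1.differentiable (by simp) x).hasGradientAt
    have h2 := ((hΘ n).1.differentiable (by simp) x).hasGradientAt
    have h3 : HasGradientAt (fun y => 1 - Θ n y) (-gradient (Θ n) x) x := by
      have := HasGradientAt.comp_deriv (g := fun t => 1 - t)
        ((hasDerivAt_id (Θ n x)).const_sub 1) h2
      simpa using this
    rw [(h1.mul' h3).gradient, smul_neg]
    abel
  set G0 : 𝔼 → 𝔼 := fun x => η x • dΦ x + Φ x • gradient η x with hG0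
  have hG0L : MemLp G0 (ENNReal.ofReal p) (volume.restrict Ω) :=
    memLp_gradient_mul hΦ.1.aestronglyMeasurable hΦC hdΦ hη
  have hGL : ∀ n, MemLp (fun x => m n x • dΦ x + Φ x • gradient (m n) x) (ENNReal.ofReal p)
      (volume.restrict Ω) := fun n =>
    memLp_gradient_mul hΦ.1.aestronglyMeasurable hΦC hdΦ (hmt n)
  -- The gradient error consists of Θ G₀, small by dominated convergence, and η Φ ∇Θ. The latter may
  -- be restricted to A because Φ vanishes elsewhere, and only on A is ∇Θ known to be small.
  have hdiff : ∀ n, ∀ᵐ x ∂(volume.restrict Ω),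
      (m n x • dΦ x + Φ x • gradient (m n) x) - G0 x
        = -(Θ n x • G0 x) - (η x * Φ x) • A.indicator (gradient (Θ n)) x := by
    intro n
    filter_upwards [hΦA] with x hx
    by_cases hxA : x ∈ A
    · rw [Set.indicator_of_mem hxA, hgm, hG0, hm]
      module
    · obtain ⟨h1, h2⟩ := hx hxA
      simp [hG0, h1, h2]
  have hGl : Tendsto (fun n => eLpNorm (fun x => (m n x • dΦ x + Φ x • gradient (m n) x) - G0 x)
      (ENNReal.ofReal p) (volume.restrict Ω)) atTop (𝓝 0) := by
    have t1 : Tendsto (fun n => eLpNorm (fun x => Θ n x • G0 x) (ENNReal.ofReal p)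
        (volume.restrict Ω)) atTop (𝓝 0) := by
      refine tendsto_eLpNorm_zero_of_dominated (g := fun x => ‖G0 x‖) hp0 ENNReal.ofReal_ne_top
        (fun n => (hΘ n).1.continuous.aestronglyMeasurable.smul hG0L.1) hG0L.norm
        (fun n => Eventually.of_forall fun x => ?_) ?_
      · rw [norm_smul, Real.norm_of_nonneg ((hΘ n).2.2.1 x).1]
        exact mul_le_of_le_one_left (norm_nonneg _) ((hΘ n).2.2.1 x).2
      · filter_upwards [hΘ0, hΦA] with x h1 h2
        by_cases hxA : x ∈ A
        · simpa using (h1 hxA).smul_const (G0 x)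
        · obtain ⟨h3, h4⟩ := h2 hxA
          simp [hG0, h3, h4]
    have t2 := ENNReal.Tendsto.const_mul (a := ENNReal.ofReal (M * C)) hΘl
      (Or.inr ENNReal.ofReal_ne_top)
    have t3 := t1.add t2
    rw [mul_zero, add_zero] at t3
    refine tendsto_of_tendsto_of_tendsto_of_le_of_le tendsto_const_nhds t3 (fun _ => zero_le)
      fun n => ?_
    have e : (fun x => (m n x • dΦ x + Φ x • gradient (m n) x) - G0 x) =ᵐ[volume.restrict Ω]
        (fun x => -(Θ n x • G0 x)) + fun x =>
          ((m n x • dΦ x + Φ x • gradient (m n) x) - G0 x) + Θ n x • G0 x :=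
      Eventually.of_forall fun x => by simp
    rw [eLpNorm_congr_ae e]
    have m1 : AEStronglyMeasurable (fun x => Θ n x • G0 x) (volume.restrict Ω) :=
      (hΘ n).1.continuous.aestronglyMeasurable.smul hG0L.1
    refine (eLpNorm_add_le m1.neg (((hGL n).1.sub hG0L.1).add m1) hp1).trans (add_le_add ?_ ?_)
    · exact (eLpNorm_neg (fun x => Θ n x • G0 x) _ _).le
    · refine eLpNorm_le_mul_eLpNorm_of_ae_le_mul ?_ _
      filter_upwards [hdiff n, hΦC] with x h1 h2
      simp only [Pi.add_apply, Pi.sub_apply]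
      rw [h1, show ∀ a b : 𝔼, -a - b + a = -b by intros; abel, norm_neg, norm_smul, norm_mul]
      exact mul_le_mul_of_nonneg_right (mul_le_mul (hM x) h2 (norm_nonneg _) hM0) (norm_nonneg _)
  obtain ⟨-, j2, j3⟩ := tendsto_integral_weakForm (μ := μ) hp hpN hu.1.1 hu.1.2.2 hh
    (φ := fun n x => m n x * Φ x) (φ0 := fun x => η x * Φ x)
    (G := fun n x => m n x • dΦ x + Φ x • gradient (m n) x) (G0 := G0) (C := M * C) (R := R)
    (fun n => (hmt n).1.continuous.aestronglyMeasurable.mul hΦ.1.aestronglyMeasurable)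
    (fun n => by
      filter_upwards [hΦC] with x hx
      rw [abs_mul]
      exact mul_le_mul (hmM n x) hx (abs_nonneg _) hM0)
    (fun n x hx => by
      have : η x = 0 := image_eq_zero_of_notMem_tsupport fun h => hx (hR h)
      simp [hm, this])
    (by
      filter_upwards [hΘ0, hΦA] with x h1 h2
      by_cases hxA : x ∈ A
      · have := (((h1 hxA).const_sub 1).const_mul (η x)).mul_const (Φ x)
        simpa using this
      · simp [(h2 hxA).1])
    hGL hG0L hGl
  exact ⟨j2, le_of_tendsto' j3 fun n =>
    (hu.integral_weakForm_le hp hpN hΩ hh hC hΦ hΦC hΦ0 hdΦ (hmt n) (hm0 n)).2⟩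

end Testing

/-! ### Test functions as profiles of (u, v): derivatives and bounds. -/

section TestProfiles

/-- Because p > 1 the kink of the positive part is smoothed: at the origin the increment is at most
|y|^(p-1) |y| = o(|y|). This is why D^p, not D, goes into the C¹ chain rule. -/
lemma hasDerivAt_max_zero_rpow {p : ℝ} (hp : 1 < p) (x : ℝ) :
    HasDerivAt (fun x : ℝ => max x 0 ^ p) (p * max x 0 ^ (p - 1)) x := by
  rcases lt_trichotomy x 0 with h | rfl | h
  · have e : (fun x : ℝ => max x 0 ^ p) =ᶠ[𝓝 x] fun _ => 0 := by
      filter_upwards [gt_mem_nhds h] with y hy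
      rw [max_eq_right hy.le, Real.zero_rpow (by linarith)]
    rw [max_eq_right h.le, Real.zero_rpow (by linarith), mul_zero]
    exact (hasDerivAt_const x (0 : ℝ)).congr_of_eventuallyEq e
  · rw [max_self, Real.zero_rpow (by linarith), mul_zero, hasDerivAt_iff_isLittleO_nhds_zero]
    simp only [zero_add, max_self, smul_zero, sub_zero]
    rw [Real.zero_rpow (by linarith)]
    refine Asymptotics.isLittleO_iff.2 fun c hc => ?_
    have hlim : Tendsto (fun y : ℝ => |y| ^ (p - 1)) (𝓝 0) (𝓝 0) := by
      have : Continuous fun y : ℝ => |y| ^ (p - 1) :=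
        continuous_abs.rpow_const fun _ => Or.inr (by linarith)
      have h := this.tendsto 0
      rwa [abs_zero, Real.zero_rpow (by linarith)] at h
    filter_upwards [hlim.eventually (gt_mem_nhds hc)] with y hy
    rw [sub_zero, Real.norm_of_nonneg (by positivity), Real.norm_eq_abs]
    rcases eq_or_ne y 0 with rfl | hy0
    · simp [Real.zero_rpow (show p ≠ 0 by linarith)]
    · calc max y 0 ^ p ≤ |y| ^ p := by
            gcongr
            exact max_le (le_abs_self y) (abs_nonneg y)
        _ = |y| ^ (p - 1) * |y| := by
            rw [← Real.rpow_add_one (abs_ne_zero.2 hy0), sub_add_cancel]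
        _ ≤ c * |y| := by gcongr
  · have e : (fun x : ℝ => max x 0 ^ p) =ᶠ[𝓝 x] fun x => x ^ p := by
      filter_upwards [lt_mem_nhds h] with y hy
      rw [max_eq_left hy.le]
    rw [max_eq_left h.le]
    exact (Real.hasDerivAt_rpow_const (Or.inl h.ne')).congr_of_eventuallyEq e

/-- Bounded partials for profiles that vanish where `a < b + ε`. -/
lemma HasBoundedPartials.of_vanishing {ε : ℝ} (hε : 0 < ε) {Φ Φa Φb : ℝ → ℝ → ℝ}
    (h0 : ∀ a b, a < b + ε → 0 < b + ε → Φ a b = 0 ∧ Φa a b = 0 ∧ Φb a b = 0)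
    (hd : ∀ a b, 0 < a → 0 ≤ b → HasFDerivAt (fun z : ℝ × ℝ => Φ z.1 z.2)
      (Φa a b • ContinuousLinearMap.fst ℝ ℝ ℝ + Φb a b • ContinuousLinearMap.snd ℝ ℝ ℝ) (a, b))
    (hca : ∀ a b, 0 < a → 0 ≤ b → ContinuousAt (fun z : ℝ × ℝ => Φa z.1 z.2) (a, b))
    (hcb : ∀ a b, 0 < a → 0 ≤ b → ContinuousAt (fun z : ℝ × ℝ => Φb z.1 z.2) (a, b))
    {C : ℝ} (hC : 0 ≤ C)
    (hbd : ∀ a b, 0 ≤ b → b + ε ≤ a → |Φ a b| ≤ C ∧ |Φa a b| ≤ C ∧ |Φb a b| ≤ C) :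
    HasBoundedPartials Φ Φa Φb := by
  -- For a ≤ 0 ≤ b the inequalities a < b + ε and 0 < b + ε are strict, hence persist on a full
  -- neighbourhood, including slightly negative second arguments. The singularity at a = 0 is
  -- therefore never met.
  have hev : ∀ a b, ¬ 0 < a → 0 ≤ b → ∀ᶠ z : ℝ × ℝ in 𝓝 (a, b),
      Φ z.1 z.2 = 0 ∧ Φa z.1 z.2 = 0 ∧ Φb z.1 z.2 = 0 := by
    intro a b ha hb
    have hop1 : IsOpen {z : ℝ × ℝ | z.1 < z.2 + ε} := isOpen_lt (by fun_prop) (by fun_prop)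
    have hop2 : IsOpen {z : ℝ × ℝ | 0 < z.2 + ε} := isOpen_lt (by fun_prop) (by fun_prop)
    have hop : IsOpen {z : ℝ × ℝ | z.1 < z.2 + ε ∧ 0 < z.2 + ε} := hop1.inter hop2
    have hmem : (a, b) ∈ {z : ℝ × ℝ | z.1 < z.2 + ε ∧ 0 < z.2 + ε} := by
      constructor <;> simp only <;> linarith
    filter_upwards [hop.mem_nhds hmem] with z hz using h0 z.1 z.2 hz.1 hz.2
  refine ⟨fun a b hb => ?_, fun z hz => ?_, fun z hz => ?_, C, fun a b hb => ?_⟩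
  · by_cases ha : 0 < a
    · exact hd a b ha hb
    · have h := hev a b ha hb
      rw [h.self_of_nhds.2.1, h.self_of_nhds.2.2]
      simp only [zero_smul, add_zero]
      exact (hasFDerivAt_const (0 : ℝ) (a, b)).congr_of_eventuallyEq (h.mono fun z hz => hz.1)
  · refine ContinuousAt.continuousWithinAt ?_
    by_cases ha : 0 < z.1
    · exact hca z.1 z.2 ha hz
    · exact continuousAt_const.congr ((hev z.1 z.2 ha hz).mono fun z hz => hz.2.1.symm)
  · refine ContinuousAt.continuousWithinAt ?_
    by_cases ha : 0 < z.1
    · exact hcb z.1 z.2 ha hz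
    · exact continuousAt_const.congr ((hev z.1 z.2 ha hz).mono fun z hz => hz.2.2.symm)
  · rcases lt_or_ge a (b + ε) with h | h
    · obtain ⟨h1, h2, h3⟩ := h0 a b h (by linarith)
      rw [h1, h2, h3, abs_zero]
      exact ⟨hC, hC, hC⟩
    · exact hbd a b hb h

/-- The ratio `k / (k + |a|)` between the truncation `k a / (k + |a|)` and `a`. -/
noncomputable def truncRatio (k a : ℝ) : ℝ := k / (k + |a|)

lemma truncRatio_pos {k : ℝ} (hk : 0 < k) (a : ℝ) : 0 < truncRatio k a := by
  unfold truncRatio; positivity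

lemma truncRatio_le_one {k : ℝ} (hk : 0 < k) (a : ℝ) : truncRatio k a ≤ 1 := by
  unfold truncRatio
  rw [div_le_one (by positivity)]
  linarith [abs_nonneg a]

lemma truncRatio_mul_le {k : ℝ} (hk : 0 < k) {a : ℝ} (ha : 0 ≤ a) : truncRatio k a * a ≤ k := by
  unfold truncRatio
  rw [abs_of_nonneg ha, div_mul_eq_mul_div, div_le_iff₀ (by positivity)]
  nlinarith

lemma continuous_truncRatio {k : ℝ} (hk : 0 < k) : Continuous (truncRatio k) := by
  unfold truncRatio
  refine continuous_const.div (continuous_const.add continuous_abs) fun a => ?_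
  positivity

/-- The derivative of k a / (k + a) is k² / (k + a)², the square of the ratio. The truncation is
thus smooth on a > 0, and only the single quantity τ = k / (k + a) enters the energy computation. -/
lemma hasDerivAt_truncRatio_mul {k : ℝ} (hk : 0 < k) {a : ℝ} (ha : 0 < a) :
    HasDerivAt (fun a => truncRatio k a * a) (truncRatio k a ^ 2) a := by
  have e : (fun a => truncRatio k a * a) =ᶠ[𝓝 a] fun a => k / (k + a) * a := by
    filter_upwards [lt_mem_nhds ha] with y hy
    rw [truncRatio, abs_of_pos hy]
  have h := ((hasDerivAt_const a k).div ((hasDerivAt_id a).const_add k)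
    (by simp only [id]; positivity)).mul (hasDerivAt_id a)
  refine (h.congr_of_eventuallyEq e).congr_deriv ?_
  simp only [truncRatio, abs_of_pos ha, id, Pi.div_apply]
  field_simp
  ring

/-- The positive part of the difference between the truncation of `a` and `b + ε`. -/
noncomputable def gapPart (ε k a b : ℝ) : ℝ := max (truncRatio k a * a - (b + ε)) 0

lemma gapPart_nonneg (ε k a b : ℝ) : 0 ≤ gapPart ε k a b := le_max_right _ _

lemma gapPart_eq_zero {ε k a b : ℝ} (hk : 0 < k) (h : a < b + ε) (hb : 0 < b + ε) :
    gapPart ε k a b = 0 := by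
  refine max_eq_right ?_
  have h1 := truncRatio_pos hk a
  have h2 := truncRatio_le_one hk a
  rcases le_or_gt a 0 with ha | ha
  · nlinarith
  · nlinarith

lemma gapPart_le {ε k a b : ℝ} (hk : 0 < k) (hb : 0 ≤ b + ε) (ha : 0 ≤ a) :
    gapPart ε k a b ≤ truncRatio k a * a := by
  refine max_le (by linarith) ?_
  exact mul_nonneg (truncRatio_pos hk a).le ha

lemma continuous_gapPart {ε k : ℝ} (hk : 0 < k) :
    Continuous fun z : ℝ × ℝ => gapPart ε k z.1 z.2 := by
  have := continuous_truncRatio hk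
  unfold gapPart
  fun_prop

lemma hasFDerivAt_gapPart_rpow {p ε k : ℝ} (hp : 1 < p) (hk : 0 < k) {a b : ℝ} (ha : 0 < a) :
    HasFDerivAt (fun z : ℝ × ℝ => gapPart ε k z.1 z.2 ^ p)
      ((p * gapPart ε k a b ^ (p - 1)) • (truncRatio k a ^ 2 • ContinuousLinearMap.fst ℝ ℝ ℝ
        - ContinuousLinearMap.snd ℝ ℝ ℝ)) (a, b) := by
  have h1 : HasFDerivAt (fun z : ℝ × ℝ => truncRatio k z.1 * z.1)
      (truncRatio k a ^ 2 • ContinuousLinearMap.fst ℝ ℝ ℝ) (a, b) := by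
    have hf : HasFDerivAt (fun z : ℝ × ℝ => z.1) (ContinuousLinearMap.fst ℝ ℝ ℝ) (a, b) :=
      hasFDerivAt_fst
    have h := HasDerivAt.comp_hasFDerivAt (a, b) (hasDerivAt_truncRatio_mul hk ha) hf
    exact h
  have h2 : HasFDerivAt (fun z : ℝ × ℝ => truncRatio k z.1 * z.1 - (z.2 + ε))
      (truncRatio k a ^ 2 • ContinuousLinearMap.fst ℝ ℝ ℝ - ContinuousLinearMap.snd ℝ ℝ ℝ) (a, b) :=
    h1.sub (hasFDerivAt_snd.add_const ε)
  have h := HasDerivAt.comp_hasFDerivAt (a, b) (hasDerivAt_max_zero_rpow hp _) h2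
  exact h

/-- All six bounds follow from 0 ≤ D ≤ min(k, a) and b + ε ≥ ε, with D the value of `gapPart`: the
truncation of a lies below both a and the level k. -/
lemma gapPart_rpow_bounds {p ε k a b : ℝ} (hp : 1 < p) (hε : 0 < ε) (hk : 0 < k) (hb : 0 ≤ b)
    (hab : b + ε ≤ a) :
    gapPart ε k a b ^ p / a ^ (p - 1) ≤ k ∧ gapPart ε k a b ^ (p - 1) / a ^ (p - 1) ≤ 1 ∧
    gapPart ε k a b ^ p / a ^ p ≤ 1 ∧
    gapPart ε k a b ^ p / (b + ε) ^ (p - 1) ≤ k ^ p / ε ^ (p - 1) ∧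
    gapPart ε k a b ^ (p - 1) / (b + ε) ^ (p - 1) ≤ k ^ (p - 1) / ε ^ (p - 1) ∧
    gapPart ε k a b ^ p / (b + ε) ^ p ≤ k ^ p / ε ^ p := by
  have ha : 0 < a := by linarith
  have hD0 := gapPart_nonneg ε k a b
  have hDT := gapPart_le (ε := ε) (b := b) hk (by linarith) ha.le
  have hDk : gapPart ε k a b ≤ k := hDT.trans (truncRatio_mul_le hk ha.le)
  have hDa : gapPart ε k a b ≤ a := hDT.trans (mul_le_of_le_one_left ha.le (truncRatio_le_one hk a))
  have h1 : gapPart ε k a b ^ (p - 1) / a ^ (p - 1) ≤ 1 := by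
    rw [div_le_one (by positivity)]
    exact Real.rpow_le_rpow hD0 hDa (by linarith)
  have hpp : gapPart ε k a b ^ p = gapPart ε k a b ^ (p - 1) * gapPart ε k a b := by
    rw [← Real.rpow_add_one' hD0 (by linarith), sub_add_cancel]
  refine ⟨?_, h1, ?_, ?_, ?_, ?_⟩
  · rw [hpp, mul_div_right_comm]
    exact (mul_le_mul h1 hDk hD0 zero_le_one).trans_eq (one_mul k)
  · rw [div_le_one (by positivity)]
    exact Real.rpow_le_rpow hD0 hDa (by linarith)
  · gcongr
    linarith
  · gcongr
    linarith
  · gcongr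
    linarith

/-- Test profile for the subsolution. -/
noncomputable def subProfile (p ε k a b : ℝ) : ℝ := gapPart ε k a b ^ p / a ^ (p - 1)

/-- Partial derivative of `subProfile` in `a`. -/
noncomputable def subProfileFst (p ε k a b : ℝ) : ℝ :=
  p * gapPart ε k a b ^ (p - 1) * truncRatio k a ^ 2 / a ^ (p - 1)
    - (p - 1) * (gapPart ε k a b ^ p / a ^ p)

/-- Partial derivative of `subProfile` in `b`. -/
noncomputable def subProfileSnd (p ε k a b : ℝ) : ℝ :=
  -(p * (gapPart ε k a b ^ (p - 1) / a ^ (p - 1)))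

/-- Test profile for the supersolution. -/
noncomputable def superProfile (p ε k a b : ℝ) : ℝ := gapPart ε k a b ^ p / (b + ε) ^ (p - 1)

/-- Partial derivative of `superProfile` in `a`. -/
noncomputable def superProfileFst (p ε k a b : ℝ) : ℝ :=
  p * gapPart ε k a b ^ (p - 1) * truncRatio k a ^ 2 / (b + ε) ^ (p - 1)

/-- Partial derivative of `superProfile` in `b`. -/
noncomputable def superProfileSnd (p ε k a b : ℝ) : ℝ :=
  -(p * (gapPart ε k a b ^ (p - 1) / (b + ε) ^ (p - 1)))
    - (p - 1) * (gapPart ε k a b ^ p / (b + ε) ^ p)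

lemma hasDerivAt_rpow_one_sub {p x : ℝ} (hx : 0 < x) :
    HasDerivAt (fun x : ℝ => (x ^ (p - 1))⁻¹) (-((p - 1) / x ^ p)) x := by
  have h := (Real.hasDerivAt_rpow_const (x := x) (p := p - 1) (Or.inl hx.ne')).inv
    (by positivity)
  refine h.congr_deriv ?_
  have e1 : x ^ p = x ^ (p - 1) * x := by rw [← Real.rpow_add_one hx.ne', sub_add_cancel]
  have e2 : x ^ (p - 1) = x ^ (p - 1 - 1) * x := by
    rw [← Real.rpow_add_one hx.ne', sub_add_cancel]
  have hne : x ^ (p - 1 - 1) ≠ 0 := by positivity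
  rw [e1, e2]
  field_simp

lemma hasFDerivAt_snd_rpow {p ε a b : ℝ} (hbε : 0 < b + ε) :
    HasFDerivAt (fun z : ℝ × ℝ => ((z.2 + ε) ^ (p - 1))⁻¹)
      ((-((p - 1) / (b + ε) ^ p)) • ContinuousLinearMap.snd ℝ ℝ ℝ) (a, b) := by
  have hf : HasFDerivAt (fun z : ℝ × ℝ => z.2 + ε) (ContinuousLinearMap.snd ℝ ℝ ℝ) (a, b) :=
    hasFDerivAt_snd.add_const ε
  have h := HasDerivAt.comp_hasFDerivAt (a, b) (hasDerivAt_rpow_one_sub (p := p) hbε) hf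
  exact h

lemma profiles_eq_zero {p ε k a b : ℝ} (hp : 1 < p) (h : gapPart ε k a b = 0) :
    subProfile p ε k a b = 0 ∧ subProfileFst p ε k a b = 0 ∧ subProfileSnd p ε k a b = 0 ∧
    superProfile p ε k a b = 0 ∧ superProfileFst p ε k a b = 0 ∧ superProfileSnd p ε k a b = 0 := by
  have h1 : (0 : ℝ) ^ p = 0 := Real.zero_rpow (by linarith)
  have h2 : (0 : ℝ) ^ (p - 1) = 0 := Real.zero_rpow (by linarith)
  simp [subProfile, subProfileFst, subProfileSnd, superProfile, superProfileFst, superProfileSnd,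
    h, h1, h2]

lemma hasBoundedPartials_subProfile {p ε k : ℝ} (hp : 1 < p) (hε : 0 < ε) (hk : 0 < k) :
    HasBoundedPartials (subProfile p ε k) (subProfileFst p ε k) (subProfileSnd p ε k) := by
  refine HasBoundedPartials.of_vanishing (C := k + 2 * p) hε (fun a b h1 h2 => ?_)
    (fun a b ha hb => ?_) (fun a b ha hb => ?_) (fun a b ha hb => ?_) (by positivity)
    (fun a b hb hab => ?_)
  · obtain ⟨h3, h4, h5, -⟩ := profiles_eq_zero hp (gapPart_eq_zero hk h1 h2)
    exact ⟨h3, h4, h5⟩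
  · have h1 := hasFDerivAt_gapPart_rpow (ε := ε) (b := b) hp hk ha
    have h2 : HasFDerivAt (fun z : ℝ × ℝ => (z.1 ^ (p - 1))⁻¹)
        ((-((p - 1) / a ^ p)) • ContinuousLinearMap.fst ℝ ℝ ℝ) (a, b) := by
      have hf : HasFDerivAt (fun z : ℝ × ℝ => z.1) (ContinuousLinearMap.fst ℝ ℝ ℝ) (a, b) :=
        hasFDerivAt_fst
      have h := HasDerivAt.comp_hasFDerivAt (a, b) (hasDerivAt_rpow_one_sub (p := p) ha) hf
      exact h
    refine ((h1.mul h2).congr_fderiv ?_)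
    ext <;> simp [subProfileFst, subProfileSnd] <;> ring
  · have hc := (continuous_gapPart (ε := ε) hk).continuousAt (x := (a, b))
    have ht := ((continuous_truncRatio hk).comp continuous_fst).continuousAt (x := (a, b))
    have ha' : (a, b).1 ≠ 0 := ha.ne'
    unfold subProfileFst
    refine ContinuousAt.sub (ContinuousAt.div ?_ ?_ ?_) (ContinuousAt.mul continuousAt_const
      (ContinuousAt.div ?_ ?_ ?_))
    · exact (continuousAt_const.mul (hc.rpow_const (Or.inr (by linarith)))).mul (ht.pow 2)
    · exact continuousAt_fst.rpow_const (Or.inl ha')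
    · simp only; positivity
    · exact hc.rpow_const (Or.inr (by linarith))
    · exact continuousAt_fst.rpow_const (Or.inl ha')
    · simp only; positivity
  · have hc := (continuous_gapPart (ε := ε) hk).continuousAt (x := (a, b))
    have ha' : (a, b).1 ≠ 0 := ha.ne'
    unfold subProfileSnd
    refine (continuousAt_const.mul (ContinuousAt.div ?_ ?_ ?_)).neg
    · exact hc.rpow_const (Or.inr (by linarith))
    · exact continuousAt_fst.rpow_const (Or.inl ha')
    · simp only; positivity
  · obtain ⟨h1, h2, h3, -⟩ := gapPart_rpow_bounds hp hε hk hb hab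
    have ha : 0 < a := by linarith
    have hD0 := gapPart_nonneg ε k a b
    have hτ0 := truncRatio_pos hk a
    have hτ1 := truncRatio_le_one hk a
    have hτ2 : truncRatio k a ^ 2 ≤ 1 := pow_le_one₀ hτ0.le hτ1
    have p1 : 0 ≤ gapPart ε k a b ^ p / a ^ (p - 1) := by positivity
    have p2 : 0 ≤ gapPart ε k a b ^ (p - 1) / a ^ (p - 1) := by positivity
    have p3 : 0 ≤ gapPart ε k a b ^ p / a ^ p := by positivity
    refine ⟨?_, ?_, ?_⟩
    · rw [subProfile, abs_of_nonneg p1]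
      linarith
    · rw [subProfileFst, show p * gapPart ε k a b ^ (p - 1) * truncRatio k a ^ 2 / a ^ (p - 1)
        = p * (gapPart ε k a b ^ (p - 1) / a ^ (p - 1) * truncRatio k a ^ 2) by ring, abs_le]
      have q0 : 0 ≤ gapPart ε k a b ^ (p - 1) / a ^ (p - 1) * truncRatio k a ^ 2 := by positivity
      have q1 : gapPart ε k a b ^ (p - 1) / a ^ (p - 1) * truncRatio k a ^ 2 ≤ 1 :=
        mul_le_one₀ h2 (by positivity) hτ2
      constructor <;> nlinarith
    · rw [subProfileSnd, abs_neg, abs_of_nonneg (by positivity)]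
      nlinarith

lemma hasBoundedPartials_superProfile {p ε k : ℝ} (hp : 1 < p) (hε : 0 < ε) (hk : 0 < k) :
    HasBoundedPartials (superProfile p ε k) (superProfileFst p ε k) (superProfileSnd p ε k) := by
  refine HasBoundedPartials.of_vanishing
    (C := k ^ p / ε ^ (p - 1) + p * (k ^ (p - 1) / ε ^ (p - 1)) + p * (k ^ p / ε ^ p)) hε
    (fun a b h1 h2 => ?_)
    (fun a b ha hb => ?_) (fun a b ha hb => ?_) (fun a b ha hb => ?_) (by positivity)
    (fun a b hb hab => ?_)
  · obtain ⟨-, -, -, h3, h4, h5⟩ := profiles_eq_zero hp (gapPart_eq_zero hk h1 h2)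
    exact ⟨h3, h4, h5⟩
  · have hbε : 0 < b + ε := by linarith
    have h1 := hasFDerivAt_gapPart_rpow (ε := ε) (b := b) hp hk ha
    have h2 : HasFDerivAt (fun z : ℝ × ℝ => ((z.2 + ε) ^ (p - 1))⁻¹)
        ((-((p - 1) / (b + ε) ^ p)) • ContinuousLinearMap.snd ℝ ℝ ℝ) (a, b) :=
      hasFDerivAt_snd_rpow hbε
    refine ((h1.mul h2).congr_fderiv ?_)
    ext <;> simp [superProfileFst, superProfileSnd] <;> ring
  · have hbε : 0 < b + ε := by linarith
    have hc := (continuous_gapPart (ε := ε) hk).continuousAt (x := (a, b))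
    have ht := ((continuous_truncRatio hk).comp continuous_fst).continuousAt (x := (a, b))
    unfold superProfileFst
    refine ContinuousAt.div ?_ ?_ ?_
    · exact (continuousAt_const.mul (hc.rpow_const (Or.inr (by linarith)))).mul (ht.pow 2)
    · exact (continuousAt_snd.add continuousAt_const).rpow_const (Or.inl hbε.ne')
    · simp only; positivity
  · have hbε : 0 < b + ε := by linarith
    have hc := (continuous_gapPart (ε := ε) hk).continuousAt (x := (a, b))
    unfold superProfileSnd
    refine ContinuousAt.sub (continuousAt_const.mul (ContinuousAt.div ?_ ?_ ?_)).neg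
      (ContinuousAt.mul continuousAt_const (ContinuousAt.div ?_ ?_ ?_))
    · exact hc.rpow_const (Or.inr (by linarith))
    · exact (continuousAt_snd.add continuousAt_const).rpow_const (Or.inl hbε.ne')
    · simp only; positivity
    · exact hc.rpow_const (Or.inr (by linarith))
    · exact (continuousAt_snd.add continuousAt_const).rpow_const (Or.inl hbε.ne')
    · simp only; positivity
  · obtain ⟨-, -, -, h1, h2, h3⟩ := gapPart_rpow_bounds hp hε hk hb hab
    have hbε : 0 < b + ε := by linarith
    have hD0 := gapPart_nonneg ε k a b
    have hτ0 := truncRatio_pos hk a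
    have hτ1 := truncRatio_le_one hk a
    have hτ2 : truncRatio k a ^ 2 ≤ 1 := pow_le_one₀ hτ0.le hτ1
    have p1 : 0 ≤ gapPart ε k a b ^ p / (b + ε) ^ (p - 1) := by positivity
    have p2 : 0 ≤ gapPart ε k a b ^ (p - 1) / (b + ε) ^ (p - 1) := by positivity
    have p3 : 0 ≤ gapPart ε k a b ^ p / (b + ε) ^ p := by positivity
    have c1 : 0 ≤ k ^ p / ε ^ (p - 1) := by positivity
    have c2 : 0 ≤ k ^ (p - 1) / ε ^ (p - 1) := by positivity
    have c3 : 0 ≤ k ^ p / ε ^ p := by positivity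
    have d2 := mul_le_mul_of_nonneg_left h2 (by linarith : 0 ≤ p)
    have d3 := mul_le_mul_of_nonneg_left h3 (by linarith : 0 ≤ p - 1)
    have e2 : 0 ≤ p * (k ^ (p - 1) / ε ^ (p - 1)) := by positivity
    have e3 : 0 ≤ p * (k ^ p / ε ^ p) := by positivity
    refine ⟨?_, ?_, ?_⟩
    · rw [superProfile, abs_of_nonneg p1]
      linarith
    · rw [superProfileFst, abs_of_nonneg (by positivity),
        show p * gapPart ε k a b ^ (p - 1) * truncRatio k a ^ 2 / (b + ε) ^ (p - 1)
        = p * (gapPart ε k a b ^ (p - 1) / (b + ε) ^ (p - 1)) * truncRatio k a ^ 2 by ring]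
      have := mul_le_of_le_one_right (show 0 ≤ p * (gapPart ε k a b ^ (p - 1) / (b + ε) ^ (p - 1))
        by positivity) hτ2
      linarith
    · rw [superProfileSnd, ← neg_add', abs_neg, abs_of_nonneg (add_nonneg (by positivity)
        (mul_nonneg (by linarith) p3))]
      linarith

/-- The profile `(b + ε)^{1-p}` of the logarithmic estimate. -/
lemma hasBoundedPartials_rpow {p ε : ℝ} (hp : 1 < p) (hε : 0 < ε) :
    HasBoundedPartials (fun _ b => ((b + ε) ^ (p - 1))⁻¹) (fun _ _ => 0)
      (fun _ b => -((p - 1) / (b + ε) ^ p)) := by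
  refine ⟨fun a b hb => ?_, continuousOn_const, ?_, (ε ^ (p - 1))⁻¹ + (p - 1) / ε ^ p,
    fun a b hb => ?_⟩
  · have := hasFDerivAt_snd_rpow (p := p) (a := a) (show 0 < b + ε by linarith)
    simpa using this
  · refine (ContinuousOn.div continuousOn_const ?_ fun z hz => ?_).neg
    · exact ContinuousOn.rpow_const (by fun_prop) fun z _ => Or.inr (by linarith)
    · have : 0 < z.2 + ε := add_pos_of_nonneg_of_pos hz hε
      positivity
  · have hp1 : 0 ≤ p - 1 := by linarith
    have hb' : 0 < b + ε := by linarith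
    have h1 : (ε ^ (p - 1))⁻¹ ≥ ((b + ε) ^ (p - 1))⁻¹ := by
      gcongr
      linarith
    have h2 : (p - 1) / (b + ε) ^ p ≤ (p - 1) / ε ^ p := by
      gcongr
      linarith
    have h3 : 0 ≤ (p - 1) / (b + ε) ^ p := by positivity
    have h4 : 0 ≤ ((b + ε) ^ (p - 1))⁻¹ := by positivity
    rw [abs_neg, abs_of_nonneg h3, abs_of_nonneg h4, abs_zero]
    refine ⟨?_, ?_, ?_⟩ <;> linarith

/-- The profile `((a - b - ε)⁺ / a)²`. -/
lemma hasBoundedPartials_ratio {ε : ℝ} (hε : 0 < ε) :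
    HasBoundedPartials (fun a b => max (a - (b + ε)) 0 ^ 2 / a ^ 2)
      (fun a b => 2 * (max (a - (b + ε)) 0 * (b + ε)) / a ^ 3)
      (fun a b => -(2 * max (a - (b + ε)) 0 / a ^ 2)) := by
  have hc : Continuous fun z : ℝ × ℝ => max (z.1 - (z.2 + ε)) 0 := by fun_prop
  refine HasBoundedPartials.of_vanishing (C := 1 + 2 / ε) hε (fun a b h1 h2 => ?_)
    (fun a b ha hb => ?_) (fun a b ha hb => ?_) (fun a b ha hb => ?_) (by positivity)
    (fun a b hb hab => ?_)
  · rw [max_eq_right (by linarith)]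
    simp
  · have hf : HasFDerivAt (fun z : ℝ × ℝ => z.1 - (z.2 + ε))
        (ContinuousLinearMap.fst ℝ ℝ ℝ - ContinuousLinearMap.snd ℝ ℝ ℝ) (a, b) :=
      hasFDerivAt_fst.sub (hasFDerivAt_snd.add_const ε)
    have hg : HasDerivAt (fun x : ℝ => max x 0 ^ 2) (2 * max (a - (b + ε)) 0) (a - (b + ε)) := by
      have h := hasDerivAt_max_zero_rpow one_lt_two (a - (b + ε))
      rw [show (2 : ℝ) - 1 = 1 by norm_num, Real.rpow_one] at h
      simpa only [Real.rpow_two] using h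
    have h1 : HasFDerivAt (fun z : ℝ × ℝ => max (z.1 - (z.2 + ε)) 0 ^ 2)
        ((2 * max (a - (b + ε)) 0) • (ContinuousLinearMap.fst ℝ ℝ ℝ
          - ContinuousLinearMap.snd ℝ ℝ ℝ)) (a, b) := by
      have h := HasDerivAt.comp_hasFDerivAt (a, b) hg hf
      exact h
    have h2 : HasFDerivAt (fun z : ℝ × ℝ => (z.1 ^ 2)⁻¹)
        ((-(2 / a ^ 3)) • ContinuousLinearMap.fst ℝ ℝ ℝ) (a, b) := by
      have h3 : HasDerivAt (fun x : ℝ => (x ^ 2)⁻¹) (-(2 / a ^ 3)) a := by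
        refine ((hasDerivAt_pow 2 a).inv (by positivity)).congr_deriv ?_
        field_simp
        ring
      have hf' : HasFDerivAt (fun z : ℝ × ℝ => z.1) (ContinuousLinearMap.fst ℝ ℝ ℝ) (a, b) :=
        hasFDerivAt_fst
      have h := HasDerivAt.comp_hasFDerivAt (a, b) h3 hf'
      exact h
    -- Since (s⁺)² = s⁺ s, the two contributions to the derivative in a combine: 2 s⁺ / a² - 2 (s⁺)²
    -- / a³ = 2 s⁺ (b + ε) / a³.
    have hsq : max (a - (b + ε)) 0 ^ 2 = max (a - (b + ε)) 0 * (a - (b + ε)) := by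
      rcases max_cases (a - (b + ε)) 0 with ⟨h, _⟩ | ⟨h, _⟩ <;> rw [h] <;> ring
    refine ((h1.mul h2).congr_fderiv ?_)
    ext
    · simp only [ContinuousLinearMap.comp_apply, ContinuousLinearMap.inl_apply,
        add_apply, smul_apply,
        sub_apply, ContinuousLinearMap.coe_fst', ContinuousLinearMap.coe_snd',
        smul_eq_mul, hsq]
      field_simp
      ring
    · simp only [ContinuousLinearMap.comp_apply, ContinuousLinearMap.inr_apply,
        add_apply, smul_apply,
        sub_apply, ContinuousLinearMap.coe_fst', ContinuousLinearMap.coe_snd',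
        smul_eq_mul]
      field_simp
      ring
  · refine ContinuousAt.div (by fun_prop) (by fun_prop) ?_
    simp only; positivity
  · refine (ContinuousAt.div (by fun_prop) (by fun_prop) ?_).neg
    simp only; positivity
  · have ha : 0 < a := by linarith
    rw [max_eq_left (by linarith)]
    have h0 : 0 ≤ a - (b + ε) := by linarith
    have hbε : 0 ≤ b + ε := by linarith
    have hεa : ε ≤ a := by linarith
    have hr : 2 / a ≤ 2 / ε := by gcongr
    have hr0 : 0 < 2 / ε := by positivity
    refine ⟨?_, ?_, ?_⟩
    · rw [abs_of_nonneg (by positivity)]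
      have : (a - (b + ε)) ^ 2 / a ^ 2 ≤ 1 := by
        rw [div_le_one (by positivity)]
        exact pow_le_pow_left₀ h0 (by linarith) 2
      linarith
    · rw [abs_of_nonneg (by positivity)]
      have : 2 * ((a - (b + ε)) * (b + ε)) / a ^ 3 ≤ 2 / a := by
        rw [div_le_div_iff₀ (by positivity) ha]
        have : (a - (b + ε)) * (b + ε) ≤ a * a :=
          mul_le_mul (by linarith) (by linarith) hbε ha.le
        nlinarith
      linarith
    · rw [abs_neg, abs_of_nonneg (by positivity)]
      have : 2 * (a - (b + ε)) / a ^ 2 ≤ 2 / a := by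
        rw [div_le_div_iff₀ (by positivity) ha]
        nlinarith
      linarith

end TestProfiles

/-! ### Bregman distance and the Picone-type pointwise inequality. -/

section Convexity

variable {F : Type*} [NormedAddCommGroup F] [InnerProductSpace ℝ F]

/-- The Bregman distance of `‖·‖^p / p`. -/
noncomputable def bregman (p : ℝ) (A B : F) : ℝ :=
  ‖A‖ ^ p / p + (p - 1) / p * ‖B‖ ^ p - inner ℝ (pFlux p B) A

lemma rpow_sub_one_mul_le {p : ℝ} (hp : 1 < p) {s t : ℝ} (hs : 0 ≤ s) (ht : 0 ≤ t) :
    s ^ (p - 1) * t ≤ t ^ p / p + (p - 1) / p * s ^ p := by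
  have h := Real.young_inequality_of_nonneg ht (Real.rpow_nonneg hs (p - 1))
    (Real.HolderConjugate.conjExponent hp)
  rw [Real.conjExponent, ← Real.rpow_mul hs, mul_div_cancel₀ _ (by linarith : p - 1 ≠ 0)] at h
  calc s ^ (p - 1) * t = t * s ^ (p - 1) := mul_comm _ _
    _ ≤ _ := h
    _ = _ := by
      have : p - 1 ≠ 0 := by linarith
      field_simp

/-- The equality case of Young's inequality, obtained from the strict Bernoulli inequality for the
ratio t / s. -/
lemma eq_of_rpow_sub_one_mul_eq {p : ℝ} (hp : 1 < p) {s t : ℝ} (hs : 0 ≤ s) (ht : 0 ≤ t)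
    (h : s ^ (p - 1) * t = t ^ p / p + (p - 1) / p * s ^ p) : t = s := by
  have hp0 : 0 < p := by linarith
  rcases hs.eq_or_lt with rfl | hs
  · rw [Real.zero_rpow (by linarith), Real.zero_rpow (by linarith)] at h
    have : t ^ p = 0 := by
      field_simp at h
      linarith
    exact (Real.rpow_eq_zero ht hp0.ne').1 this
  · by_contra hne
    have hr : t / s - 1 ≠ 0 := by
      rw [sub_ne_zero, Ne, div_eq_one_iff_eq hs.ne']
      exact hne
    have hb := one_add_mul_self_lt_rpow_one_add (s := t / s - 1) (p := p)
      (by linarith [div_nonneg ht hs.le]) hr hp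
    rw [add_sub_cancel, Real.div_rpow ht hs.le, lt_div_iff₀ (by positivity)] at hb
    have e : s ^ p = s ^ (p - 1) * s := by rw [← Real.rpow_add_one hs.ne', sub_add_cancel]
    have e2 : (1 + p * (t / s - 1)) * s ^ p = p * (s ^ (p - 1) * t) - (p - 1) * s ^ p := by
      rw [e]
      field_simp
      ring
    rw [e2, h] at hb
    field_simp at hb
    linarith

lemma inner_pFlux_le {p : ℝ} (hp : 1 < p) (A B : F) :
    inner ℝ (pFlux p B) A ≤ ‖B‖ ^ (p - 1) * ‖A‖ := by
  refine (real_inner_le_norm _ _).trans_eq ?_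
  rw [norm_pFlux hp]

/-- Cauchy–Schwarz followed by Young. -/
lemma bregman_nonneg {p : ℝ} (hp : 1 < p) (A B : F) : 0 ≤ bregman p A B := by
  have h1 := inner_pFlux_le hp A B
  have h2 := rpow_sub_one_mul_le hp (norm_nonneg B) (norm_nonneg A)
  unfold bregman
  linarith

/-- Both inequalities behind `bregman_nonneg` must be equalities: Young gives equal norms, and
Cauchy–Schwarz then gives ⟨B, A⟩ = |A| |B|, so |B - A|² = 0. -/
lemma eq_of_bregman_eq_zero {p : ℝ} (hp : 1 < p) {A B : F} (h : bregman p A B = 0) : A = B := by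
  have h1 := inner_pFlux_le hp A B
  have h2 := rpow_sub_one_mul_le hp (norm_nonneg B) (norm_nonneg A)
  unfold bregman at h
  have hn : ‖A‖ = ‖B‖ := eq_of_rpow_sub_one_mul_eq hp (norm_nonneg B) (norm_nonneg A)
    (by linarith)
  rcases eq_or_ne B 0 with rfl | hB
  · rwa [norm_zero, norm_eq_zero] at hn
  · have hB' : 0 < ‖B‖ := norm_pos_iff.2 hB
    have h3 : inner ℝ (pFlux p B) A = ‖B‖ ^ (p - 1) * ‖A‖ := by linarith
    rw [inner_pFlux, show p - 1 = (p - 2) + 1 by ring, Real.rpow_add_one hB'.ne', mul_assoc] at h3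
    have h4 : inner ℝ B A = ‖B‖ * ‖A‖ :=
      mul_left_cancel₀ (Real.rpow_pos_of_pos hB' _).ne' h3
    rw [← sub_eq_zero, ← norm_eq_zero, ← sq_eq_zero_iff, norm_sub_sq_real, real_inner_comm, h4, hn]
    ring

lemma pFlux_neg (p : ℝ) (z : F) : pFlux p (-z) = -pFlux p z := by
  simp [pFlux]

lemma pFlux_smul {p : ℝ} {a : ℝ} (ha : 0 < a) (z : F) :
    pFlux p (a • z) = a ^ (p - 1) • pFlux p z := by
  rw [pFlux, pFlux, norm_smul, Real.norm_of_nonneg ha.le, Real.mul_rpow ha.le (norm_nonneg z),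
    smul_smul, smul_smul, show p - 1 = (p - 2) + 1 by ring, Real.rpow_add_one ha.ne']
  congr 1
  ring

lemma inner_pFlux_self {p : ℝ} (hp : 1 < p) (z : F) : inner ℝ (pFlux p z) z = ‖z‖ ^ p := by
  rw [inner_pFlux, real_inner_self_eq_norm_sq]
  rcases eq_or_ne z 0 with rfl | hz
  · rw [norm_zero, Real.zero_rpow (by linarith : p ≠ 0)]
    simp
  · rw [← Real.rpow_natCast, ← Real.rpow_add (norm_pos_iff.2 hz)]
    norm_num

/-- The density of the energy estimate. -/
noncomputable def energyDensity (p ε k a b : ℝ) (P Q : F) : ℝ :=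
  truncRatio k a * (p * (truncRatio k a * a) * gapPart ε k a b ^ (p - 1)) *
    bregman p (a⁻¹ • P) ((b + ε)⁻¹ • Q)

lemma pos_of_gapPart_ne_zero {ε k a b : ℝ} (hε : 0 < ε) (hk : 0 < k) (hb : 0 ≤ b)
    (h : gapPart ε k a b ≠ 0) : b + ε ≤ a ∧ 0 < a := by
  have : b + ε ≤ a := by
    by_contra hlt
    exact h (gapPart_eq_zero hk (not_le.1 hlt) (by linarith))
  exact ⟨this, by linarith⟩

lemma energyDensity_nonneg {p ε k a b : ℝ} (hp : 1 < p) (hε : 0 < ε) (hk : 0 < k) (hb : 0 ≤ b)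
    (P Q : F) : 0 ≤ energyDensity p ε k a b P Q := by
  unfold energyDensity
  by_cases hD : gapPart ε k a b = 0
  · rw [hD, Real.zero_rpow (by linarith)]
    simp
  · have ha := (pos_of_gapPart_ne_zero hε hk hb hD).2
    have := truncRatio_pos hk a
    have := bregman_nonneg hp (a⁻¹ • P) ((b + ε)⁻¹ • Q)
    have := gapPart_nonneg ε k a b
    positivity

set_option maxHeartbeats 800000 in
/-- Pointwise lower bound for the principal part of the two tested inequalities. -/
lemma energyDensity_le {p ε k a b : ℝ} (hp : 1 < p) (hε : 0 < ε) (hk : 0 < k) (hb : 0 ≤ b)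
    (P Q : F) :
    energyDensity p ε k a b P Q ≤
      inner ℝ (pFlux p P) (subProfileFst p ε k a b • P + subProfileSnd p ε k a b • Q)
      - inner ℝ (pFlux p Q) (superProfileFst p ε k a b • P + superProfileSnd p ε k a b • Q)
      + (p - 1) * (1 - truncRatio k a) * ‖P‖ ^ p := by
  have hp0 : 0 < p := by linarith
  have hp1 : 0 < p - 1 := by linarith
  have hτ1 := truncRatio_le_one hk a
  by_cases hD : gapPart ε k a b = 0
  · obtain ⟨-, h1, h2, -, h3, h4⟩ := profiles_eq_zero (p := p) hp hD
    rw [h1, h2, h3, h4, energyDensity, hD, Real.zero_rpow (by linarith)]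
    simp only [mul_zero, zero_mul, zero_smul, add_zero, inner_zero_right, sub_zero, zero_add]
    exact mul_nonneg (mul_nonneg hp1.le (by linarith)) (by positivity)
  obtain ⟨hab, ha⟩ := pos_of_gapPart_ne_zero hε hk hb hD
  have hβ : 0 < b + ε := by linarith
  have hD0 : 0 < gapPart ε k a b := lt_of_le_of_ne (gapPart_nonneg ε k a b) (Ne.symm hD)
  have hDe : gapPart ε k a b = truncRatio k a * a - (b + ε) := by
    unfold gapPart at hD ⊢
    refine max_eq_left ?_
    by_contra hlt
    exact hD (max_eq_right (not_le.1 hlt).le)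
  have hτ0 := truncRatio_pos hk a
  have hDa : gapPart ε k a b ≤ a := (gapPart_le hk hβ.le ha.le).trans
    (mul_le_of_le_one_left ha.le hτ1)
  set D := gapPart ε k a b with hDdef
  set τ := truncRatio k a with hτ
  set d := D ^ (p - 1) with hd
  set β := b + ε with hβdef
  have hd0 : 0 < d := Real.rpow_pos_of_pos hD0 _
  have hda : d ≤ a ^ (p - 1) := Real.rpow_le_rpow hD0.le hDa hp1.le
  have hDp : D ^ p = d * D := by rw [hd, ← Real.rpow_add_one hD0.ne', sub_add_cancel]
  have hap : a ^ p = a ^ (p - 1) * a := by rw [← Real.rpow_add_one ha.ne', sub_add_cancel]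
  have hβp : β ^ p = β ^ (p - 1) * β := by rw [← Real.rpow_add_one hβ.ne', sub_add_cancel]
  -- In terms of the logarithmic gradients A = P / a and B = Q / β everything becomes linear in
  -- |A|^p, |B|^p and the two mixed products I and J.
  obtain ⟨A, rfl⟩ : ∃ A, P = a • A := ⟨a⁻¹ • P, by rw [smul_inv_smul₀ ha.ne']⟩
  obtain ⟨B, rfl⟩ : ∃ B, Q = β • B := ⟨β⁻¹ • Q, by rw [smul_inv_smul₀ hβ.ne']⟩
  have ha1 : 0 < a ^ (p - 1) := by positivity
  have hb1 : 0 < β ^ (p - 1) := by positivity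
  have hY := rpow_sub_one_mul_le hp (norm_nonneg A) (norm_nonneg B)
  have hI := inner_pFlux_le hp B A
  rw [energyDensity, inv_smul_smul₀ ha.ne', inv_smul_smul₀ hβ.ne', pFlux_smul ha, pFlux_smul hβ,
    norm_smul, Real.norm_of_nonneg ha.le, Real.mul_rpow ha.le (norm_nonneg A)]
  simp only [inner_add_right, real_inner_smul_left, real_inner_smul_right, inner_pFlux_self hp,
    subProfileFst, subProfileSnd, superProfileFst, superProfileSnd, bregman]
  rw [← hDdef, ← hτ, ← hd, ← hβdef, hDp, hap, hβp]
  set α := ‖A‖ ^ p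
  set γ := ‖B‖ ^ p
  set I := inner ℝ (pFlux p A) B
  set J := inner ℝ (pFlux p B) A
  have hα : 0 ≤ α := by positivity
  have hγ : 0 ≤ γ := by positivity
  have e1 : a ^ (p - 1) * ((p * d * τ ^ 2 / a ^ (p - 1) - (p - 1) * (d * D / (a ^ (p - 1) * a))) *
      (a * α) + -(p * (d / a ^ (p - 1))) * (β * I))
      - β ^ (p - 1) * (p * d * τ ^ 2 / β ^ (p - 1) * (a * J) + (-(p * (d / β ^ (p - 1)))
        - (p - 1) * (d * D / (β ^ (p - 1) * β))) * (β * γ))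
      = (p * d * τ ^ 2 * a - (p - 1) * (d * D)) * α - p * d * β * I - p * d * τ ^ 2 * a * J
        + (p * d * β + (p - 1) * (d * D)) * γ := by
    field_simp
    ring
  have e2 : ∀ x y : ℝ, a ^ (p - 1) * (x * (a * α) + y * (β * I)) =
      x * (a * (a ^ (p - 1) * α)) + y * (β * (a ^ (p - 1) * I)) := fun x y => by ring
  have e3 : ∀ x y : ℝ, β ^ (p - 1) * (x * (a * J) + y * (β * γ)) =
      x * (a * (β ^ (p - 1) * J)) + y * (β * (β ^ (p - 1) * γ)) := fun x y => by ring
  rw [e2, e3] at e1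
  rw [e1]
  -- The mixed product I is removed by Young. This discards the nonnegative multiple p d β of the
  -- Bregman distance with exchanged arguments; the one containing J is kept.
  have k1 : p * d * β * I ≤ p * d * β * (γ / p + (p - 1) / p * α) :=
    mul_le_mul_of_nonneg_left (hI.trans hY) (by positivity)
  -- The derivative of the truncation is τ² instead of 1, which leaves a deficit in |A|^p. Since τ d
  -- a ≤ a^p it is covered by the error (p - 1)(1 - τ)|P|^p.
  have k2 : (p - 1) * (1 - τ) * (τ * d * a * α) ≤ (p - 1) * (1 - τ) * (a ^ (p - 1) * a * α) := by
    refine mul_le_mul_of_nonneg_left ?_ (mul_nonneg hp1.le (by linarith))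
    gcongr
    nlinarith
  have k3 : 0 ≤ (p - 1) * (1 - τ) * (τ * a * d * γ) :=
    mul_nonneg (mul_nonneg hp1.le (by linarith)) (by positivity)
  have e4 : p * d * β * (γ / p + (p - 1) / p * α) = d * β * γ + d * β * (p - 1) * α := by
    field_simp
  have e5 : τ * (p * (τ * a) * d) * (α / p + (p - 1) / p * γ - J)
      = τ * (τ * a) * d * (α + (p - 1) * γ) - p * d * τ ^ 2 * a * J := by
    field_simp
  rw [e4] at k1
  rw [e5, hDe]
  linarith

end Convexity

/-! ### The energy estimate. -/

section Energy

/-- Integrates good ≤ q + err without integrability of `good` or `err`: only q is integrable, so its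
negative part has finite integral and can be cancelled in `ENNReal`. The error may contain the
growth term, which need not be finite. -/
lemma lintegral_ofReal_le_of_le_add {α : Type*} [MeasurableSpace α] {ν : Measure α}
    {q good err : α → ℝ} (hq : Integrable q ν) (hq0 : ∫ x, q x ∂ν ≤ 0)
    (hgood : ∀ᵐ x ∂ν, 0 ≤ good x) (h : ∀ᵐ x ∂ν, good x ≤ q x + err x) :
    ∫⁻ x, ENNReal.ofReal (good x) ∂ν ≤ ∫⁻ x, ENNReal.ofReal (err x) ∂ν := by
  have hm1 : AEMeasurable (fun x => ENNReal.ofReal (q x)) ν := hq.1.aemeasurable.ennreal_ofReal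
  have hm2 : AEMeasurable (fun x => ENNReal.ofReal (-q x)) ν :=
    hq.1.aemeasurable.neg.ennreal_ofReal
  have hfin : ∫⁻ x, ENNReal.ofReal (-q x) ∂ν ≠ ⊤ := hq.neg.lintegral_lt_top.ne
  have hle : ∫⁻ x, ENNReal.ofReal (q x) ∂ν ≤ ∫⁻ x, ENNReal.ofReal (-q x) ∂ν := by
    rw [integral_eq_lintegral_pos_part_sub_lintegral_neg_part hq, sub_nonpos] at hq0
    exact (ENNReal.toReal_le_toReal hq.lintegral_lt_top.ne hfin).1 hq0
  have hpt : ∀ᵐ x ∂ν, ENNReal.ofReal (good x) + ENNReal.ofReal (-q x)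
      ≤ ENNReal.ofReal (q x) + ENNReal.ofReal (err x) := by
    filter_upwards [hgood, h] with x h0 hx
    rcases le_or_gt 0 (q x) with hqx | hqx
    · rw [ENNReal.ofReal_of_nonpos (by linarith : -q x ≤ 0), add_zero]
      exact (ENNReal.ofReal_le_ofReal hx).trans ENNReal.ofReal_add_le
    · rw [ENNReal.ofReal_of_nonpos hqx.le, zero_add, ← ENNReal.ofReal_add h0 (by linarith)]
      exact ENNReal.ofReal_le_ofReal (by linarith)
  have hint := lintegral_mono_ae hpt
  rw [lintegral_add_right' _ hm2, lintegral_add_left' hm1] at hint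
  refine (ENNReal.add_le_add_iff_right hfin).1 (hint.trans ?_)
  rw [add_comm]
  gcongr

section Pointwise

variable {F : Type*} [NormedAddCommGroup F] [InnerProductSpace ℝ F]

/-- This bound, like `superProfile_mul_le` below, is free of k and ε. Hence the cut-off errors are
controlled before these parameters are chosen, and the second bound has exactly the density of the
growth hypothesis. -/
lemma subProfile_le {p ε k a b : ℝ} (hp : 1 < p) (hε : 0 < ε) (hk : 0 < k) (hb : 0 ≤ b) :
    0 ≤ subProfile p ε k a b ∧ subProfile p ε k a b ≤ max a 0 := by
  by_cases hD : gapPart ε k a b = 0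
  · rw [(profiles_eq_zero hp hD).1]
    exact ⟨le_rfl, le_max_right _ _⟩
  obtain ⟨hab, ha⟩ := pos_of_gapPart_ne_zero hε hk hb hD
  have hD0 := gapPart_nonneg ε k a b
  have hDa : gapPart ε k a b ≤ a := (gapPart_le hk (by linarith) ha.le).trans
    (mul_le_of_le_one_left ha.le (truncRatio_le_one hk a))
  refine ⟨by unfold subProfile; positivity, ?_⟩
  rw [max_eq_left ha.le, subProfile, div_le_iff₀ (by positivity), ← Real.rpow_one_add' ha.le
    (by linarith), add_sub_cancel]
  exact Real.rpow_le_rpow hD0 hDa (by linarith)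

lemma superProfile_mul_le {p ε k a b t : ℝ} (hp : 1 < p) (hε : 0 < ε) (hk : 0 < k) (hb : 0 < b)
    (ht : 0 ≤ t) :
    0 ≤ superProfile p ε k a b ∧
    superProfile p ε k a b * t ^ (p - 1) ≤ max a 0 ^ p * (t / b) ^ (p - 1) := by
  by_cases hD : gapPart ε k a b = 0
  · rw [(profiles_eq_zero hp hD).2.2.2.1, zero_mul]
    exact ⟨le_rfl, by positivity⟩
  obtain ⟨hab, ha⟩ := pos_of_gapPart_ne_zero hε hk hb.le hD
  have hD0 := gapPart_nonneg ε k a b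
  have hDa : gapPart ε k a b ≤ a := (gapPart_le hk (by linarith) ha.le).trans
    (mul_le_of_le_one_left ha.le (truncRatio_le_one hk a))
  refine ⟨by unfold superProfile; positivity, ?_⟩
  rw [max_eq_left ha.le, superProfile, Real.div_rpow ht hb.le, div_mul_eq_mul_div, ← mul_div_assoc]
  gcongr
  linarith

/-- The error density of the energy estimate. -/
noncomputable def energyError (p ε k η z m g a b s t : ℝ) : ℝ :=
  η * ((p - 1) * (1 - truncRatio k a) * s ^ p)
    + z * (max a 0 * s ^ (p - 1) + max a 0 ^ p * (t / b) ^ (p - 1))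
    + η * ((m + |g|) * k ^ p * (1 - (b / (b + ε)) ^ (p - 1)))

/-- Adds the integrands of the two tested inequalities, the second for -v. The principal parts are
handled by `energyDensity_le`, the terms with the cut-off gradient Z by Cauchy–Schwarz. -/
lemma energyDensity_le_add_energyError {p ε k a b η m f g : ℝ} (hp : 1 < p) (hε : 0 < ε)
    (hk : 0 < k) (hb : 0 < b) (hη : 0 ≤ η) (hm : 0 ≤ m) (hfg : f ≤ g) (P Q Z : F) :
    η * energyDensity p ε k a b P Q ≤
      (inner ℝ (pFlux p P) (η • (subProfileFst p ε k a b • P + subProfileSnd p ε k a b • Q)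
          + subProfile p ε k a b • Z) - (m + f) * pFlux p a * (η * subProfile p ε k a b))
      + (inner ℝ (pFlux p (-Q)) (η • (superProfileFst p ε k a b • P
          + superProfileSnd p ε k a b • Q) + superProfile p ε k a b • Z)
          - (m + g) * pFlux p (-b) * (η * superProfile p ε k a b))
      + energyError p ε k η ‖Z‖ m g a b ‖P‖ ‖Q‖ := by
  have h1 := mul_le_mul_of_nonneg_left (energyDensity_le hp hε hk hb.le P Q (a := a)) hη
  obtain ⟨hs0, hs⟩ := subProfile_le (a := a) hp hε hk hb.le
  obtain ⟨hS0, hS⟩ := superProfile_mul_le (a := a) hp hε hk hb (norm_nonneg Q)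
  have hz1 : -(‖Z‖ * (max a 0 * ‖P‖ ^ (p - 1))) ≤ subProfile p ε k a b * inner ℝ (pFlux p P) Z := by
    have h := inner_pFlux_le hp (-Z) P
    rw [inner_neg_right, norm_neg] at h
    have h2 := mul_le_mul_of_nonneg_left h hs0
    have h3 := mul_le_mul_of_nonneg_right hs
      (mul_nonneg (Real.rpow_nonneg (norm_nonneg P) (p - 1)) (norm_nonneg Z))
    linarith
  have hz2 : superProfile p ε k a b * inner ℝ (pFlux p Q) Z
      ≤ ‖Z‖ * (max a 0 ^ p * (‖Q‖ / b) ^ (p - 1)) := by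
    have h2 := mul_le_mul_of_nonneg_left (inner_pFlux_le hp Z Q) hS0
    have h3 := mul_le_mul_of_nonneg_right hS (norm_nonneg Z)
    linarith
  -- Cancellation of the zero-order terms: u^(p-1) times its test is D^p, and v^(p-1) times its test
  -- is r D^p with r = (v / (v + ε))^(p-1). By f ≤ g only (m + g)(1 - r) D^p is left, and D ≤ k.
  have hzero : η * ((m + f) * pFlux p a * subProfile p ε k a b
      + (m + g) * pFlux p (-b) * superProfile p ε k a b)
      ≤ η * ((m + |g|) * k ^ p * (1 - (b / (b + ε)) ^ (p - 1))) := by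
    refine mul_le_mul_of_nonneg_left ?_ hη
    have hr0 : 0 ≤ (b / (b + ε)) ^ (p - 1) := by positivity
    have hr1 : (b / (b + ε)) ^ (p - 1) ≤ 1 :=
      Real.rpow_le_one (by positivity) ((div_le_one (by linarith)).2 (by linarith)) (by linarith)
    by_cases hD : gapPart ε k a b = 0
    · rw [(profiles_eq_zero hp hD).1, (profiles_eq_zero hp hD).2.2.2.1]
      simp only [mul_zero, add_zero]
      have : 0 ≤ m + |g| := by positivity
      have : 0 ≤ 1 - (b / (b + ε)) ^ (p - 1) := by linarith
      positivity
    obtain ⟨hab, ha⟩ := pos_of_gapPart_ne_zero hε hk hb.le hD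
    have hD0 := gapPart_nonneg ε k a b
    have hDk : gapPart ε k a b ^ p ≤ k ^ p := Real.rpow_le_rpow hD0
      ((gapPart_le hk (by linarith) ha.le).trans (truncRatio_mul_le hk ha.le)) (by linarith)
    have hDp : 0 ≤ gapPart ε k a b ^ p := by positivity
    have f1 : pFlux p a = a ^ (p - 1) := by
      rw [← pFlux_real, abs_of_pos ha, ← Real.rpow_add_one ha.ne']
      congr 1; ring
    have f2 : pFlux p (-b) = -b ^ (p - 1) := by
      rw [pFlux_neg, ← pFlux_real, abs_of_pos hb, ← Real.rpow_add_one hb.ne']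
      congr 2; ring
    have g1 : pFlux p a * subProfile p ε k a b = gapPart ε k a b ^ p := by
      rw [f1, subProfile]
      field_simp
    have g2 : pFlux p (-b) * superProfile p ε k a b
        = -((b / (b + ε)) ^ (p - 1) * gapPart ε k a b ^ p) := by
      have : 0 < b + ε := by linarith
      rw [f2, superProfile, Real.div_rpow hb.le this.le]
      field_simp
    rw [mul_assoc, mul_assoc, g1, g2]
    set r := (b / (b + ε)) ^ (p - 1)
    set D := gapPart ε k a b ^ p
    calc (m + f) * D + (m + g) * -(r * D) ≤ (m + g) * D + (m + g) * -(r * D) := by gcongr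
      _ = (m + g) * (D * (1 - r)) := by ring
      _ ≤ (m + |g|) * (k ^ p * (1 - r)) := by
          have h1r : 0 ≤ 1 - r := by linarith
          have hmg : 0 ≤ m + |g| := by positivity
          calc (m + g) * (D * (1 - r)) ≤ (m + |g|) * (D * (1 - r)) := by
                gcongr
                exact le_abs_self g
            _ ≤ _ := by gcongr
      _ = _ := by ring
  simp only [inner_add_right, real_inner_smul_right, pFlux_neg, inner_neg_left] at h1 hzero ⊢
  rw [energyError]
  linarith

end Pointwise

variable {N : ℕ}

local notation "𝔼" => EuclideanSpace ℝ (Fin N)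

lemma HasBoundedPartials.memLp_comp {p : ENNReal} {Ω : Set 𝔼} (hΩ : IsOpen Ω) {u v : 𝔼 → ℝ}
    {du dv : 𝔼 → 𝔼} {Φ Φa Φb : ℝ → ℝ → ℝ} (hΦ : HasBoundedPartials Φ Φa Φb)
    (hu : HasWeakGradient Ω u du) (hv : HasWeakGradient Ω v dv)
    (hv0 : ∀ᵐ x ∂(volume.restrict Ω), 0 ≤ v x)
    (hdu : MemLp du p (volume.restrict Ω)) (hdv : MemLp dv p (volume.restrict Ω)) :
    ∃ C, 0 ≤ C ∧ (∀ᵐ x ∂(volume.restrict Ω), |Φ (u x) (v x)| ≤ C) ∧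
      MemLp (fun x => Φa (u x) (v x) • du x + Φb (u x) (v x) • dv x) p (volume.restrict Ω) := by
  obtain ⟨C, hC⟩ := hΦ.bounded
  have hC0 : 0 ≤ C := (abs_nonneg _).trans (hC 0 0 le_rfl).1
  refine ⟨C, hC0, hv0.mono fun x hx => (hC _ _ hx).1, ?_⟩
  have hw := hu.comp hΩ hΦ hv hv0
  refine MemLp.of_le_mul (c := C) (hdu.norm.add hdv.norm) hw.2.1.aestronglyMeasurable ?_
  filter_upwards [hv0] with x hx
  obtain ⟨-, h1, h2⟩ := hC (u x) (v x) hx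
  calc _ ≤ ‖Φa (u x) (v x) • du x‖ + ‖Φb (u x) (v x) • dv x‖ := norm_add_le _ _
    _ ≤ C * ‖du x‖ + C * ‖dv x‖ := by
        rw [norm_smul, norm_smul]
        gcongr
        · exact h1
        · exact h2
    _ = C * ‖((fun x => ‖du x‖) + fun x => ‖dv x‖) x‖ := by
        rw [Pi.add_apply, Real.norm_of_nonneg (by positivity)]
        ring

lemma IsWeakSupersolution.hasWeakGradient {p μ : ℝ} {Ω : Set 𝔼} (hΩ : IsOpen Ω) {g v : 𝔼 → ℝ}
    (hv : IsWeakSupersolution p μ Ω g v) :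
    HasWeakGradient Ω v (weakGrad Ω v) ∧
    MemLp v (ENNReal.ofReal (sobolevExponent N p)) (volume.restrict Ω) ∧
    MemLp (weakGrad Ω v) (ENNReal.ofReal p) (volume.restrict Ω) ∧
    weakGrad Ω (fun x => -v x) =ᵐ[volume.restrict Ω] fun x => -weakGrad Ω v x := by
  obtain ⟨h1, h2⟩ := weakGrad_neg_ae hΩ hv.1.2.1
  have h3 := hv.1.1.neg
  have h4 := (hv.1.2.2.ae_eq h2).neg
  have e1 : -(fun x => -v x) = v := by ext x; simp
  have e2 : (-fun x => -weakGrad Ω v x) = weakGrad Ω v := by ext x; simp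
  rw [e1] at h3
  rw [e2] at h4
  exact ⟨h1, h3, h4, h2⟩

/-- The energy estimate behind the comparison principle. -/
lemma lintegral_energyDensity_le {p μ : ℝ} (hp : 1 < p) (hpN : p < N) (hμ : 0 ≤ μ) {Ω : Set 𝔼}
    (hΩ : IsOpen Ω) (hΩb : Bornology.IsBounded Ωᶜ) {f g u v : 𝔼 → ℝ}
    (hf : MemLp f (ENNReal.ofReal (N / p)) (volume.restrict Ω))
    (hg : MemLp g (ENNReal.ofReal (N / p)) (volume.restrict Ω))
    (hfg : ∀ᵐ x ∂(volume.restrict Ω), f x ≤ g x)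
    (hu : IsWeakSubsolution p μ Ω f u) (hv : IsWeakSupersolution p μ Ω g v)
    (hvpos : ∀ᵐ x ∂(volume.restrict Ω), 0 < v x) (huv : LEOnBoundary p Ω u v)
    {ε k : ℝ} (hε : 0 < ε) (hk : 0 < k) {η : 𝔼 → ℝ} (hη : IsTestFunction Set.univ η)
    (hη0 : ∀ x, 0 ≤ η x) :
    ∫⁻ x in Ω, ENNReal.ofReal (η x * energyDensity p ε k (u x) (v x) (weakGrad Ω u x)
        (weakGrad Ω v x)) ≤
      ∫⁻ x in Ω, ENNReal.ofReal (energyError p ε k (η x) ‖gradient η x‖ (μ / ‖x‖ ^ p) (g x)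
        (u x) (v x) ‖weakGrad Ω u x‖ ‖weakGrad Ω v x‖) := by
  have hp0 : ENNReal.ofReal p ≠ 0 := by simpa using (by linarith : 0 < p)
  have hp1 : 1 ≤ ENNReal.ofReal p := by simpa using hp.le
  have hv0 : ∀ᵐ x ∂(volume.restrict Ω), 0 ≤ v x := hvpos.mono fun x hx => hx.le
  obtain ⟨hvw, hvp, hdv, hdv'⟩ := hv.hasWeakGradient hΩ
  have huw := hasWeakGradient_weakGrad hu.1.2.1
  have hdu := hu.1.2.2
  obtain ⟨χ, hχ, hχc, hχ1, ⟨hWp, hWw, hdW⟩, σ, hσ, hl, hdl⟩ := huv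
  obtain ⟨U, hU, hUΩ, hU1⟩ := eventually_nhdsSet_iff_exists.1 hχ1
  have hse : ENNReal.ofReal (sobolevExponent N p) ≠ 0 := by
    simpa using (by linarith [one_lt_sobolevExponent hp hpN] : 0 < sobolevExponent N p)
  obtain ⟨Θ, hΘ, hΘ0, hΘl⟩ := exists_boundary_cutoff hΩ hΩb hp1 ENNReal.ofReal_ne_top hse hσ hWp.1
    hdW hl hdl hU hUΩ hε
  -- Off this set the point is near ∂Ω, where χ = 1, and (u - v)⁺ < ε, so u < v + ε and both tests
  -- vanish. The boundary cut-offs are built at the level c = ε for this reason.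
  have hvan : ∀ᵐ x ∂(volume.restrict Ω),
      x ∉ {x | x ∈ U → ε ≤ χ x * max (u x - v x) 0} → gapPart ε k (u x) (v x) = 0 := by
    filter_upwards [hv0] with x hx hxA
    simp only [Classical.not_imp, not_le] at hxA
    rw [hU1 x hxA.1, one_mul] at hxA
    have := (le_max_left (u x - v x) 0).trans_lt hxA.2
    exact gapPart_eq_zero hk (by linarith) (by linarith)
  have hB1 := hasBoundedPartials_subProfile hp hε hk
  have hB2 := hasBoundedPartials_superProfile hp hε hk
  obtain ⟨C1, hC1, hΦ1, hd1⟩ := hB1.memLp_comp hΩ huw hvw hv0 hdu hdv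
  obtain ⟨C2, hC2, hΦ2, hd2⟩ := hB2.memLp_comp hΩ huw hvw hv0 hdu hdv
  obtain ⟨i1, t1⟩ := hu.integral_weakForm_le_of_cutoff hp hpN hΩ hf hC1
    (huw.comp hΩ hB1 hvw hv0) hΦ1 (hv0.mono fun x hx => (subProfile_le hp hε hk hx).1) hd1 hΘ hΘ0
    hΘl (hvan.mono fun x hx hxA => by
      obtain ⟨h1, h2, h3, -⟩ := profiles_eq_zero hp (hx hxA)
      exact ⟨h1, by rw [h2, h3, zero_smul, zero_smul, add_zero]⟩) hη hη0
  obtain ⟨i2, t2⟩ := IsWeakSubsolution.integral_weakForm_le_of_cutoff hp hpN hΩ hv hg hC2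
    (huw.comp hΩ hB2 hvw hv0) hΦ2
    (hvpos.mono fun x hx => (superProfile_mul_le hp hε hk hx le_rfl).1) hd2 hΘ hΘ0
    hΘl (hvan.mono fun x hx hxA => by
      obtain ⟨-, -, -, h1, h2, h3⟩ := profiles_eq_zero hp (hx hxA)
      exact ⟨h1, by rw [h2, h3, zero_smul, zero_smul, add_zero]⟩) hη hη0
  refine lintegral_ofReal_le_of_le_add (i1.add i2) ?_ ?_ ?_
  · simp only [Pi.add_apply]
    rw [integral_add i1 i2]
    linarith
  · filter_upwards [hv0] with x hx
    exact mul_nonneg (hη0 x) (energyDensity_nonneg hp hε hk hx _ _)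
  · filter_upwards [hvpos, hfg, hdv'] with x hx hxfg hxd
    simp only [Pi.add_apply, weakForm]
    rw [hxd]
    exact energyDensity_le_add_energyError hp hε hk hx (hη0 x)
      (div_nonneg hμ (Real.rpow_nonneg (norm_nonneg x) p)) hxfg _ _ _

end Energy

/-! ### Fatou arguments, cut-offs at infinity, vanishing of the truncation and zero-order errors. -/

section Limits

lemma lintegral_le_of_tendsto {α : Type*} [MeasurableSpace α] {ν : Measure α}
    {F : ℕ → α → ENNReal} {f : α → ENNReal} (hm : ∀ n, AEMeasurable (F n) ν)
    (h : ∀ᵐ x ∂ν, Tendsto (fun n => F n x) atTop (𝓝 (f x))) {c : ENNReal}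
    (hi : ∀ n, ∫⁻ x, F n x ∂ν ≤ c) : ∫⁻ x, f x ∂ν ≤ c := by
  calc ∫⁻ x, f x ∂ν = ∫⁻ x, liminf (fun n => F n x) atTop ∂ν :=
        lintegral_congr_ae (h.mono fun x hx => hx.liminf_eq.symm)
    _ ≤ liminf (fun n => ∫⁻ x, F n x ∂ν) atTop := lintegral_liminf_le' hm
    _ ≤ c := by
      refine (liminf_le_liminf (Eventually.of_forall hi)).trans_eq ?_
      exact liminf_const c

lemma ae_eq_zero_of_tendsto_lintegral {α : Type*} [MeasurableSpace α] {ν : Measure α}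
    {F : ℕ → α → ENNReal} {f : α → ENNReal} (hm : ∀ n, AEMeasurable (F n) ν)
    (h : ∀ᵐ x ∂ν, Tendsto (fun n => F n x) atTop (𝓝 (f x)))
    (hi : Tendsto (fun n => ∫⁻ x, F n x ∂ν) atTop (𝓝 0)) : ∀ᵐ x ∂ν, f x = 0 := by
  have hf : AEMeasurable f ν := aemeasurable_of_tendsto_metrizable_ae _ hm h
  refine (lintegral_eq_zero_iff' hf).1 (le_antisymm ?_ zero_le)
  calc ∫⁻ x, f x ∂ν = ∫⁻ x, liminf (fun n => F n x) atTop ∂ν :=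
        lintegral_congr_ae (h.mono fun x hx => hx.liminf_eq.symm)
    _ ≤ liminf (fun n => ∫⁻ x, F n x ∂ν) atTop := lintegral_liminf_le' hm
    _ = 0 := hi.liminf_eq

lemma tendsto_truncRatio (a : ℝ) : Tendsto (fun k => truncRatio k a) atTop (𝓝 1) := by
  have h : Tendsto (fun k : ℝ => 1 - |a| / (k + |a|)) atTop (𝓝 (1 - 0)) :=
    tendsto_const_nhds.sub (tendsto_const_nhds.div_atTop
      (tendsto_atTop_add_const_right _ _ tendsto_id))
  rw [sub_zero] at h
  refine h.congr' ?_
  filter_upwards [eventually_gt_atTop 0] with k hk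
  have : 0 < k + |a| := by positivity
  rw [truncRatio]
  field_simp
  ring

variable {N : ℕ}

local notation "𝔼" => EuclideanSpace ℝ (Fin N)

/-- Standard cut-off functions at scale `R`. -/
lemma exists_scaled_cutoff : ∃ C : ℝ, 0 ≤ C ∧ ∀ R : ℝ, 0 < R → ∃ η : 𝔼 → ℝ,
    IsTestFunction Set.univ η ∧ (∀ x, η x ∈ Set.Icc 0 1) ∧ (∀ x ∈ Metric.ball 0 R, η x = 1) ∧
    (∀ x, ‖gradient η x‖ ≤ C / R) ∧
    ∀ x, x ∉ Metric.ball (0 : 𝔼) (2 * R) \ Metric.ball 0 R → gradient η x = 0 := by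
  -- Outer radius 3/2 instead of 2 keeps the closed support of the scaled bump inside the open ball
  -- of radius 2R.
  let φ : ContDiffBump (0 : 𝔼) := ⟨1, 3 / 2, one_pos, by norm_num⟩
  have hφ : ContDiff ℝ ∞ (φ : 𝔼 → ℝ) := φ.contDiff
  obtain ⟨C, hC⟩ := hφ.continuous_gradient.bounded_above_of_compact_support
    φ.hasCompactSupport.gradient
  refine ⟨C, (norm_nonneg _).trans (hC 0), fun R hR => ?_⟩
  have hsub : tsupport (fun x : 𝔼 => φ (R⁻¹ • x)) ⊆ Metric.closedBall 0 (3 / 2 * R) := by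
    refine closure_minimal (fun x hx => ?_) Metric.isClosed_closedBall
    have : R⁻¹ • x ∈ Function.support φ := hx
    rw [φ.support_eq, mem_ball_zero_iff, norm_smul, norm_inv, Real.norm_of_nonneg hR.le,
      inv_mul_lt_iff₀ hR] at this
    rw [mem_closedBall_zero_iff]
    exact (this.trans_eq (mul_comm _ _)).le
  have hg : ∀ x, HasGradientAt (fun x : 𝔼 => φ (R⁻¹ • x)) (R⁻¹ • gradient φ (R⁻¹ • x)) x := by
    intro x
    have h1 : HasFDerivAt (fun x : 𝔼 => R⁻¹ • x) (R⁻¹ • ContinuousLinearMap.id ℝ 𝔼) x :=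
      (hasFDerivAt_id x).const_smul R⁻¹
    have h2 := ((hφ.differentiable (by simp)) (R⁻¹ • x)).hasGradientAt.hasFDerivAt
    have h3 := h2.comp x h1
    rw [hasGradientAt_iff_hasFDerivAt]
    refine h3.congr_fderiv ?_
    ext y
    simp
  have hone : ∀ x ∈ Metric.ball (0 : 𝔼) R, φ (R⁻¹ • x) = 1 := by
    intro x hx
    refine φ.one_of_mem_closedBall ?_
    rw [mem_ball_zero_iff] at hx
    rw [mem_closedBall_zero_iff, norm_smul, norm_inv, Real.norm_of_nonneg hR.le,
      inv_mul_le_iff₀ hR]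
    exact hx.le.trans_eq (mul_one R).symm
  refine ⟨fun x => φ (R⁻¹ • x), ⟨hφ.comp (contDiff_const_smul _), ?_, Set.subset_univ _⟩,
    fun x => ⟨φ.nonneg, φ.le_one⟩, hone, fun x => ?_, fun x hx => ?_⟩
  · exact HasCompactSupport.of_support_subset_isCompact (isCompact_closedBall 0 (3 / 2 * R))
      (subset_closure.trans hsub)
  · rw [(hg x).gradient, norm_smul, norm_inv, Real.norm_of_nonneg hR.le, div_eq_inv_mul]
    gcongr
    exact hC _
  · by_cases h2 : x ∈ Metric.ball (0 : 𝔼) (2 * R)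
    · have h1 : x ∈ Metric.ball (0 : 𝔼) R := by
        by_contra h
        exact hx ⟨h2, h⟩
      have e : (fun x : 𝔼 => φ (R⁻¹ • x)) =ᶠ[𝓝 x] fun _ => 1 := by
        filter_upwards [Metric.isOpen_ball.mem_nhds h1] with y hy using hone y hy
      rw [gradient, e.fderiv_eq]
      simp
    · refine gradient_eq_zero_of_notMem_tsupport fun h => h2 ?_
      have := hsub h
      rw [mem_closedBall_zero_iff] at this
      rw [mem_ball_zero_iff]
      linarith

/-- The truncation error vanishes as the truncation level tends to infinity. -/
lemma tendsto_truncation_error {p : ℝ} (hp : 1 < p) {ν : Measure 𝔼} {u η : 𝔼 → ℝ} {du : 𝔼 → 𝔼}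
    (hu : AEMeasurable u ν) (hdu : MemLp du (ENNReal.ofReal p) ν) (hη : AEMeasurable η ν)
    (hη1 : ∀ x, η x ∈ Set.Icc 0 1) :
    Tendsto (fun n : ℕ => ∫⁻ x, ENNReal.ofReal
      (η x * ((p - 1) * (1 - truncRatio (n + 1) (u x)) * ‖du x‖ ^ p)) ∂ν) atTop (𝓝 0) := by
  have hp0 : 0 < p := by linarith
  have hp1 : 0 < p - 1 := by linarith
  have hint : Integrable (fun x => (p - 1) * ‖du x‖ ^ p) ν := by
    have := hdu.integrable_norm_rpow (by simpa using hp0) ENNReal.ofReal_ne_top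
    rw [ENNReal.toReal_ofReal hp0.le] at this
    exact this.const_mul _
  rw [← lintegral_zero (μ := ν)]
  refine tendsto_lintegral_of_dominated_convergence'
    (fun x => ENNReal.ofReal ((p - 1) * ‖du x‖ ^ p)) (fun n => ?_) (fun n => ?_)
    hint.lintegral_lt_top.ne ?_
  · have h1 : AEMeasurable (fun x => truncRatio (n + 1) (u x)) ν :=
      (continuous_truncRatio (by positivity)).measurable.comp_aemeasurable hu
    have h2 := hdu.1.norm.aemeasurable.pow_const p
    exact (hη.mul (((h1.const_sub 1).const_mul _).mul h2)).ennreal_ofReal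
  · refine Eventually.of_forall fun x => ENNReal.ofReal_le_ofReal ?_
    have h1 := truncRatio_pos (k := (n : ℝ) + 1) (by positivity) (u x)
    have h2 := truncRatio_le_one (k := (n : ℝ) + 1) (by positivity) (u x)
    have h3 : (p - 1) * (1 - truncRatio (n + 1) (u x)) ≤ p - 1 :=
      mul_le_of_le_one_right hp1.le (by linarith)
    have h4 : 0 ≤ (p - 1) * (1 - truncRatio (n + 1) (u x)) := mul_nonneg hp1.le (by linarith)
    calc _ ≤ 1 * ((p - 1) * (1 - truncRatio (n + 1) (u x)) * ‖du x‖ ^ p) := by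
          gcongr
          exact (hη1 x).2
      _ ≤ (p - 1) * ‖du x‖ ^ p := by
          rw [one_mul]
          gcongr
  · refine Eventually.of_forall fun x => ?_
    have h1 : Tendsto (fun n : ℕ => truncRatio (n + 1) (u x)) atTop (𝓝 1) :=
      (tendsto_truncRatio (u x)).comp
        (tendsto_atTop_add_const_right _ 1 tendsto_natCast_atTop_atTop)
    have h2 : Tendsto (fun n : ℕ => η x * ((p - 1) * (1 - truncRatio (n + 1) (u x)) * ‖du x‖ ^ p))
        atTop (𝓝 (η x * ((p - 1) * (1 - 1) * ‖du x‖ ^ p))) :=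
      (((h1.const_sub 1).const_mul _).mul_const _).const_mul _
    have h3 := (ENNReal.continuous_ofReal.tendsto _).comp h2
    simpa [Function.comp_def] using h3

lemma integrableOn_norm_rpow_ball {p : ℝ} (hp : 1 < p) (hpN : p < N) (μ R : ℝ) :
    IntegrableOn (fun x : 𝔼 => μ / ‖x‖ ^ p) (Metric.ball 0 R) := by
  refine integrableOn_ball_of_norm_le_rpow (C := |μ|) (α := p) ?_ ?_ ?_ ?_
  · rw [finrank_euclideanSpace_fin]
    have : (0 : ℝ) < N := by linarith
    exact_mod_cast this
  · rwa [finrank_euclideanSpace_fin]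
  · refine Eventually.of_forall fun x => le_of_eq ?_
    rw [Real.norm_eq_abs, abs_div, abs_of_nonneg (show 0 ≤ ‖x‖ ^ p by positivity),
      Real.rpow_neg (norm_nonneg _), div_eq_mul_inv]
  · exact (measurable_const.div (measurable_norm.pow_const p)).aestronglyMeasurable

lemma integrable_mul_of_tsupport_of_memLp {p : ℝ} (hp : 1 < p) (hpN : p < N) {Ω : Set 𝔼}
    {g : 𝔼 → ℝ} (hg : MemLp g (ENNReal.ofReal (N / p)) (volume.restrict Ω)) {η : 𝔼 → ℝ}
    (hη : Continuous η) (hηc : HasCompactSupport η) :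
    Integrable (fun x => η x * |g x|) (volume.restrict Ω) := by
  have hp0 : 0 < p := by linarith
  have hconj : (N / p : ℝ).HolderConjugate (N / (N - p)) := by
    rw [Real.holderConjugate_iff]
    constructor
    · rw [lt_div_iff₀ hp0]
      linarith
    · have : (N : ℝ) - p ≠ 0 := by linarith
      have : (N : ℝ) ≠ 0 := by linarith
      field_simp
      ring
  have := hconj.symm.ennrealOfReal
  exact ((hη.memLp_of_hasCompactSupport (p := ENNReal.ofReal (N / (N - p))) hηc).restrict
    Ω).integrable_mul hg.abs

lemma integrable_mul_norm_rpow {p : ℝ} (hp : 1 < p) (hpN : p < N) (μ : ℝ) {η : 𝔼 → ℝ}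
    (hη : Continuous η) (hηc : HasCompactSupport η) :
    Integrable (fun x : 𝔼 => η x * (μ / ‖x‖ ^ p)) := by
  have h : LocallyIntegrable (fun x : 𝔼 => μ / ‖x‖ ^ p) := by
    rw [locallyIntegrable_iff]
    intro K hK
    obtain ⟨R, hR⟩ := hK.isBounded.subset_ball 0
    exact (integrableOn_norm_rpow_ball hp hpN μ R).mono_set hR
  exact h.integrable_smul_left_of_hasCompactSupport hη hηc

/-- The zero-order error vanishes as `ε → 0`. -/
lemma tendsto_zero_order_error {p μ : ℝ} (hp : 1 < p) (hpN : p < N) (hμ : 0 ≤ μ) {Ω : Set 𝔼}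
    {g v η : 𝔼 → ℝ} (hg : MemLp g (ENNReal.ofReal (N / p)) (volume.restrict Ω))
    (hv : AEMeasurable v (volume.restrict Ω)) (hvpos : ∀ᵐ x ∂(volume.restrict Ω), 0 < v x)
    (hη : Continuous η) (hηc : HasCompactSupport η) (hη0 : ∀ x, 0 ≤ η x) {k : ℝ} (hk : 0 < k) :
    Tendsto (fun n : ℕ => ∫⁻ x in Ω, ENNReal.ofReal (η x * ((μ / ‖x‖ ^ p + |g x|) * k ^ p *
      (1 - (v x / (v x + 1 / ((n : ℝ) + 1))) ^ (p - 1))))) atTop (𝓝 0) := by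
  have hp1 : 0 < p - 1 := by linarith
  have hint : Integrable (fun x => η x * (μ / ‖x‖ ^ p + |g x|) * k ^ p) (volume.restrict Ω) := by
    have := ((integrable_mul_norm_rpow hp hpN μ hη hηc).restrict (s := Ω)).add
      (integrable_mul_of_tsupport_of_memLp hp hpN hg hη hηc)
    refine (this.congr (Eventually.of_forall fun x => ?_)).mul_const (k ^ p)
    simp only [Pi.add_apply]
    ring
  rw [← lintegral_zero (μ := volume.restrict Ω)]
  refine tendsto_lintegral_of_dominated_convergence'
    (fun x => ENNReal.ofReal (η x * (μ / ‖x‖ ^ p + |g x|) * k ^ p)) (fun n => ?_) (fun n => ?_)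
    hint.lintegral_lt_top.ne ?_
  · have h1 := (hv.div (hv.add_const (1 / ((n : ℝ) + 1)))).pow_const (p - 1)
    have h2 := (hint.1.aemeasurable.mul (h1.const_sub 1)).ennreal_ofReal
    refine h2.congr (Eventually.of_forall fun x => ?_)
    simp only [Pi.mul_apply, Pi.div_apply]
    congr 1
    ring
  · filter_upwards [hvpos] with x hx
    refine ENNReal.ofReal_le_ofReal ?_
    have h0 : 0 ≤ (v x / (v x + 1 / ((n : ℝ) + 1))) ^ (p - 1) := by positivity
    have h1 : 0 ≤ μ / ‖x‖ ^ p + |g x| := by positivity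
    have h2 := hη0 x
    calc _ = η x * (μ / ‖x‖ ^ p + |g x|) * k ^ p *
          (1 - (v x / (v x + 1 / ((n : ℝ) + 1))) ^ (p - 1)) := by ring
      _ ≤ _ := mul_le_of_le_one_right (by positivity) (by linarith)
  · filter_upwards [hvpos] with x hx
    have h1 : Tendsto (fun n : ℕ => (v x / (v x + 1 / ((n : ℝ) + 1))) ^ (p - 1)) atTop (𝓝 1) := by
      have h := ((tendsto_one_div_add_atTop_nhds_zero_nat (𝕜 := ℝ)).const_add (v x))
      rw [add_zero] at h
      have h' := (tendsto_const_nhds (x := v x)).div h hx.ne'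
      rw [div_self hx.ne'] at h'
      have h'' := h'.rpow_const (p := p - 1) (Or.inr hp1.le)
      rwa [Real.one_rpow] at h''
    have h3 := (ENNReal.continuous_ofReal.tendsto _).comp
      (((h1.const_sub 1).const_mul ((μ / ‖x‖ ^ p + |g x|) * k ^ p)).const_mul (η x))
    simpa [Function.comp_def] using h3

end Limits

/-! ### Removal of the cut-off at infinity and equality of logarithmic gradients. -/

section GradientIdentity

variable {N : ℕ}

local notation "𝔼" => EuclideanSpace ℝ (Fin N)

/-- The L^N norm of a gradient is scale invariant: (C / R) |B_{2R}|^(1/N) does not depend on R. -/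
lemma eLpNorm_gradient_cutoff_le (hN : 1 < N) {C R : ℝ} (hR : 0 < R) {η : 𝔼 → ℝ}
    (h1 : ∀ x, ‖gradient η x‖ ≤ C / R)
    (h2 : ∀ x, x ∉ Metric.ball (0 : 𝔼) (2 * R) \ Metric.ball 0 R → gradient η x = 0) (Ω : Set 𝔼) :
    eLpNorm (fun x => ‖gradient η x‖) (ENNReal.ofReal N) (volume.restrict Ω)
      ≤ volume (Metric.ball (0 : 𝔼) 1) ^ (N : ℝ)⁻¹ * ENNReal.ofReal (2 * C) := by
  have hN0 : (0 : ℝ) < N := by positivity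
  have : NeZero N := ⟨by omega⟩
  have hsupp : Function.support (fun x => ‖gradient η x‖) ⊆ Metric.ball (0 : 𝔼) (2 * R) := by
    intro x hx
    by_contra hxb
    exact hx (by simp only; rw [h2 x fun h => hxb h.1, norm_zero])
  calc _ ≤ eLpNorm (fun x => ‖gradient η x‖) (ENNReal.ofReal N) volume :=
        eLpNorm_mono_measure _ Measure.restrict_le_self
    _ = eLpNorm (fun x => ‖gradient η x‖) (ENNReal.ofReal N)
          (volume.restrict (Metric.ball 0 (2 * R))) :=
        (eLpNorm_restrict_eq_of_support_subset hsupp).symm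
    _ ≤ volume (Metric.ball (0 : 𝔼) (2 * R)) ^ (N : ℝ)⁻¹ * ENNReal.ofReal (C / R) := by
        have h := eLpNorm_le_of_ae_bound (p := ENNReal.ofReal N)
          (μ := volume.restrict (Metric.ball (0 : 𝔼) (2 * R))) (f := fun x => ‖gradient η x‖)
          (Eventually.of_forall fun x => (norm_norm (gradient η x)).trans_le (h1 x))
        rwa [Measure.restrict_apply_univ, ENNReal.toReal_ofReal hN0.le] at h
    _ = _ := by
        rw [Measure.addHaar_ball _ _ (by positivity), finrank_euclideanSpace_fin,
          ENNReal.mul_rpow_of_nonneg _ _ (by positivity),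
          ENNReal.ofReal_rpow_of_nonneg (by positivity) (by positivity),
          Real.pow_rpow_inv_natCast (by positivity) (by omega), mul_right_comm,
          ← ENNReal.ofReal_mul (by positivity), mul_comm]
        congr 2
        field_simp

/-- The gradient term of the cut-off at infinity tends to zero. -/
lemma tendsto_cutoff_error {p : ℝ} (hp : 1 < p) (hpN : p < N) {Ω : Set 𝔼} {u : 𝔼 → ℝ}
    {du : 𝔼 → 𝔼} (hu : MemLp u (ENNReal.ofReal (sobolevExponent N p)) (volume.restrict Ω))
    (hdu : MemLp du (ENNReal.ofReal p) (volume.restrict Ω)) {C : ℝ}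
    {η : ℕ → 𝔼 → ℝ} (hη : ∀ n, IsTestFunction Set.univ (η n))
    (h1 : ∀ (n : ℕ) x, ‖gradient (η n) x‖ ≤ C / (n + 1))
    (h2 : ∀ (n : ℕ) x, x ∉ Metric.ball (0 : 𝔼) (2 * (n + 1)) \ Metric.ball 0 (n + 1) →
      gradient (η n) x = 0) :
    Tendsto (fun n => ∫⁻ x in Ω, ENNReal.ofReal
      (‖gradient (η n) x‖ * (max (u x) 0 * ‖du x‖ ^ (p - 1)))) atTop (𝓝 0) := by
  have hp0 : 0 < p := by linarith
  have hp1 : 0 < p - 1 := by linarith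
  have hN1 : (1 : ℝ) < N := by linarith
  have hNp : (0 : ℝ) < N - p := by linarith
  have hse : 0 < sobolevExponent N p := by linarith [one_lt_sobolevExponent hp hpN]
  have hN11 : (0 : ℝ) < N - 1 := by linarith
  -- 1/p* + (p - 1)/p = (N - 1)/N, so u |∇u|^(p-1) lies in L^(N/(N-1)), dual to the L^N bound on ∇η.
  -- Since ∇η lives outside the ball of radius n + 1, only a tail of this function enters.
  have hT : (sobolevExponent N p).HolderTriple (p / (p - 1)) (N / (N - 1)) := by
    refine ⟨?_, hse, by positivity⟩
    rw [sobolevExponent]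
    field_simp
    ring
  have hT2 : (N : ℝ).HolderConjugate (N / (N - 1)) := by
    rw [Real.holderConjugate_iff]
    refine ⟨hN1, ?_⟩
    field_simp
    ring
  have hT' := hT.ennrealOfReal
  have hT2' := hT2.ennrealOfReal
  have hw : MemLp (fun x => u x * ‖pFlux p (du x)‖) (ENNReal.ofReal (N / (N - 1)))
      (volume.restrict Ω) := MemLp.mul' (memLp_pFlux hp hdu).norm hu
  set w : 𝔼 → ℝ := fun x => u x * ‖pFlux p (du x)‖ with hwdef
  have htail : Tendsto (fun n : ℕ => eLpNorm ((Metric.ball (0 : 𝔼) (n + 1))ᶜ.indicator w)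
      (ENNReal.ofReal (N / (N - 1))) (volume.restrict Ω)) atTop (𝓝 0) := by
    refine tendsto_eLpNorm_zero_of_dominated (g := fun x => ‖w x‖) ?_ ENNReal.ofReal_ne_top
      (fun n => hw.1.indicator measurableSet_ball.compl) hw.norm
      (fun n => Eventually.of_forall fun x => norm_indicator_le_norm_self _ _)
      (Eventually.of_forall fun x => ?_)
    · simpa using (by positivity : 0 < (N : ℝ) / (N - 1))
    · refine tendsto_const_nhds.congr' ?_
      filter_upwards [eventually_ge_atTop ⌈‖x‖⌉₊] with n hn
      have : ‖x‖ < n + 1 := (Nat.le_ceil _).trans_lt (by exact_mod_cast Nat.lt_succ_of_le hn)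
      rw [Set.indicator_of_notMem]
      simpa using this
  set K := volume (Metric.ball (0 : 𝔼) 1) ^ (N : ℝ)⁻¹ * ENNReal.ofReal (2 * C)
  have hK : K ≠ ⊤ := ENNReal.mul_ne_top
    (ENNReal.rpow_ne_top_of_nonneg (by positivity) measure_ball_lt_top.ne) ENNReal.ofReal_ne_top
  have hlim := ENNReal.Tendsto.const_mul htail (Or.inr hK)
  rw [mul_zero] at hlim
  refine tendsto_of_tendsto_of_tendsto_of_le_of_le tendsto_const_nhds hlim (fun _ => zero_le)
    fun n => ?_
  have hm1 : AEStronglyMeasurable (fun x => ‖gradient (η n) x‖) (volume.restrict Ω) :=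
    (hη n).1.continuous_gradient.norm.aestronglyMeasurable
  calc _ ≤ ∫⁻ x in Ω, ‖((fun x => ‖gradient (η n) x‖) •
          (Metric.ball (0 : 𝔼) (n + 1))ᶜ.indicator w) x‖ₑ := by
        refine lintegral_mono fun x => ?_
        simp only
        rw [Pi.smul_apply', ← ofReal_norm, smul_eq_mul]
        refine ENNReal.ofReal_le_ofReal ?_
        by_cases hx : x ∈ Metric.ball (0 : 𝔼) (n + 1)
        · rw [h2 n x fun h => h.2 hx]
          simp
        · rw [Set.indicator_of_mem hx, norm_mul, norm_norm, hwdef]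
          simp only
          rw [norm_mul, norm_norm, norm_pFlux hp]
          gcongr
          exact max_le (Real.le_norm_self _) (norm_nonneg _)
    _ = eLpNorm ((fun x => ‖gradient (η n) x‖) •
          (Metric.ball (0 : 𝔼) (n + 1))ᶜ.indicator w) 1 (volume.restrict Ω) :=
        eLpNorm_one_eq_lintegral_enorm.symm
    _ ≤ eLpNorm (fun x => ‖gradient (η n) x‖) (ENNReal.ofReal N) (volume.restrict Ω) *
          eLpNorm ((Metric.ball (0 : 𝔼) (n + 1))ᶜ.indicator w) (ENNReal.ofReal (N / (N - 1)))
            (volume.restrict Ω) :=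
        eLpNorm_smul_le_mul_eLpNorm (hw.1.indicator measurableSet_ball.compl) hm1
    _ ≤ _ := by
        gcongr
        exact eLpNorm_gradient_cutoff_le (by exact_mod_cast hN1) (by positivity) (h1 n) (h2 n) Ω

/-- With |∇η| ≤ C / R on the annulus, the term is C times the average in the growth hypothesis; for
nonnegative quantities a vanishing limsup is a limit. -/
lemma tendsto_growth_error {Ω : Set 𝔼} {G : 𝔼 → ℝ}
    (hgrowth : limsup (fun R : ℝ => ENNReal.ofReal R⁻¹ *
      ∫⁻ x in Metric.ball 0 (2 * R) \ Metric.ball 0 R, ENNReal.ofReal (G x)) atTop = 0)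
    {C : ℝ} (hC : 0 ≤ C) {η : ℕ → 𝔼 → ℝ}
    (h1 : ∀ (n : ℕ) x, ‖gradient (η n) x‖ ≤ C / (n + 1))
    (h2 : ∀ (n : ℕ) x, x ∉ Metric.ball (0 : 𝔼) (2 * (n + 1)) \ Metric.ball 0 (n + 1) →
      gradient (η n) x = 0) :
    Tendsto (fun n => ∫⁻ x in Ω, ENNReal.ofReal (‖gradient (η n) x‖ * G x)) atTop (𝓝 0) := by
  have h0 : Tendsto (fun R : ℝ => ENNReal.ofReal R⁻¹ *
      ∫⁻ x in Metric.ball (0 : 𝔼) (2 * R) \ Metric.ball 0 R, ENNReal.ofReal (G x)) atTop (𝓝 0) :=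
    tendsto_of_le_liminf_of_limsup_le zero_le hgrowth.le
  have h3 := h0.comp (tendsto_atTop_add_const_right atTop (1 : ℝ) tendsto_natCast_atTop_atTop)
  have h4 := ENNReal.Tendsto.const_mul h3 (Or.inr (ENNReal.ofReal_ne_top (r := C)))
  rw [mul_zero] at h4
  refine tendsto_of_tendsto_of_tendsto_of_le_of_le tendsto_const_nhds h4 (fun _ => zero_le)
    fun n => ?_
  have hms : MeasurableSet (Metric.ball (0 : 𝔼) (2 * ((n : ℝ) + 1)) \ Metric.ball 0 ((n : ℝ) + 1)) :=
    measurableSet_ball.diff measurableSet_ball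
  calc _ ≤ ∫⁻ x, ENNReal.ofReal (‖gradient (η n) x‖ * G x) := setLIntegral_le_lintegral _ _
    _ ≤ ∫⁻ x, (Metric.ball (0 : 𝔼) (2 * ((n : ℝ) + 1)) \ Metric.ball 0 ((n : ℝ) + 1)).indicator
          (fun x => ENNReal.ofReal C * ENNReal.ofReal ((n : ℝ) + 1)⁻¹ * ENNReal.ofReal (G x)) x := by
        refine lintegral_mono fun x => ?_
        by_cases hx : x ∈ Metric.ball (0 : 𝔼) (2 * ((n : ℝ) + 1)) \ Metric.ball 0 ((n : ℝ) + 1)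
        · simp only
          rw [Set.indicator_of_mem hx, ENNReal.ofReal_mul (norm_nonneg _), ← ENNReal.ofReal_mul hC]
          gcongr
          rw [← div_eq_mul_inv]
          exact h1 n x
        · simp only
          rw [h2 n x hx, norm_zero, zero_mul, ENNReal.ofReal_zero]
          exact zero_le
    _ = _ := by
        rw [lintegral_indicator hms, lintegral_const_mul' _ _
          (ENNReal.mul_ne_top ENNReal.ofReal_ne_top ENNReal.ofReal_ne_top), mul_assoc]
        rfl

lemma aemeasurable_energyDensity {ν : Measure 𝔼} {p ε k : ℝ} (hk : 0 < k) {u v : 𝔼 → ℝ}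
    {du dv : 𝔼 → 𝔼} (hu : AEMeasurable u ν) (hv : AEMeasurable v ν) (hdu : AEMeasurable du ν)
    (hdv : AEMeasurable dv ν) :
    AEMeasurable (fun x => energyDensity p ε k (u x) (v x) (du x) (dv x)) ν := by
  have h1 : AEMeasurable (fun x => truncRatio k (u x)) ν :=
    (continuous_truncRatio hk).measurable.comp_aemeasurable hu
  have h2 : AEMeasurable (fun x => gapPart ε k (u x) (v x)) ν :=
    ((h1.mul hu).sub (hv.add_const ε)).max aemeasurable_const
  have h3 : AEMeasurable (fun x => (u x)⁻¹ • du x) ν := hu.inv.smul hdu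
  have h4 : AEMeasurable (fun x => (v x + ε)⁻¹ • dv x) ν := (hv.add_const ε).inv.smul hdv
  have h5 : AEMeasurable (fun x => pFlux p ((v x + ε)⁻¹ • dv x)) ν :=
    (h4.norm.pow_const (p - 2)).smul h4
  have h6 : AEMeasurable (fun x => inner ℝ (pFlux p ((v x + ε)⁻¹ • dv x)) ((u x)⁻¹ • du x)) ν :=
    h5.inner h3
  have h7 : AEMeasurable (fun x => ‖(u x)⁻¹ • du x‖ ^ p / p) ν :=
    (h3.norm.pow_const p).div_const p
  have h8 : AEMeasurable (fun x => (p - 1) / p * ‖(v x + ε)⁻¹ • dv x‖ ^ p) ν :=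
    (h4.norm.pow_const p).const_mul _
  have h9 : AEMeasurable (fun x => bregman p ((u x)⁻¹ • du x) ((v x + ε)⁻¹ • dv x)) ν :=
    (h7.add h8).sub h6
  have h10 : AEMeasurable (fun x => truncRatio k (u x) *
      (p * (truncRatio k (u x) * u x) * gapPart ε k (u x) (v x) ^ (p - 1))) ν :=
    h1.mul (((h1.mul hu).const_mul p).mul (h2.pow_const (p - 1)))
  exact h10.mul h9

lemma tendsto_energyDensity {F : Type*} [NormedAddCommGroup F] [InnerProductSpace ℝ F]
    {p a b : ℝ} (hp : 1 < p) (hb : 0 < b) (hab : b < a) {k ε : ℕ → ℝ}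
    (hk : Tendsto k atTop atTop) (hε : Tendsto ε atTop (𝓝 0)) (hε0 : ∀ n, 0 < ε n) (P Q : F) :
    Tendsto (fun n => energyDensity p (ε n) (k n) a b P Q) atTop
      (𝓝 (p * a * (a - b) ^ (p - 1) * bregman p (a⁻¹ • P) (b⁻¹ • Q))) := by
  -- By homogeneity the ε-dependence sits in powers of the scalar c = (b + ε)⁻¹, so continuity of
  -- the vector field z ↦ |z|^(p-2) z is not needed.
  have hbr : ∀ c : ℝ, 0 < c → bregman p (a⁻¹ • P) (c • Q) = ‖a⁻¹ • P‖ ^ p / p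
      + (p - 1) / p * (c ^ p * ‖Q‖ ^ p) - c ^ (p - 1) * inner ℝ (pFlux p Q) (a⁻¹ • P) := by
    intro c hc
    rw [bregman, pFlux_smul hc, norm_smul c, Real.norm_of_nonneg hc.le,
      Real.mul_rpow hc.le (norm_nonneg Q), real_inner_smul_left]
  have hτ := (tendsto_truncRatio a).comp hk
  have hc : Tendsto (fun n => (b + ε n)⁻¹) atTop (𝓝 b⁻¹) := by
    have := (hε.const_add b).inv₀ (by simpa using hb.ne')
    rwa [add_zero] at this
  have hD : Tendsto (fun n => gapPart (ε n) (k n) a b) atTop (𝓝 (a - b)) := by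
    have h := ((hτ.mul_const a).sub (hε.const_add b)).max (tendsto_const_nhds (x := (0 : ℝ)))
    rw [one_mul, add_zero, max_eq_left (by linarith)] at h
    exact h
  have hB : Tendsto (fun n => bregman p (a⁻¹ • P) ((b + ε n)⁻¹ • Q)) atTop
      (𝓝 (bregman p (a⁻¹ • P) (b⁻¹ • Q))) := by
    rw [hbr _ (inv_pos.2 hb)]
    have h := ((((hc.rpow_const (p := p) (Or.inr (by linarith))).mul_const (‖Q‖ ^ p)).const_mul
      ((p - 1) / p)).const_add (‖a⁻¹ • P‖ ^ p / p)).sub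
      ((hc.rpow_const (p := p - 1) (Or.inr (by linarith))).mul_const
        (inner ℝ (pFlux p Q) (a⁻¹ • P)))
    refine h.congr fun n => ?_
    rw [hbr _ (inv_pos.2 (by linarith [hε0 n]))]
  have h := (hτ.mul (((hτ.mul_const a).const_mul p).mul
    (hD.rpow_const (p := p - 1) (Or.inr (by linarith))))).mul hB
  simp only [one_mul] at h
  exact h

/-- On the set where the subsolution exceeds the supersolution, their logarithmic gradients
agree. -/
lemma ae_log_gradient_eq {p μ : ℝ} (hp : 1 < p) (hpN : p < N) (hμ : 0 ≤ μ) {Ω : Set 𝔼}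
    (hΩ : IsOpen Ω) (hΩb : Bornology.IsBounded Ωᶜ) {f g u v : 𝔼 → ℝ}
    (hf : MemLp f (ENNReal.ofReal (N / p)) (volume.restrict Ω))
    (hg : MemLp g (ENNReal.ofReal (N / p)) (volume.restrict Ω))
    (hfg : ∀ᵐ x ∂(volume.restrict Ω), f x ≤ g x)
    (hu : IsWeakSubsolution p μ Ω f u) (hv : IsWeakSupersolution p μ Ω g v)
    (hvpos : ∀ᵐ x ∂(volume.restrict Ω), 0 < v x)
    (hgrowth : limsup (fun R : ℝ => ENNReal.ofReal R⁻¹ *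
      ∫⁻ x in Metric.ball 0 (2 * R) \ Metric.ball 0 R,
        ENNReal.ofReal (max (u x) 0 ^ p * (‖weakGrad Ω v x‖ / v x) ^ (p - 1))) atTop = 0)
    (huv : LEOnBoundary p Ω u v) :
    ∀ᵐ x ∂(volume.restrict Ω), v x < u x →
      (u x)⁻¹ • weakGrad Ω u x = (v x)⁻¹ • weakGrad Ω v x := by
  have hp1 : 0 < p - 1 := by linarith
  obtain ⟨C, hC, hcut⟩ := exists_scaled_cutoff (N := N)
  choose η hη hη01 hη1 hηC hη0 using fun n : ℕ => hcut (n + 1) (by positivity)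
  obtain ⟨hvw, hvp, hdv, -⟩ := hv.hasWeakGradient hΩ
  have hdu := hu.1.2.2
  have hum : AEMeasurable u (volume.restrict Ω) := hu.1.1.1.aemeasurable
  have hvm : AEMeasurable v (volume.restrict Ω) := hvp.1.aemeasurable
  have hdum : AEMeasurable (weakGrad Ω u) (volume.restrict Ω) := hdu.1.aemeasurable
  have hdvm : AEMeasurable (weakGrad Ω v) (volume.restrict Ω) := hdv.1.aemeasurable
  -- The order of choices matters: the radius n + 1 first, then the level k depending on n, and only
  -- then ε, since the zero-order error carries a factor k^p. The two cut-off errors are uniform in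
  -- k and ε.
  have htr : ∀ n : ℕ, ∃ k : ℝ, (n : ℝ) + 1 ≤ k ∧ ∫⁻ x in Ω, ENNReal.ofReal
      (η n x * ((p - 1) * (1 - truncRatio k (u x)) * ‖weakGrad Ω u x‖ ^ p))
      < ((n : ENNReal) + 1)⁻¹ := by
    intro n
    have hpos : (0 : ENNReal) < ((n : ENNReal) + 1)⁻¹ := by simp
    have h := (tendsto_truncation_error hp hum hdu (hη n).1.continuous.aemeasurable
      (hη01 n)).eventually (gt_mem_nhds hpos)
    obtain ⟨m, hm, hmn⟩ := (h.and (eventually_ge_atTop n)).exists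
    exact ⟨m + 1, by exact_mod_cast Nat.succ_le_succ hmn, hm⟩
  choose k hk hE1 using htr
  have hk0 : ∀ n, 0 < k n := fun n => lt_of_lt_of_le (by positivity) (hk n)
  have hzr : ∀ n : ℕ, ∃ ε : ℝ, 0 < ε ∧ ε ≤ 1 / ((n : ℝ) + 1) ∧ ∫⁻ x in Ω, ENNReal.ofReal
      (η n x * ((μ / ‖x‖ ^ p + |g x|) * k n ^ p * (1 - (v x / (v x + ε)) ^ (p - 1))))
      < ((n : ENNReal) + 1)⁻¹ := by
    intro n
    have hpos : (0 : ENNReal) < ((n : ENNReal) + 1)⁻¹ := by simp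
    have h := (tendsto_zero_order_error hp hpN hμ hg hvm hvpos (hη n).1.continuous (hη n).2.1
      (fun x => (hη01 n x).1) (hk0 n)).eventually (gt_mem_nhds hpos)
    obtain ⟨m, hm, hmn⟩ := (h.and (eventually_ge_atTop n)).exists
    refine ⟨1 / ((m : ℝ) + 1), by positivity, ?_, hm⟩
    gcongr
  choose ε hε0 hε hE3 using hzr
  have hεl : Tendsto ε atTop (𝓝 0) := squeeze_zero (fun n => (hε0 n).le) hε
    tendsto_one_div_add_atTop_nhds_zero_nat
  have hkl : Tendsto k atTop atTop := tendsto_atTop_mono hk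
    (tendsto_atTop_add_const_right atTop (1 : ℝ) tendsto_natCast_atTop_atTop)
  have hE2a := tendsto_cutoff_error hp hpN hu.1.1 hdu hη hηC hη0
  have hE2b := tendsto_growth_error (Ω := Ω) hgrowth hC hηC hη0
  have hinv : Tendsto (fun n : ℕ => ((n : ENNReal) + 1)⁻¹) atTop (𝓝 0) := by
    have := (tendsto_add_atTop_iff_nat 1).2 ENNReal.tendsto_inv_nat_nhds_zero
    simpa using this
  have hbound := (hinv.add (hE2a.add hE2b)).add hinv
  simp only [add_zero] at hbound
  have hint : Tendsto (fun n => ∫⁻ x in Ω, ENNReal.ofReal (η n x * energyDensity p (ε n) (k n)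
      (u x) (v x) (weakGrad Ω u x) (weakGrad Ω v x))) atTop (𝓝 0) := by
    refine tendsto_of_tendsto_of_tendsto_of_le_of_le tendsto_const_nhds hbound (fun _ => zero_le)
      fun n => ?_
    refine (lintegral_energyDensity_le hp hpN hμ hΩ hΩb hf hg hfg hu hv hvpos huv (hε0 n) (hk0 n)
      (hη n) fun x => (hη01 n x).1).trans ?_
    have hgm : AEMeasurable (fun x => ‖gradient (η n) x‖) (volume.restrict Ω) :=
      (hη n).1.continuous_gradient.norm.aemeasurable
    have m1 : AEMeasurable (fun x => ENNReal.ofReal (η n x * ((p - 1) *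
        (1 - truncRatio (k n) (u x)) * ‖weakGrad Ω u x‖ ^ p))) (volume.restrict Ω) :=
      ((hη n).1.continuous.aemeasurable.mul ((((continuous_truncRatio
        (hk0 n)).measurable.comp_aemeasurable hum).const_sub 1 |>.const_mul _).mul
        (hdum.norm.pow_const p))).ennreal_ofReal
    have m2 : AEMeasurable (fun x => ENNReal.ofReal (‖gradient (η n) x‖ *
        (max (u x) 0 * ‖weakGrad Ω u x‖ ^ (p - 1)))) (volume.restrict Ω) :=
      (hgm.mul ((hum.max aemeasurable_const).mul (hdum.norm.pow_const _))).ennreal_ofReal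
    have m3 : AEMeasurable (fun x => ENNReal.ofReal (‖gradient (η n) x‖ *
        (max (u x) 0 ^ p * (‖weakGrad Ω v x‖ / v x) ^ (p - 1)))) (volume.restrict Ω) :=
      (hgm.mul (((hum.max aemeasurable_const).pow_const p).mul
        ((hdvm.norm.div hvm).pow_const _))).ennreal_ofReal
    have hadd : ∀ {f₁ f₂ f₃ : 𝔼 → ENNReal}, AEMeasurable f₁ (volume.restrict Ω) →
        AEMeasurable f₂ (volume.restrict Ω) → AEMeasurable f₃ (volume.restrict Ω) →
        ∀ f₄ : 𝔼 → ENNReal, ∫⁻ x in Ω, (f₁ x + (f₂ x + f₃ x) + f₄ x) =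
          (∫⁻ x in Ω, f₁ x) + ((∫⁻ x in Ω, f₂ x) + ∫⁻ x in Ω, f₃ x) + ∫⁻ x in Ω, f₄ x := by
      intro f₁ f₂ f₃ m1 m2 m3 f₄
      rw [← lintegral_add_left' m2, ← lintegral_add_left' m1]
      exact lintegral_add_left' (m1.add (m2.add m3)) f₄
    calc _ ≤ ∫⁻ x in Ω, (ENNReal.ofReal (η n x * ((p - 1) *
          (1 - truncRatio (k n) (u x)) * ‖weakGrad Ω u x‖ ^ p)) +
          (ENNReal.ofReal (‖gradient (η n) x‖ * (max (u x) 0 * ‖weakGrad Ω u x‖ ^ (p - 1))) +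
            ENNReal.ofReal (‖gradient (η n) x‖ *
              (max (u x) 0 ^ p * (‖weakGrad Ω v x‖ / v x) ^ (p - 1)))) +
          ENNReal.ofReal (η n x * ((μ / ‖x‖ ^ p + |g x|) * k n ^ p *
            (1 - (v x / (v x + ε n)) ^ (p - 1))))) := by
          refine lintegral_mono fun x => ?_
          simp only [energyError, mul_add (‖gradient (η n) x‖)]
          exact ENNReal.ofReal_add_le.trans (add_le_add (ENNReal.ofReal_add_le.trans
            (add_le_add le_rfl ENNReal.ofReal_add_le)) le_rfl)
      _ = _ := hadd m1 m2 m3 _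
      _ ≤ _ := by
          gcongr
          · exact (hE1 n).le
          · exact (hE3 n).le
  -- Pointwise limit of the energy density. At a fixed x the cut-off is eventually 1; where u ≤ v
  -- the density is 0 for every n. Fatou's lemma then makes the limit vanish almost everywhere.
  have hlim : ∀ᵐ x ∂(volume.restrict Ω), Tendsto (fun n => ENNReal.ofReal (η n x *
      energyDensity p (ε n) (k n) (u x) (v x) (weakGrad Ω u x) (weakGrad Ω v x))) atTop
      (𝓝 (ENNReal.ofReal (p * u x * max (u x - v x) 0 ^ (p - 1) *
        bregman p ((u x)⁻¹ • weakGrad Ω u x) ((v x)⁻¹ • weakGrad Ω v x)))) := by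
    filter_upwards [hvpos] with x hx
    refine (ENNReal.continuous_ofReal.tendsto _).comp ?_
    rcases lt_or_ge (v x) (u x) with h | h
    · have h1 := tendsto_energyDensity hp hx h hkl hεl hε0 (weakGrad Ω u x) (weakGrad Ω v x)
      rw [max_eq_left (by linarith)]
      refine h1.congr' ?_
      filter_upwards [eventually_ge_atTop ⌈‖x‖⌉₊] with n hn
      have : ‖x‖ < n + 1 := (Nat.le_ceil _).trans_lt (by exact_mod_cast Nat.lt_succ_of_le hn)
      rw [hη1 n x (by simpa using this), one_mul]
    · rw [max_eq_right (by linarith), Real.zero_rpow hp1.ne', mul_zero, zero_mul]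
      refine tendsto_const_nhds.congr fun n => ?_
      rw [energyDensity, gapPart_eq_zero (hk0 n) (by linarith [hε0 n]) (by linarith [hε0 n]),
        Real.zero_rpow hp1.ne', mul_zero, mul_zero, zero_mul, mul_zero]
  have hzero := ae_eq_zero_of_tendsto_lintegral (fun n => ((hη n).1.continuous.aemeasurable.mul
    (aemeasurable_energyDensity (hk0 n) hum hvm hdum hdvm)).ennreal_ofReal) hlim hint
  filter_upwards [hzero, hvpos] with x hx hvx hlt
  have hux : 0 < u x := hvx.trans hlt
  rw [ENNReal.ofReal_eq_zero, max_eq_left (by linarith)] at hx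
  have hpos : 0 < p * u x * (u x - v x) ^ (p - 1) := by
    have : 0 < u x - v x := by linarith
    positivity
  refine eq_of_bregman_eq_zero hp (le_antisymm ?_ (bregman_nonneg hp _ _))
  exact nonpos_of_mul_nonpos_right hx hpos

end GradientIdentity

/-! ### Logarithmic gradient estimate for positive supersolutions. -/

section LogarithmicEstimate

/-- The test function is η^n (v + ε)^(1-p). Differentiating the power of v gives (p - 1) η^n (|∇v| /
(v + ε))^p; Young's inequality takes (p - 1)/p of it for the term with ∇η, leaving (p - 1)²/p. The
Hardy term of a supersolution has the good sign and is dropped, and (v / (v + ε))^(p-1) ≤ 1 leaves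
only |g|. -/
lemma logarithmic_estimate_pointwise {F : Type*} [NormedAddCommGroup F] [InnerProductSpace ℝ F]
    {p ε b η m g : ℝ} {n : ℕ} (hp : 1 < p) (hn : p ≤ n) (hε : 0 < ε) (hb : 0 < b)
    (hη : η ∈ Set.Icc (0 : ℝ) 1) (hm : 0 ≤ m) (Q Z : F) :
    (p - 1) ^ 2 / p * (η ^ n * (‖Q‖ / (b + ε)) ^ p) ≤
      (inner ℝ (pFlux p (-Q)) (η ^ n • ((0 : ℝ) • Q + (-((p - 1) / (b + ε) ^ p)) • Q)
        + ((b + ε) ^ (p - 1))⁻¹ • ((n * η ^ (n - 1)) • Z))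
        - (m + g) * pFlux p (-b) * (η ^ n * ((b + ε) ^ (p - 1))⁻¹))
      + ((n * ‖Z‖) ^ p / p + η ^ n * |g|) := by
  obtain ⟨hη0, hη1⟩ := hη
  have hp0 : 0 < p := by linarith
  have hp1 : 0 < p - 1 := by linarith
  have hβ : 0 < b + ε := by linarith
  set β := b + ε with hβdef
  set w := ‖Q‖ / β with hw
  have hw0 : 0 ≤ w := by positivity
  have hβp : 0 < β ^ p := by positivity
  have hβ1 : 0 < β ^ (p - 1) := by positivity
  have hwp : w ^ p = ‖Q‖ ^ p / β ^ p := Real.div_rpow (norm_nonneg _) hβ.le _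
  have hw1 : w ^ (p - 1) = ‖Q‖ ^ (p - 1) / β ^ (p - 1) := Real.div_rpow (norm_nonneg _) hβ.le _
  have hn1 : (1 : ℝ) < n := hp.trans_le hn
  have hn1' : 1 < n := by exact_mod_cast hn1
  have hin := inner_pFlux_le hp Z Q
  -- Here n ≥ p enters: n (p - 1)/p ≤ n - 1, and 0 ≤ η ≤ 1. The power of η in the cross term then
  -- fits into Young's inequality.
  have hpow : η ^ (n - 1) ≤ (η ^ ((n : ℝ) / p)) ^ (p - 1) := by
    rcases hη0.eq_or_lt with rfl | hpos
    · rw [zero_pow (by omega)]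
      positivity
    · rw [← Real.rpow_natCast, ← Real.rpow_mul hη0, Nat.cast_sub hn1'.le, Nat.cast_one]
      refine Real.rpow_le_rpow_of_exponent_ge hpos hη1 ?_
      rw [div_mul_eq_mul_div, div_le_iff₀ hp0]
      nlinarith
  have hηp : (η ^ ((n : ℝ) / p)) ^ p = η ^ n := by
    rw [← Real.rpow_mul hη0, div_mul_cancel₀ _ hp0.ne', Real.rpow_natCast]
  have hyoung := rpow_sub_one_mul_le hp (s := w * η ^ ((n : ℝ) / p)) (t := n * ‖Z‖)
    (by positivity) (by positivity)
  rw [Real.mul_rpow hw0 (by positivity), Real.mul_rpow hw0 (by positivity), hηp] at hyoung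
  have hcross : w ^ (p - 1) * (n * η ^ (n - 1) * ‖Z‖) ≤
      (n * ‖Z‖) ^ p / p + (p - 1) / p * (w ^ p * η ^ n) := by
    refine le_trans ?_ hyoung
    calc w ^ (p - 1) * (n * η ^ (n - 1) * ‖Z‖) = w ^ (p - 1) * η ^ (n - 1) * (n * ‖Z‖) := by ring
      _ ≤ _ := by gcongr
  have hflux : pFlux p (-b) = -b ^ (p - 1) := by
    rw [pFlux_neg, ← pFlux_real, abs_of_pos hb, ← Real.rpow_add_one hb.ne']
    congr 2; ring
  have hr0 : 0 ≤ b ^ (p - 1) * (β ^ (p - 1))⁻¹ := by positivity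
  have hr1 : b ^ (p - 1) * (β ^ (p - 1))⁻¹ ≤ 1 := by
    rw [← div_eq_mul_inv, div_le_one hβ1]
    exact Real.rpow_le_rpow hb.le (by linarith) hp1.le
  have hzero : (m + g) * pFlux p (-b) * (η ^ n * (β ^ (p - 1))⁻¹) ≤ η ^ n * |g| := by
    rw [hflux]
    have hηn : 0 ≤ η ^ n := by positivity
    calc (m + g) * -b ^ (p - 1) * (η ^ n * (β ^ (p - 1))⁻¹)
        = η ^ n * ((-m - g) * (b ^ (p - 1) * (β ^ (p - 1))⁻¹)) := by ring
      _ ≤ η ^ n * (|g| * 1) := by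
          refine mul_le_mul_of_nonneg_left ?_ hηn
          calc (-m - g) * (b ^ (p - 1) * (β ^ (p - 1))⁻¹)
              ≤ |g| * (b ^ (p - 1) * (β ^ (p - 1))⁻¹) := by
                refine mul_le_mul_of_nonneg_right ?_ hr0
                linarith [neg_le_abs g]
            _ ≤ |g| * 1 := by gcongr
      _ = _ := by rw [mul_one]
  have hmain : inner ℝ (pFlux p (-Q)) (η ^ n • ((0 : ℝ) • Q + (-((p - 1) / β ^ p)) • Q)
        + (β ^ (p - 1))⁻¹ • ((n * η ^ (n - 1)) • Z))
      = (p - 1) * (η ^ n * w ^ p) - n * η ^ (n - 1) * ((β ^ (p - 1))⁻¹ * inner ℝ (pFlux p Q) Z) := by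
    simp only [zero_smul, zero_add, inner_add_right, real_inner_smul_right, pFlux_neg,
      inner_neg_left, inner_pFlux_self hp, hwp]
    field_simp
    ring
  have hin' : n * η ^ (n - 1) * ((β ^ (p - 1))⁻¹ * inner ℝ (pFlux p Q) Z)
      ≤ w ^ (p - 1) * (n * η ^ (n - 1) * ‖Z‖) := by
    rw [hw1]
    calc n * η ^ (n - 1) * ((β ^ (p - 1))⁻¹ * inner ℝ (pFlux p Q) Z)
        ≤ n * η ^ (n - 1) * ((β ^ (p - 1))⁻¹ * (‖Q‖ ^ (p - 1) * ‖Z‖)) := by gcongr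
      _ = _ := by
          field_simp
  have e : (p - 1) ^ 2 / p * (η ^ n * w ^ p)
      = (p - 1) * (η ^ n * w ^ p) - (p - 1) / p * (w ^ p * η ^ n) := by
    field_simp
  rw [hmain, e]
  linarith

variable {N : ℕ}

local notation "𝔼" => EuclideanSpace ℝ (Fin N)

lemma IsTestFunction.pow {Ω : Set 𝔼} {ξ : 𝔼 → ℝ} (hξ : IsTestFunction Ω ξ) {n : ℕ} (hn : n ≠ 0) :
    IsTestFunction Ω (fun x => ξ x ^ n) ∧
    ∀ x, gradient (fun x => ξ x ^ n) x = (n * ξ x ^ (n - 1)) • gradient ξ x := by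
  have hsub : Function.support (fun x => ξ x ^ n) ⊆ Function.support ξ := by
    intro x hx h0
    exact hx (by simp [h0, hn])
  refine ⟨⟨hξ.1.pow n, hξ.2.1.mono hsub, (closure_mono hsub).trans hξ.2.2⟩, fun x => ?_⟩
  have h := (hξ.1.differentiable (by simp) x).hasGradientAt
  exact (HasGradientAt.comp_deriv (hasDerivAt_pow n (ξ x)) h).gradient

/-- Logarithmic gradient estimate for positive supersolutions. -/
lemma IsWeakSupersolution.lintegral_log_gradient_lt_top {p μ : ℝ} (hp : 1 < p) (hpN : p < N)
    (hμ : 0 ≤ μ) {Ω : Set 𝔼} (hΩ : IsOpen Ω) {g v : 𝔼 → ℝ}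
    (hg : MemLp g (ENNReal.ofReal (N / p)) (volume.restrict Ω))
    (hv : IsWeakSupersolution p μ Ω g v) (hvpos : ∀ᵐ x ∂(volume.restrict Ω), 0 < v x)
    {ξ : 𝔼 → ℝ} (hξ : IsTestFunction Ω ξ) (hξ1 : ∀ x, ξ x ∈ Set.Icc (0 : ℝ) 1) {n : ℕ}
    (hn : p ≤ n) :
    ∫⁻ x in Ω, ENNReal.ofReal ((p - 1) ^ 2 / p * (ξ x ^ n * (‖weakGrad Ω v x‖ / v x) ^ p)) < ⊤ := by
  have hp0 : 0 < p := by linarith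
  have hn0 : n ≠ 0 := by
    rintro rfl
    simp at hn
    linarith
  obtain ⟨hvw, hvp, hdv, hdv'⟩ := hv.hasWeakGradient hΩ
  have hv0 : ∀ᵐ x ∂(volume.restrict Ω), 0 ≤ v x := hvpos.mono fun x hx => hx.le
  obtain ⟨hm, hmg⟩ := hξ.pow hn0
  have herr : Integrable (fun x => (n * ‖gradient ξ x‖) ^ p / p + ξ x ^ n * |g x|)
      (volume.restrict Ω) := by
    refine Integrable.add ?_ ?_
    · have hc : Continuous fun x => (n * ‖gradient ξ x‖) ^ p / p :=
        ((continuous_const.mul hξ.1.continuous_gradient.norm).rpow_const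
          fun _ => Or.inr hp0.le).div_const p
      refine (hc.integrable_of_hasCompactSupport
        (hξ.2.1.gradient.mono fun x hx h0 => hx ?_)).restrict
      simp [h0, Real.zero_rpow hp0.ne']
    · exact integrable_mul_of_tsupport_of_memLp hp hpN hg hm.1.continuous hm.2.1
  -- The right-hand side does not depend on ε, so Fatou's lemma allows ε → 0.
  have hbound : ∀ ε : ℝ, 0 < ε → ∫⁻ x in Ω, ENNReal.ofReal
      ((p - 1) ^ 2 / p * (ξ x ^ n * (‖weakGrad Ω v x‖ / (v x + ε)) ^ p)) ≤
      ∫⁻ x in Ω, ENNReal.ofReal ((n * ‖gradient ξ x‖) ^ p / p + ξ x ^ n * |g x|) := by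
    intro ε hε
    have hB := hasBoundedPartials_rpow hp hε
    obtain ⟨C, hC, hΦ, hd⟩ := hB.memLp_comp hΩ hvw hvw hv0 hdv hdv
    obtain ⟨i, t⟩ := IsWeakSubsolution.integral_weakForm_le hp hpN hΩ hv hg hC
      (hvw.comp hΩ hB hvw hv0) hΦ (hv0.mono fun x hx => by positivity) hd hm
      (fun x => pow_nonneg (hξ1 x).1 n)
    refine lintegral_ofReal_le_of_le_add i t ?_ ?_
    · filter_upwards [hvpos] with x hx
      have := (hξ1 x).1
      positivity
    · filter_upwards [hvpos, hdv'] with x hx hxd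
      simp only [weakForm]
      rw [hxd, hmg]
      exact logarithmic_estimate_pointwise hp hn hε hx (hξ1 x)
        (div_nonneg hμ (Real.rpow_nonneg (norm_nonneg x) p)) _ _
  have hvm : AEMeasurable v (volume.restrict Ω) := hvp.1.aemeasurable
  have hdvm : AEMeasurable (weakGrad Ω v) (volume.restrict Ω) := hdv.1.aemeasurable
  refine (lintegral_le_of_tendsto (F := fun (k : ℕ) x => ENNReal.ofReal ((p - 1) ^ 2 / p *
    (ξ x ^ n * (‖weakGrad Ω v x‖ / (v x + 1 / ((k : ℝ) + 1))) ^ p))) (fun k => ?_) ?_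
    fun k => hbound _ (by positivity)).trans_lt herr.lintegral_lt_top
  · exact ((hm.1.continuous.aemeasurable.mul ((hdvm.norm.div
      (hvm.add_const _)).pow_const p)).const_mul _).ennreal_ofReal
  · filter_upwards [hvpos] with x hx
    refine (ENNReal.continuous_ofReal.tendsto _).comp ((Tendsto.const_mul _ ?_).const_mul _)
    refine Tendsto.rpow_const ?_ (Or.inr hp0.le)
    have h := (tendsto_one_div_add_atTop_nhds_zero_nat (𝕜 := ℝ)).const_add (v x)
    rw [add_zero] at h
    exact tendsto_const_nhds.div h hx.ne'

/-- The logarithmic estimate with ξ = 1 on K and exponent ⌈p⌉ bounds ∇v / v in L^p(K), hence in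
L¹(K). It supplies the dominating function in `hasWeakGradient_ratio_zero`. -/
lemma IsWeakSupersolution.locallyIntegrableOn_log_gradient {p μ : ℝ} (hp : 1 < p) (hpN : p < N)
    (hμ : 0 ≤ μ) {Ω : Set 𝔼} (hΩ : IsOpen Ω) {g v : 𝔼 → ℝ}
    (hg : MemLp g (ENNReal.ofReal (N / p)) (volume.restrict Ω))
    (hv : IsWeakSupersolution p μ Ω g v) (hvpos : ∀ᵐ x ∂(volume.restrict Ω), 0 < v x) :
    LocallyIntegrableOn (fun x => ‖weakGrad Ω v x‖ / v x) Ω := by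
  have hp0 : 0 < p := by linarith
  have hp1 : 0 < p - 1 := by linarith
  obtain ⟨hvw, hvp, hdv, hdv'⟩ := hv.hasWeakGradient hΩ
  have hvm : AEMeasurable v (volume.restrict Ω) := hvp.1.aemeasurable
  have hdvm : AEMeasurable (weakGrad Ω v) (volume.restrict Ω) := hdv.1.aemeasurable
  rw [locallyIntegrableOn_iff hΩ.isLocallyClosed]
  intro K hKΩ hK
  obtain ⟨ξ, hξ, hξ1, hξI⟩ := exists_smooth_cutoff hK hΩ hKΩ
  have hfin := hv.lintegral_log_gradient_lt_top hp hpN hμ hΩ hg hvpos hξ hξI (Nat.le_ceil p)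
  have hξK : ∀ x ∈ K, ξ x = 1 := fun x hx => hξ1.self_of_nhdsSet x hx
  have hc : 0 < (p - 1) ^ 2 / p := by positivity
  have hmeas : AEStronglyMeasurable (fun x => ‖weakGrad Ω v x‖ / v x) (volume.restrict K) :=
    ((hdvm.norm.div hvm).mono_measure (Measure.restrict_mono hKΩ le_rfl)).aestronglyMeasurable
  have hpos : ∀ᵐ x ∂(volume.restrict K), 0 < v x := ae_restrict_of_ae_restrict_of_subset hKΩ hvpos
  have hLp : MemLp (fun x => ‖weakGrad Ω v x‖ / v x) (ENNReal.ofReal p) (volume.restrict K) := by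
    refine ⟨hmeas, ?_⟩
    rw [eLpNorm_lt_top_iff_lintegral_rpow_enorm_lt_top (by simpa using hp0) ENNReal.ofReal_ne_top,
      ENNReal.toReal_ofReal hp0.le]
    have h1 : ∫⁻ x in K, ENNReal.ofReal ((p - 1) ^ 2 / p) * ‖‖weakGrad Ω v x‖ / v x‖ₑ ^ p
        ≤ ∫⁻ x in Ω, ENNReal.ofReal
          ((p - 1) ^ 2 / p * (ξ x ^ ⌈p⌉₊ * (‖weakGrad Ω v x‖ / v x) ^ p)) := by
      refine le_trans (lintegral_mono_ae ?_) (lintegral_mono_set hKΩ)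
      filter_upwards [hpos, ae_restrict_mem hK.measurableSet] with x hx hxK
      rw [hξK x hxK, one_pow, one_mul, ENNReal.ofReal_mul hc.le,
        ← ENNReal.ofReal_rpow_of_nonneg (by positivity) hp0.le,
        Real.enorm_of_nonneg (by positivity)]
    rw [lintegral_const_mul' _ _ ENNReal.ofReal_ne_top] at h1
    refine ENNReal.lt_top_of_mul_ne_top_right (h1.trans_lt hfin).ne ?_
    simpa using hc
  have : IsFiniteMeasure (volume.restrict K) := ⟨by
    rw [Measure.restrict_apply_univ]
    exact hK.measure_lt_top⟩
  exact hLp.integrable (by simpa using hp.le)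

end LogarithmicEstimate

/-! ### Rigidity, the capacity contradiction, and the theorem. -/

section Conclusion

lemma ratio_bounds {a b : ℝ} (hb : 0 < b) : 0 ≤ max (a - b) 0 ^ 2 / a ^ 2 ∧
    max (a - b) 0 ^ 2 / a ^ 2 ≤ 1 := by
  refine ⟨by positivity, ?_⟩
  rcases le_or_gt a b with h | h
  · rw [max_eq_right (by linarith)]
    simp
  · have : 0 < a := hb.trans h
    rw [max_eq_left (by linarith), div_le_one (by positivity)]
    exact pow_le_pow_left₀ (by linarith) (by linarith) 2

/-- When P = (a / b) Q the two terms cancel up to 2 (a - b - ε) ε / (a² b) Q. The first bound in the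
minimum does not contain ε and serves for domination; the second gives pointwise decay as ε → 0. -/
lemma norm_ratio_gradient_le {F : Type*} [NormedAddCommGroup F] [NormedSpace ℝ F] {ε a b : ℝ}
    (hε : 0 < ε) (hb : 0 < b) {P Q : F} (h : b < a → a⁻¹ • P = b⁻¹ • Q) :
    ‖(2 * (max (a - (b + ε)) 0 * (b + ε)) / a ^ 3) • P
      + (-(2 * max (a - (b + ε)) 0 / a ^ 2)) • Q‖ ≤ min (2 * (‖Q‖ / b)) (2 / |a| * (‖Q‖ / b) * ε) := by
  rcases le_or_gt a (b + ε) with hab | hab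
  · rw [max_eq_right (by linarith)]
    simp only [zero_mul, mul_zero, zero_div, neg_zero, zero_smul, add_zero, norm_zero]
    positivity
  · have ha : 0 < a := by linarith
    have hP : P = (a / b) • Q := by
      have h1 := congrArg (fun z => a • z) (h (by linarith))
      simp only [smul_inv_smul₀ ha.ne', smul_smul] at h1
      rw [h1, div_eq_mul_inv]
    have e : (2 * (max (a - (b + ε)) 0 * (b + ε)) / a ^ 3) • P
        + (-(2 * max (a - (b + ε)) 0 / a ^ 2)) • Q
        = (2 * (a - (b + ε)) * ε / (a ^ 2 * b)) • Q := by
      rw [max_eq_left (by linarith), hP, smul_smul, ← add_smul]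
      congr 1
      field_simp
      ring
    have h0 : 0 ≤ a - (b + ε) := by linarith
    rw [e, norm_smul, Real.norm_of_nonneg (by positivity), abs_of_pos ha]
    have key : 2 * (a - (b + ε)) * ε / (a ^ 2 * b) * ‖Q‖ ≤ 2 / a * (‖Q‖ / b) * ε := by
      rw [show 2 / a * (‖Q‖ / b) * ε = 2 * a * ε / (a ^ 2 * b) * ‖Q‖ by field_simp]
      gcongr
      linarith
    refine le_min (key.trans ?_) key
    calc 2 / a * (‖Q‖ / b) * ε = 2 * (‖Q‖ / b) * (ε / a) := by ring
      _ ≤ 2 * (‖Q‖ / b) := mul_le_of_le_one_right (by positivity)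
          ((div_le_one ha).2 (by linarith))

variable {N : ℕ}

local notation "𝔼" => EuclideanSpace ℝ (Fin N)

/-- The square makes the ratio C¹ in (u, v), and the shift ε keeps u away from 0 on its support, so
the chain rule applies for each ε. As ε → 0 the functions are bounded by 1 and the gradients are
dominated by 2 |∇v| / v and tend to 0. -/
lemma hasWeakGradient_ratio_zero {Ω : Set 𝔼} (hΩ : IsOpen Ω) {u v : 𝔼 → ℝ} {du dv : 𝔼 → 𝔼}
    (hu : HasWeakGradient Ω u du) (hv : HasWeakGradient Ω v dv)
    (hvpos : ∀ᵐ x ∂(volume.restrict Ω), 0 < v x)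
    (hlog : LocallyIntegrableOn (fun x => ‖dv x‖ / v x) Ω)
    (heq : ∀ᵐ x ∂(volume.restrict Ω), v x < u x → (u x)⁻¹ • du x = (v x)⁻¹ • dv x) :
    HasWeakGradient Ω (fun x => max (u x - v x) 0 ^ 2 / u x ^ 2) (fun _ => 0) := by
  have hum : AEMeasurable u (volume.restrict Ω) := hu.1.aestronglyMeasurable.aemeasurable
  have hvm : AEMeasurable v (volume.restrict Ω) := hv.1.aestronglyMeasurable.aemeasurable
  have hm : AEMeasurable (fun x => max (u x - v x) 0 ^ 2 / u x ^ 2) (volume.restrict Ω) :=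
    (((hum.sub hvm).max aemeasurable_const).pow_const 2).div (hum.pow_const 2)
  set ε : ℕ → ℝ := fun n => 1 / ((n : ℝ) + 1) with hεdef
  have hε : ∀ n, 0 < ε n := fun n => by positivity
  have hεl : Tendsto ε atTop (𝓝 0) := tendsto_one_div_add_atTop_nhds_zero_nat
  have hcomp := fun n => hu.comp hΩ (hasBoundedPartials_ratio (hε n)) hv
    (hvpos.mono fun x hx => hx.le)
  refine ⟨?_, (integrable_zero 𝔼 𝔼 volume).locallyIntegrable.locallyIntegrableOn Ω, fun φ hφ => ?_⟩
  · rw [locallyIntegrableOn_iff hΩ.isLocallyClosed]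
    intro K hKΩ hK
    have : IsFiniteMeasure (volume.restrict K) := ⟨by
      rw [Measure.restrict_apply_univ]
      exact hK.measure_lt_top⟩
    refine Integrable.of_bound
      (hm.mono_measure (Measure.restrict_mono hKΩ le_rfl)).aestronglyMeasurable 1 ?_
    filter_upwards [ae_restrict_of_ae_restrict_of_subset hKΩ hvpos] with x hx
    rw [Real.norm_of_nonneg (ratio_bounds hx).1]
    exact (ratio_bounds hx).2
  · have hgi : Integrable (fun x => ‖gradient φ x‖) (volume.restrict Ω) :=
      (hφ.1.continuous_gradient.norm.integrable_of_hasCompactSupport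
        hφ.2.1.gradient.norm).restrict
    have hli : Integrable (fun x => ‖φ x‖ * (2 * (‖dv x‖ / v x))) (volume.restrict Ω) := by
      have h := (hlog.integrable_smul_of_tsupport hφ.1.continuous hφ.2.1 hφ.2.2).norm.const_mul 2
      refine h.restrict.congr ?_
      filter_upwards [hvpos] with x hx
      rw [norm_smul, Real.norm_of_nonneg (by positivity : 0 ≤ ‖dv x‖ / v x)]
      ring
    have l1 : Tendsto (fun n => ∫ x in Ω, (max (u x - (v x + ε n)) 0 ^ 2 / u x ^ 2) • gradient φ x)
        atTop (𝓝 (∫ x in Ω, (max (u x - v x) 0 ^ 2 / u x ^ 2) • gradient φ x)) := by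
      refine tendsto_integral_of_dominated_convergence (fun x => ‖gradient φ x‖) (fun n => ?_) hgi
        (fun n => ?_) (Eventually.of_forall fun x => ?_)
      · exact (hcomp n).1.aestronglyMeasurable.smul hφ.1.continuous_gradient.aestronglyMeasurable
      · filter_upwards [hvpos] with x hx
        have h := ratio_bounds (a := u x) (show 0 < v x + ε n by linarith [hε n])
        rw [norm_smul, Real.norm_of_nonneg h.1]
        exact mul_le_of_le_one_left (norm_nonneg _) h.2
      · have h1 := ((((hεl.const_add (v x)).const_sub (u x)).max
          (tendsto_const_nhds (x := (0 : ℝ)))).pow 2).div_const (u x ^ 2)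
        rw [add_zero] at h1
        exact h1.smul_const _
    have l2 : Tendsto (fun n => ∫ x in Ω, φ x •
        ((2 * (max (u x - (v x + ε n)) 0 * (v x + ε n)) / u x ^ 3) • du x
          + (-(2 * max (u x - (v x + ε n)) 0 / u x ^ 2)) • dv x)) atTop
        (𝓝 (∫ _ in Ω, (0 : 𝔼))) := by
      refine tendsto_integral_of_dominated_convergence _ (fun n => ?_) hli (fun n => ?_) ?_
      · exact hφ.1.continuous.aestronglyMeasurable.smul (hcomp n).2.1.aestronglyMeasurable
      · filter_upwards [hvpos, heq] with x hx hxe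
        rw [norm_smul]
        exact mul_le_mul_of_nonneg_left ((norm_ratio_gradient_le (hε n) hx hxe).trans
          (min_le_left _ _)) (norm_nonneg _)
      · filter_upwards [hvpos, heq] with x hx hxe
        have h0 := hεl.const_mul (2 / |u x| * (‖dv x‖ / v x))
        rw [mul_zero] at h0
        have h1 := (squeeze_zero_norm (fun n => (norm_ratio_gradient_le (hε n) hx
          hxe).trans (min_le_right _ _)) h0).const_smul (φ x)
        rwa [smul_zero] at h1
    have l3 := l2.neg
    simp only [integral_zero, neg_zero] at l3
    simp only [smul_zero, integral_zero, neg_zero]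
    refine tendsto_nhds_unique l1 (l3.congr fun n => ?_)
    exact ((hcomp n).2.2 φ hφ).symm

lemma tendsto_eLpNorm_smul_add {α F : Type*} [MeasurableSpace α] {ν : Measure α}
    [NormedAddCommGroup F] [NormedSpace ℝ F] {q : ENNReal} (hq : 1 ≤ q) {r : ℝ} {w w' : α → F}
    {s s' : ℕ → α → F} (hm : ∀ n, AEStronglyMeasurable (fun x => w x - s n x) ν)
    (hm' : ∀ n, AEStronglyMeasurable (fun x => w' x - s' n x) ν)
    (ht : Tendsto (fun n => eLpNorm (fun x => w x - s n x) q ν) atTop (𝓝 0))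
    (ht' : Tendsto (fun n => eLpNorm (fun x => w' x - s' n x) q ν) atTop (𝓝 0)) :
    Tendsto (fun n => eLpNorm (fun x => (r • w x + w' x) - (r • s n x + s' n x)) q ν) atTop
      (𝓝 0) := by
  have hlim := (ENNReal.Tendsto.const_mul ht (Or.inr (enorm_ne_top (x := r)))).add ht'
  rw [mul_zero, add_zero] at hlim
  refine tendsto_of_tendsto_of_tendsto_of_le_of_le tendsto_const_nhds hlim (fun _ => zero_le)
    fun n => ?_
  have e : (fun x => (r • w x + w' x) - (r • s n x + s' n x))
      = (r • fun x => w x - s n x) + fun x => w' x - s' n x := by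
    ext x
    simp only [Pi.add_apply, Pi.smul_apply, smul_sub]
    abel
  rw [e]
  refine (eLpNorm_add_le ((hm n).const_smul _) (hm' n) hq).trans ?_
  rw [eLpNorm_const_smul]

lemma gradient_smul_add (r : ℝ) {σ σ' : 𝔼 → ℝ} (hσ : Differentiable ℝ σ)
    (hσ' : Differentiable ℝ σ') (x : 𝔼) :
    gradient (fun x => r • σ x + σ' x) x = r • gradient σ x + gradient σ' x := by
  have h1 := (hσ x).hasGradientAt.hasFDerivAt
  have h2 := (hσ' x).hasGradientAt.hasFDerivAt
  have h3 : HasGradientAt (fun x => r • σ x + σ' x) (r • gradient σ x + gradient σ' x) x := by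
    rw [hasGradientAt_iff_hasFDerivAt]
    refine ((h1.const_smul r).add h2).congr_fderiv ?_
    simp
  exact h3.gradient

/-- If `u = κ v` with `κ > 1`, the boundary conditions force the complement to have vanishing
capacity. -/
lemma pCapacity_compl_eq_zero_of_ae_eq_mul {p : ℝ} (hp : 1 < p) (hpN : p < N) {Ω : Set 𝔼}
    (hΩ : IsOpen Ω) (hΩb : Bornology.IsBounded Ωᶜ) {u v : 𝔼 → ℝ}
    (hvpos : ∀ᵐ x ∂(volume.restrict Ω), 0 < v x) {c : ℝ} (hc : 0 < c)
    (hvc : LEOnBoundary p Ω (fun _ => c) v) (huv : LEOnBoundary p Ω u v) {κ : ℝ} (hκ : 1 < κ)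
    (h : ∀ᵐ x ∂(volume.restrict Ω), u x = κ * v x) : pCapacity p Ωᶜ = 0 := by
  have hκ0 : 0 < κ - 1 := by linarith
  obtain ⟨χ, hχ, hχc, hχ1, ⟨hWp, -, hdW⟩, σ, hσ, hl, hdl⟩ := huv
  obtain ⟨χ', hχ', hχc', hχ1', ⟨hWp', -, hdW'⟩, σ', hσ', hl', hdl'⟩ := hvc
  obtain ⟨U, hU, hUΩ, hU1⟩ := eventually_nhdsSet_iff_exists.1 hχ1
  obtain ⟨U', hU', hUΩ', hU1'⟩ := eventually_nhdsSet_iff_exists.1 hχ1'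
  have hse1 : 1 ≤ sobolevExponent N p := by linarith [one_lt_sobolevExponent hp hpN]
  have hse : ENNReal.ofReal (sobolevExponent N p) ≠ 0 := by
    simpa using (by linarith : 0 < sobolevExponent N p)
  have hσg := fun n => gradient_smul_add (κ - 1)⁻¹ ((hσ n).1.differentiable (by simp))
    ((hσ' n).1.differentiable (by simp))
  set w : 𝔼 → ℝ := fun x => χ x * max (u x - v x) 0 with hw
  set w' : 𝔼 → ℝ := fun x => χ' x * max (c - v x) 0 with hw'
  -- With this factor r (u - v)⁺ = v, so near the boundary the combination equals v + (c - v)⁺ ≥ c,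
  -- while it is still approximated by test functions of Ω.
  set r := (κ - 1)⁻¹ with hr
  have hσt : ∀ n, IsTestFunction Ω fun x => r • σ n x + σ' n x := by
    intro n
    have hr1 : ContDiff ℝ ∞ fun x => r • σ n x := (hσ n).1.const_smul r
    refine ⟨hr1.add (hσ' n).1, ?_, ?_⟩
    · exact HasCompactSupport.add ((hσ n).2.1.smul_left (f := fun _ => r)) (hσ' n).2.1
    · refine (tsupport_add _ _).trans (Set.union_subset ?_ (hσ' n).2.2)
      exact (tsupport_smul_subset_right (fun _ => r) (σ n)).trans (hσ n).2.2
  have hWm : AEStronglyMeasurable (fun x => r • w x + w' x) (volume.restrict Ω) :=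
    (hWp.1.const_smul r).add hWp'.1
  have hdWm : MemLp (fun x => r • weakGrad Ω w x + weakGrad Ω w' x) (ENNReal.ofReal p)
      (volume.restrict Ω) := (hdW.const_smul r).add hdW'
  have hlim : Tendsto (fun n => eLpNorm (fun x => (r • w x + w' x) - (r • σ n x + σ' n x))
      (ENNReal.ofReal (sobolevExponent N p)) (volume.restrict Ω)) atTop (𝓝 0) :=
    tendsto_eLpNorm_smul_add (by simpa using hse1)
      (fun n => hWp.1.sub (hσ n).1.continuous.aestronglyMeasurable)
      (fun n => hWp'.1.sub (hσ' n).1.continuous.aestronglyMeasurable) hl hl'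
  have hdlim : Tendsto (fun n => eLpNorm (fun x => (r • weakGrad Ω w x + weakGrad Ω w' x)
      - gradient (fun y => r • σ n y + σ' n y) x) (ENNReal.ofReal p) (volume.restrict Ω)) atTop
      (𝓝 0) := by
    simp only [hσg]
    exact tendsto_eLpNorm_smul_add (by simpa using hp.le)
      (fun n => hdW.1.sub (hσ n).1.continuous_gradient.aestronglyMeasurable)
      (fun n => hdW'.1.sub (hσ' n).1.continuous_gradient.aestronglyMeasurable) hdl hdl'
  refine pCapacity_compl_eq_zero hΩ hΩb hp.le hse hσt hWm hdWm hlim hdlim (hU.inter hU')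
    (Set.subset_inter hUΩ hUΩ') hc ?_
  filter_upwards [h, hvpos] with x hx hvx hxU
  rw [hw, hw']
  simp only
  rw [hU1 x hxU.1, hU1' x hxU.2, one_mul, one_mul, hx, max_eq_left (by nlinarith), smul_eq_mul,
    show κ * v x - v x = (κ - 1) * v x by ring, hr, inv_mul_cancel_left₀ hκ0.ne']
  linarith [le_max_left (c - v x) 0]

end Conclusion

/-- Comparison principle in exterior domains. The growth condition is stated with the positive
part `u⁺` of the (possibly sign-changing) function `u`, as an `ℝ≥0∞`-valued integral, and
`|∇ log v| = |∇v| / v`. -/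
theorem theorem3p3 (N : ℕ) (p μ : ℝ) (hp : 1 < p) (hpN : p < N)
    (hμ : 0 ≤ μ) (hμ' : μ < (((N : ℝ) - p) / p) ^ p)
    (Ω : Set (EuclideanSpace ℝ (Fin N))) (hΩ : IsOpen Ω) (hΩc : IsConnected Ω)
    (hΩb : Bornology.IsBounded Ωᶜ) (hΩcap : 0 < pCapacity p Ωᶜ)
    (f g u v : EuclideanSpace ℝ (Fin N) → ℝ)
    (hf : MemLp f (ENNReal.ofReal (N / p)) (volume.restrict Ω))
    (hg : MemLp g (ENNReal.ofReal (N / p)) (volume.restrict Ω))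
    (hfg : ∀ᵐ x ∂(volume.restrict Ω), f x ≤ g x)
    (hu : IsWeakSubsolution p μ Ω f u)
    (hv : IsWeakSupersolution p μ Ω g v)
    (hvpos : ∀ᵐ x ∂(volume.restrict Ω), 0 < v x)
    (hvbdry : ∃ c : ℝ, 0 < c ∧ LEOnBoundary p Ω (fun _ => c) v)
    (hgrowth : limsup (fun R : ℝ => ENNReal.ofReal R⁻¹ *
      ∫⁻ x in Metric.ball 0 (2 * R) \ Metric.ball 0 R,
        ENNReal.ofReal (max (u x) 0 ^ p * (‖weakGrad Ω v x‖ / v x) ^ (p - 1))) atTop = 0)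
    (huv : LEOnBoundary p Ω u v) :
    ∀ᵐ x ∂(volume.restrict Ω), u x ≤ v x := by

  have hv0 : ∀ᵐ x ∂(volume.restrict Ω), 0 ≤ v x := hvpos.mono fun x hx => hx.le
  obtain ⟨hvw, -, -, -⟩ := hv.hasWeakGradient hΩ
  have hlog := hv.locallyIntegrableOn_log_gradient hp hpN hμ hΩ hg hvpos
  have heq := ae_log_gradient_eq hp hpN hμ hΩ hΩb hf hg hfg hu hv hvpos hgrowth huv
  obtain ⟨c, hc⟩ := (hasWeakGradient_ratio_zero hΩ (hasWeakGradient_weakGrad hu.1.2.1) hvw hvpos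
    hlog heq).exists_ae_eq_const hΩ hΩc
  rcases eq_or_ne c 0 with rfl | hc0
  · filter_upwards [hc, hvpos] with x hx hvx
    by_contra! hlt
    have h1 : 0 < u x := hvx.trans hlt
    have h2 : 0 < u x - v x := by linarith
    rw [max_eq_left h2.le] at hx
    have : 0 < (u x - v x) ^ 2 / u x ^ 2 := by positivity
    linarith
  · exfalso
    -- A nonzero constant excludes u ≤ v on any set of positive measure, because the ratio is zero
    -- there.
    have hlt : ∀ᵐ x ∂(volume.restrict Ω), 0 < v x ∧ v x < u x ∧ ((u x - v x) / u x) ^ 2 = c := by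
      filter_upwards [hc, hvpos] with x hx hvx
      have h1 : v x < u x := by
        by_contra! hle
        rw [max_eq_right (by linarith)] at hx
        exact hc0 (by simpa using hx.symm)
      refine ⟨hvx, h1, ?_⟩
      rwa [max_eq_left (by linarith), ← div_pow] at hx
    have hne : (ae (volume.restrict Ω)).NeBot := by
      rw [ae_neBot, Ne, Measure.restrict_eq_zero]
      exact (hΩ.measure_pos volume hΩc.nonempty).ne'
    -- (u - v)/u is positive with square c, so it equals √c and v is a fixed multiple of u. As 0 < v
    -- < u, the multiple lies strictly between 0 and 1, which gives κ > 1 for its inverse.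
    have hsq : ∀ᵐ x ∂(volume.restrict Ω), v x = (1 - √c) * u x := by
      filter_upwards [hlt] with x hx
      obtain ⟨h1, h2, h3⟩ := hx
      have h4 : 0 < u x := h1.trans h2
      rw [← h3, Real.sqrt_sq (div_nonneg (by linarith) h4.le)]
      field_simp
      ring
    have hκ : 0 < 1 - √c ∧ 1 - √c < 1 := by
      obtain ⟨x, ⟨h1, h2, h3⟩, h4⟩ := (hlt.and hsq).exists
      have h5 : 0 < u x := h1.trans h2
      rw [h4] at h1 h2
      exact ⟨(pos_iff_pos_of_mul_pos h1).2 h5, by nlinarith⟩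
    obtain ⟨d, hd, hdv⟩ := hvbdry
    refine hΩcap.ne' (pCapacity_compl_eq_zero_of_ae_eq_mul hp hpN hΩ hΩb hvpos hd hdv huv
      (κ := (1 - √c)⁻¹) ((one_lt_inv₀ hκ.1).2 hκ.2) ?_)
    filter_upwards [hsq] with x hx
    rw [hx, inv_mul_cancel_left₀ hκ.1.ne']
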